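/- **Setting.** Let $\kappa_1<\dots<\kappa_n$ be real and let $A$ be a real $k\times n$ matrix of rank $k$ with non-negative maximal minors. Let $T$ be a Le-tableau representing $[A]$: it has pivots $i_1<\dots<i_k$ in $[n]$; its boxes are the pairs $(r,j)$ with $r\in[k]$, $j>i_r$ a non-pivot; each box is filled with $0$ or with a weight $w_{rj}>0$ (a *filled* box) such that if $r<s$, $i_s<i<j$ and $(r,i),(s,j)$ are filled then $(s,i)$ is filled. In its network the source of row $r$ is joined to the first filled box of the row, each filled box is joined to the next one on its left in its row (larger column index), each horizontal edge carrying the weight of the box it enters, and to the next one below it in its column, or, if there is none, to the sink of that column, with weight $1$. That $T$ represents $[A]$ means $A=G\,A_T$ with $\det G>0$, where $A_T$ has entry $1$ at $(r,i_r)$ and at $(r,j)$ the entry $(-1)^{\#\{s:\,i_r<i_s<j\}}$ times the sum over the paths from source $r$ to sink $j$ of the products of weights. Let $g$ be the number of filled boxes, i.e. the dimension of the positroid cell of $[A]$. A row (and its source) is *isolated* if it has no filled box; let $k'$ be the number of rows that are not isolated. **Edge functions.** Times are $t=(t_1=x,t_2,\dots)$, real with finitely many non-zero entries, $\theta(\zeta,t)=\sum_l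 t_l\zeta^l$, $\theta_j=\theta(\kappa_j,\cdot)$. *White vertices* are $V_r$ $(r\in[k])$ and $V_b$ ($b$ a filled box); *black vertices* are $V'_b$. For $b$ in row $r$ let $\Phi^{(3)}_b=\sum_j(-1)^{\#\{s:\,i_r<i_s<j\}}p_{b,j}e^{\theta_j}$, where $p_{b,j}$ is the weighted number of paths from $b$ to sink $j$, and let $\Phi^{(2)}_b$ be the same sum over the paths that leave $b$ downwards; $\Phi^{(2)}_r=e^{\theta_{i_r}}$. At any white vertex, $\Phi^{(1)}=w_{b'}\Phi^{(3)}_{b'}$ with $b'$ the next filled box to the left in the row (resp. the first one for $V_r$), and $\Phi^{(1)}=0$ if there is none; $\Phi^{(3)}_r=\Phi^{(1)}_r+\Phi^{(2)}_r$. One has $\Phi^{(3)}=\Phi^{(1)}+\Phi^{(2)}$ at all white vertices. **Curve.** $\Gamma$ is the union of copies of $\mathbb{CP}^1$ with coordinate $\zeta$: $\Gamma_0$ with $P_0=\{\zeta=\infty\}$, $\Gamma_r$ and $\Gamma_b$ for the white vertices, $\Sigma_b$ for the black ones. Glued pairs: $1\in\Gamma_r$ with $\kappa_{i_r}\in\Gamma_0$;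 $0\in\Gamma_r$ with $1\in\Sigma_b$, $b$ the first filled box of row $r$; $0\in\Gamma_b$ with $1\in\Sigma_{b'}$, $b'$ the next filled box to the left; $\infty\in\Gamma_b$ with $0\in\Sigma_b$; $1\in\Gamma_b$ with $\infty\in\Sigma_{b'}$, $b'$ the next filled box below $b$, or with $\kappa_j\in\Gamma_0$ if there is none and $b$ is in column $j$. The ovals of $\Gamma$ are the faces of the planar network: the real circles, oriented by increasing $\zeta$, are cut at the glued points into arcs, and the arc that ends at a glued point $p$ is continued by the arc that begins at the point glued to $p$. The infinite oval is the one through $P_0$; the others are finite. **Dressing.** Let $f^{(i)}=\sum_jA_{ij}e^{\theta_j}$, let $\mathfrak D=\partial_x^k-\mathfrak w_1\partial_x^{k-1}-\dots-\mathfrak w_k$ be the operator with $\mathfrak Df^{(i)}=0$ for $i\in[k]$, and $S_t(\zeta)=\zeta^k-\mathfrak w_1(t)\zeta^{k-1}-\dots-\mathfrak w_k(t)$. Put $q(\zeta)=\prod(\zeta-\kappa_{i_r})$ over the isolated rows, $S'_t=S_t/q$, and let $\mathfrak D'$ be the operator of order $k'$ with symbol $S'_t$, so $\mathfrak D=\mathfrak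 D'q(\partial_x)$; if no row is isolated then $\mathfrak D'=\mathfrak D$. Fix $t_0$. The vacuum wave function $\hat\phi$ is $e^{\theta(\zeta,t-t_0)}$ on $\Gamma_0$; on the component of a white vertex with $\Phi^{(1)}\neq0$ it is $$\hat\phi=\frac{\Phi^{(1)}(t)(\zeta-1)+\Phi^{(2)}(t)\zeta}{\Phi^{(3)}(t_0)(\zeta-\gamma)},\qquad \gamma=\frac{\Phi^{(1)}(t_0)}{\Phi^{(3)}(t_0)};$$ on the other white components and on $\Sigma_b$ it is $\Phi^{(3)}(t)/\Phi^{(3)}(t_0)$ (with $\Phi^{(3)}_b$ on $\Sigma_b$). $D_{\rm vac}$ is the sum of the points $\gamma$. Let $\psi=\mathfrak D\hat\phi$, except that on $\Gamma_0$ and on the components of isolated rows $\psi=\mathfrak D'\hat\phi$; let $\hat\psi(P,t)=\psi(P,t)/\psi(P,t_0)$, $D_{\rm dr}=D_{\rm vac}+k'P_0-\sum_rP_r$, where $P_r=\{\zeta=\infty\}\in\Gamma_r$ and $r$ runs over the non-isolated rows, and $D_{\rm KP}=D_{\rm dr}+(\psi(\cdot,t_0))$. Call $t_0$ *admissible* if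 at $t_0$ no $\Phi^{(2)},\Phi^{(3)}$ and no $\Phi^{(1)}\not\equiv0$ vanishes and $\psi(\cdot,t_0)$ is finite and non-zero at all glued points. **Theorem.** All $t_0=(x,0,0,\dots)$ with $x$ large enough are admissible. For every admissible $t_0$, $\psi(\cdot,t_0)$ is meromorphic and not identically zero on each component of $\Gamma$, and: 1. $D_{\rm KP}$ is effective, of degree $g$, contains neither $P_0$ nor a glued point, and is non-special: a meromorphic function $f$ on $\Gamma$ (rational on each component, with equal values at glued points) with $(f)+D_{\rm KP}\ge0$ is constant. 2. The restriction of $D_{\rm KP}$ to $\Gamma_0$ is the (reduced) Sato divisor at $t_0$, i.e. the zeros of $S'_{t_0}$ with multiplicity. 3. All points of $D_{\rm KP}$ are real and lie on finite ovals, and every finite oval contains exactly one of them, with multiplicity one. 4. $\hat\psi$ is the KP wave function on $\Gamma$ for the soliton data: $\hat\psi(\cdot,t_0)=1$; for every $t$ it is meromorphic on $\Gamma\setminus P_0$ with $(\hat\psi(\cdot,t))+D_{\rm KP}\ge0$ there, and takes equal values at glued points; near $P_0$ it is $e^{\theta(\zeta,t-t_0)}(1+O(\zeta^{-1}))$, the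 second factor being analytic in $\zeta^{-1}$; on $\Gamma_0$ it is the normalized Sato wave function $\mathfrak De^{\theta}(\zeta,t)/\mathfrak De^{\theta}(\zeta,t_0)$ (for $q(\zeta)\ne0$). For every $t$, for all but finitely many real $x$ the pole divisor of $\hat\psi(\cdot,t+(x,0,0,\dots))$ on $\Gamma\setminus P_0$ is exactly $D_{\rm KP}$. -/

import Mathlib

open Filter Topology
open scoped OnePoint

/-! ### Le-tableaux and their networks -/

/-- A Le-tableau with pivot set `{pivot 0 < ⋯ < pivot (k-1)} ⊆ Fin n`. The box in row `r` and column
`j` exists when `j` is a non-pivot index larger than `pivot r`; `weight r j` is its filling: `0` for a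
box filled with `0` (and where there is no box), and the positive weight of a box filled with `1`.
Rows are numbered from top to bottom and columns from right to left. -/
structure LeTableau (k n : ℕ) where
  pivot : Fin k → Fin n
  pivot_strictMono : StrictMono pivot
  weight : Fin k → Fin n → ℝ
  weight_nonneg : ∀ r j, 0 ≤ weight r j
  box_of_weight_ne : ∀ r j, weight r j ≠ 0 → pivot r < j ∧ j ∉ Set.range pivot
  le_rule : ∀ (r s : Fin k) (i j : Fin n), r < s → i < j → pivot s < i →
    weight r i ≠ 0 → weight s j ≠ 0 → weight s i ≠ 0

namespace LeTableau

variable {k n : ℕ}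

/-- The boxes filled with `1`. -/
abbrev Box (T : LeTableau k n) : Type := {b : Fin k × Fin n // T.weight b.1 b.2 ≠ 0}

noncomputable instance (T : LeTableau k n) : Fintype T.Box := Fintype.ofFinite _

/-- The number of boxes filled with `1`: the dimension of the positroid cell of the tableau
(the weights of these boxes are free positive coordinates on the cell). -/
noncomputable def dim (T : LeTableau k n) : ℕ := Nat.card T.Box

/-- The row `r` has a box filled with `1`, i.e. the boundary source of row `r` is not isolated. -/
def RowNonempty (T : LeTableau k n) (r : Fin k) : Prop := ∃ j, T.weight r j ≠ 0

/-- `b` is the first filled box of the row `r` met when moving left from the boundary source. -/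
def First (T : LeTableau k n) (r : Fin k) (b : T.Box) : Prop :=
  b.1.1 = r ∧ ∀ b' : T.Box, b'.1.1 = r → b.1.2 ≤ b'.1.2

/-- `b'` is the next filled box to the left of `b` in the same row. -/
def Next (T : LeTableau k n) (b b' : T.Box) : Prop :=
  b'.1.1 = b.1.1 ∧ b.1.2 < b'.1.2 ∧ ∀ c : T.Box, c.1.1 = b.1.1 → b.1.2 < c.1.2 → b'.1.2 ≤ c.1.2

/-- `b'` is the next filled box below `b` in the same column. -/
def Below (T : LeTableau k n) (b b' : T.Box) : Prop :=
  b'.1.2 = b.1.2 ∧ b.1.1 < b'.1.1 ∧ ∀ c : T.Box, c.1.2 = b.1.2 → b.1.1 < c.1.1 → b'.1.1 ≤ c.1.1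

/-- There is no filled box below `b`, so that the vertical edge at `b` ends at a boundary sink. -/
def Bottom (T : LeTableau k n) (b : T.Box) : Prop :=
  ∀ c : T.Box, c.1.2 = b.1.2 → c.1.1 ≤ b.1.1

/-- Vertices of the Le-network: boundary sources (one for each row), filled boxes, and boundary
sinks (labelled by all of `Fin n`; a pivot label is an isolated vertex). -/
abbrev Vertex (T : LeTableau k n) : Type := Fin k ⊕ T.Box ⊕ Fin n

open Classical in
/-- The weights of the oriented edges of the Le-network (`0` for pairs that are not joined):
horizontal edges are oriented to the left and carry the weight of the box that they enter, vertical
edges are oriented downwards and have weight `1`. -/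
noncomputable def edgeWeight (T : LeTableau k n) : T.Vertex → T.Vertex → ℝ
  | .inl r, .inr (.inl b) => if T.First r b then T.weight b.1.1 b.1.2 else 0
  | .inr (.inl b), .inr (.inl b') =>
      if T.Next b b' then T.weight b'.1.1 b'.1.2 else if T.Below b b' then 1 else 0
  | .inr (.inl b), .inr (.inr j) => if T.Bottom b ∧ b.1.2 = j then 1 else 0
  | _, _ => 0

open Classical in
/-- The sum over all oriented paths from `u` to `v` of the products of the weights of their edges.
The `(u, v)` entry of the `m`-th power of the weight matrix is this sum over the paths with `m` edges;
as the network is acyclic, every path has fewer edges than there are vertices. -/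
noncomputable def pathSum (T : LeTableau k n) (u v : T.Vertex) : ℝ :=
  ∑ m ∈ Finset.range (Fintype.card T.Vertex), ((Matrix.of T.edgeWeight) ^ m) u v

/-- The sign `(-1)^σ`, `σ` being the number of pivots strictly between `pivot r` and `j`. -/
noncomputable def rowSign (T : LeTableau k n) (r : Fin k) (j : Fin n) : ℝ :=
  (-1) ^ Nat.card {s : Fin k // T.pivot r < T.pivot s ∧ T.pivot s < j}

open Classical in
/-- The boundary measurement matrix of the Le-network, in reduced row echelon form. -/
noncomputable def matrix (T : LeTableau k n) : Matrix (Fin k) (Fin n) ℝ := fun r j =>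
  if j = T.pivot r then 1 else T.rowSign r j * T.pathSum (.inl r) (.inr (.inr j))

/-- The Le-tableau represents the point `[A]` of `GL⁺ \ Mat`. -/
def Represents (T : LeTableau k n) (A : Matrix (Fin k) (Fin n) ℝ) : Prop :=
  ∃ G : Matrix (Fin k) (Fin k) ℝ, 0 < G.det ∧ A = G * T.matrix

/-! ### Edge vectors of the trivalent bipartite network

A filled box `b` gives a black vertex and a white vertex; every row `r` has one more white vertex, next
to its boundary source. At a white vertex the edge `1` is the horizontal edge going left, the edge `2`
is the vertical edge going down, and the edge `3` is the horizontal edge coming from the right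
(for the white vertex at a boundary source, the edge `3` is the Darboux edge). -/

/-- White vertices: `inl r` is joined to the boundary source of row `r`, `inr b` belongs to the box `b`. -/
abbrev White (T : LeTableau k n) : Type := Fin k ⊕ T.Box

/-- The white vertex has an edge `1`, i.e. there is a filled box to its left in its row. -/
def HasLeft (T : LeTableau k n) : T.White → Prop
  | .inl r => T.RowNonempty r
  | .inr b => ∃ b', T.Next b b'

/-- Edge vector on the edge `3` of the white vertex of a box: signed sums over all paths from it. -/
noncomputable def boxVec (T : LeTableau k n) (b : T.Box) : Fin n → ℝ := fun j =>
  T.rowSign b.1.1 j * T.pathSum (.inr (.inl b)) (.inr (.inr j))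

open Classical in
/-- Edge vector on the edge `1`: the weight of the edge times the vector of the next box to the left
(`0` if there is no such box). -/
noncomputable def vec1 (T : LeTableau k n) : T.White → Fin n → ℝ
  | .inl r => ∑ b : T.Box, if T.First r b then T.weight b.1.1 b.1.2 • T.boxVec b else 0
  | .inr b => ∑ b' : T.Box, if T.Next b b' then T.weight b'.1.1 b'.1.2 • T.boxVec b' else 0

open Classical in
/-- Edge vector on the edge `2`: the basis vector of the pivot at a boundary source; at a box, the signed
sums over all paths that leave the box downwards. -/
noncomputable def vec2 (T : LeTableau k n) : T.White → Fin n → ℝ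
  | .inl r => Pi.single (T.pivot r) 1
  | .inr b => fun j => T.rowSign b.1.1 j *
      ((if T.Bottom b ∧ b.1.2 = j then 1 else 0) +
        ∑ b' : T.Box, if T.Below b b' then T.pathSum (.inr (.inl b')) (.inr (.inr j)) else 0)

/-- Edge vector on the edge `3`. -/
noncomputable def vec3 (T : LeTableau k n) (v : T.White) : Fin n → ℝ := T.vec1 v + T.vec2 v

/-! ### The reducible rational curve

The curve is a union of copies of the projective line with the affine coordinate `ζ`, glued at pairs of
real points. -/

/-- The irreducible components: `base` is `Γ₀`, and there is one component for each white and for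
each black vertex. -/
inductive Component (T : LeTableau k n) : Type
  | base : Component T
  | white (v : T.White) : Component T
  | black (b : T.Box) : Component T

/-- Points of the components, in the affine coordinate; `P₀` is the point `∞` of `base`. -/
abbrev Point (T : LeTableau k n) : Type := T.Component × OnePoint ℂ

/-- Real points of the components; `⊤` is the point `ζ = ∞`. -/
abbrev RealPoint (T : LeTableau k n) : Type := T.Component × WithTop ℝ

/-- The inclusion of the real points. -/
noncomputable def RealPoint.toPoint {T : LeTableau k n} : T.RealPoint → T.Point
  | (c, ⊤) => (c, ∞)
  | (c, (x : ℝ)) => (c, ((x : ℂ) : OnePoint ℂ))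

/-- The pairs of glued points, one for each edge of the network. On the components of white and
black vertices the marked points `1`, `2`, `3` have the coordinates `0`, `1`, `∞`; at a black vertex
the edge `1` goes left, the edge `2` comes from the right and the edge `3` comes from above. -/
inductive Glued (T : LeTableau k n) (κ : Fin n → ℝ) : T.RealPoint → T.RealPoint → Prop
  | source (r : Fin k) : Glued T κ (.white (.inl r), (1 : ℝ)) (.base, (κ (T.pivot r) : ℝ))
  | first (r : Fin k) (b : T.Box) (h : T.First r b) :
      Glued T κ (.white (.inl r), (0 : ℝ)) (.black b, (1 : ℝ))
  | next (b b' : T.Box) (h : T.Next b b') :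
      Glued T κ (.white (.inr b), (0 : ℝ)) (.black b', (1 : ℝ))
  | box (b : T.Box) : Glued T κ (.white (.inr b), ⊤) (.black b, (0 : ℝ))
  | down (b b' : T.Box) (h : T.Below b b') :
      Glued T κ (.white (.inr b), (1 : ℝ)) (.black b', ⊤)
  | sink (b : T.Box) (h : T.Bottom b) :
      Glued T κ (.white (.inr b), (1 : ℝ)) (.base, (κ b.1.2 : ℝ))

/-- The double points (seen on the components). -/
def IsNode (T : LeTableau k n) (κ : Fin n → ℝ) (x : T.RealPoint) : Prop :=
  ∃ y, T.Glued κ x y ∨ T.Glued κ y x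

/-! ### Ovals

The real part of a component is a circle, oriented by increasing `ζ`; this is the counterclockwise
orientation at every vertex of the planar graph, `base` being the vertex at the complement of the disk.
Removing the nodes cuts the circles into arcs. Walking along a face of the graph, an arc that ends at a
node `p` is continued by the arc that begins at the point `q` glued to `p`. The ovals are the cycles of
arcs obtained in this way, i.e. the faces of the graph. -/

end LeTableau

/-- Strict cyclic order on the real projective line `WithTop ℝ`. -/
def StrictCyclic (a b c : WithTop ℝ) : Prop := (a < b ∧ b < c) ∨ (b < c ∧ c < a) ∨ (c < a ∧ a < b)

namespace LeTableau

variable {k n : ℕ}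

/-- Going from `x` to `y` in the positive direction on the component `c` one meets no node strictly
between them. -/
def FreeArc (T : LeTableau k n) (κ : Fin n → ℝ) (c : T.Component) (x y : WithTop ℝ) : Prop :=
  ∀ p, T.IsNode κ (c, p) → ¬ StrictCyclic x p y

/-- Two real smooth points lie on the same arc, or on arcs that follow each other on an oval. -/
inductive OvalStep (T : LeTableau k n) (κ : Fin n → ℝ) : T.RealPoint → T.RealPoint → Prop
  | arc (c : T.Component) (x y : WithTop ℝ) (hx : ¬ T.IsNode κ (c, x)) (hy : ¬ T.IsNode κ (c, y))
      (h : T.FreeArc κ c x y) : OvalStep T κ (c, x) (c, y)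
  | cross (c c' : T.Component) (x p q y : WithTop ℝ)
      (hx : ¬ T.IsNode κ (c, x)) (hy : ¬ T.IsNode κ (c', y))
      (hglue : T.Glued κ (c, p) (c', q) ∨ T.Glued κ (c', q) (c, p))
      (hxp : T.FreeArc κ c x p) (hqy : T.FreeArc κ c' q y) : OvalStep T κ (c, x) (c', y)

/-- Two real smooth points lie on the same oval. -/
def SameOval (T : LeTableau k n) (κ : Fin n → ℝ) : T.RealPoint → T.RealPoint → Prop :=
  Relation.EqvGen (T.OvalStep κ)

/-- The real smooth point `x` lies on a finite oval, i.e. not on the oval of `P₀`. -/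
def OnFiniteOval (T : LeTableau k n) (κ : Fin n → ℝ) (x : T.RealPoint) : Prop :=
  ¬ T.IsNode κ x ∧ ¬ T.SameOval κ (.base, ⊤) x

end LeTableau

/-! ### Functions on the projective line in the affine coordinate -/

/-- The function `f` of the affine coordinate has the limit `v` at the point `p`. -/
def HasValueAt (f : ℂ → ℂ) (p : OnePoint ℂ) (v : ℂ) : Prop :=
  Tendsto f (comap ((↑) : ℂ → OnePoint ℂ) (𝓝[≠] p)) (𝓝 v)

/-- `f` is meromorphic at the point `p`; at `∞` the local parameter is `1 / ζ`. -/
def MeromorphicAtPoint (f : ℂ → ℂ) (p : OnePoint ℂ) : Prop :=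
  p.elim (MeromorphicAt (fun u => f u⁻¹) 0) (fun z => MeromorphicAt f z)

/-- The order of `f` at the point `p` (`⊤` if `f` vanishes identically near `p`). -/
noncomputable def orderAtPoint (f : ℂ → ℂ) (p : OnePoint ℂ) : WithTop ℤ :=
  p.elim (meromorphicOrderAt (fun u => f u⁻¹) 0) (fun z => meromorphicOrderAt f z)

/-! ### Heat hierarchy and Darboux dressing -/

/-- KP times `(t₁, t₂, …)`, finitely many of them non-zero; `t l` is `t_{l+1}`. -/
abbrev KPTime : Type := ℕ →₀ ℝ

/-- `θ(ζ, t) = ∑_{l ≥ 1} t_l ζ^l`. -/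
noncomputable def kpTheta (ζ : ℂ) (t : KPTime) : ℂ := t.sum fun l c => (c : ℂ) * ζ ^ (l + 1)

/-- `θ(ζ, t)` for real `ζ`. -/
noncomputable def kpThetaReal (ζ : ℝ) (t : KPTime) : ℝ := t.sum fun l c => c * ζ ^ (l + 1)

/-- The time `t` with `x = t₁` increased by `x`. -/
noncomputable def shiftX (t : KPTime) (x : ℝ) : KPTime := t + Finsupp.single 0 x

/-- The heat hierarchy solution `∑_j v_j e^{θ_j(t)}`. -/
noncomputable def expSum {n : ℕ} (κ : Fin n → ℝ) (v : Fin n → ℝ) (t : KPTime) : ℝ :=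
  ∑ j, v j * Real.exp (kpThetaReal (κ j) t)

/-- The coefficients `c_0, …, c_{k-1}` of the solution of `∂_x^k f^{(i)} = ∑_m c_m ∂_x^m f^{(i)}`,
where `f^{(i)} = ∑_j A_{ij} e^{θ_j}`, so that `𝔴_m = c_{k-m}`. -/
noncomputable def dressingCoeff {k n : ℕ} (κ : Fin n → ℝ) (A : Matrix (Fin k) (Fin n) ℝ)
    (t : KPTime) : Fin k → ℝ :=
  Matrix.mulVec
    (Matrix.of fun i m : Fin k => iteratedDeriv (m : ℕ) (fun x => expSum κ (A i) (shiftX t x)) 0)⁻¹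
    (fun i => iteratedDeriv k (fun x => expSum κ (A i) (shiftX t x)) 0)

/-- The characteristic polynomial `ζ^k - 𝔴_1(t) ζ^{k-1} - ⋯ - 𝔴_k(t)` of the Darboux operator. -/
noncomputable def satoPoly {k n : ℕ} (κ : Fin n → ℝ) (A : Matrix (Fin k) (Fin n) ℝ)
    (t : KPTime) : Polynomial ℝ :=
  Polynomial.X ^ k - ∑ m : Fin k, Polynomial.C (dressingCoeff κ A t m) * Polynomial.X ^ (m : ℕ)

/-- The ordinary differential operator in `x` with symbol `p` (at each time `t`) applied to `F`. -/
noncomputable def dress (p : KPTime → Polynomial ℝ) (F : KPTime → ℂ) (t : KPTime) : ℂ :=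
  (p t).sum fun m c => (c : ℂ) * iteratedDeriv m (fun x : ℝ => F (shiftX t x)) 0

/-- `A` has rank `k` and non-negative maximal minors. -/
def IsTotallyNonneg {k n : ℕ} (A : Matrix (Fin k) (Fin n) ℝ) : Prop :=
  A.rank = k ∧ ∀ J : Fin k ↪o Fin n, 0 ≤ (A.submatrix id J).det

namespace LeTableau

variable {k n : ℕ}

/-- The number of rows whose boundary source is not isolated: the order of the reduced operator. -/
noncomputable def reducedOrder (T : LeTableau k n) : ℕ := Nat.card {r : Fin k // T.RowNonempty r}

open Classical in
/-- The product of the linear factors `ζ - κ_i` over the isolated boundary sources `i`. -/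
noncomputable def isolatedFactor (T : LeTableau k n) (κ : Fin n → ℝ) : Polynomial ℝ :=
  ∏ r : Fin k, if T.RowNonempty r then 1 else Polynomial.X - Polynomial.C (κ (T.pivot r))

/-- The characteristic polynomial of the reduced Darboux operator: the linear factors of the isolated
boundary sources are removed. It equals `satoPoly` if there are none. -/
noncomputable def reducedSatoPoly (T : LeTableau k n) (κ : Fin n → ℝ) (A : Matrix (Fin k) (Fin n) ℝ)
    (t : KPTime) : Polynomial ℝ :=
  satoPoly κ A t /ₘ T.isolatedFactor κ

/-! ### The vacuum wave function and its dressing -/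

/-- The vacuum edge wave functions on the edges `1`, `2`, `3` of a white vertex. -/
noncomputable def Phi1 (T : LeTableau k n) (κ : Fin n → ℝ) (v : T.White) (t : KPTime) : ℝ :=
  expSum κ (T.vec1 v) t

noncomputable def Phi2 (T : LeTableau k n) (κ : Fin n → ℝ) (v : T.White) (t : KPTime) : ℝ :=
  expSum κ (T.vec2 v) t

noncomputable def Phi3 (T : LeTableau k n) (κ : Fin n → ℝ) (v : T.White) (t : KPTime) : ℝ :=
  expSum κ (T.vec3 v) t

/-- The coordinate of the vacuum divisor point on the component of a white vertex with an edge `1`. -/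
noncomputable def vacPole (T : LeTableau k n) (κ : Fin n → ℝ) (t₀ : KPTime) (v : T.White) : ℝ :=
  T.Phi1 κ v t₀ / T.Phi3 κ v t₀

open Classical in
/-- The normalized vacuum wave function `φ̂(ζ, t)` on each component, in the affine coordinate. -/
noncomputable def vacuumWave (T : LeTableau k n) (κ : Fin n → ℝ) (t₀ : KPTime) :
    T.Component → ℂ → KPTime → ℂ
  | .base, ζ, t => Complex.exp (kpTheta ζ (t - t₀))
  | .white v, ζ, t =>
      if T.HasLeft v then
        ((T.Phi1 κ v t : ℂ) * (ζ - 1) + (T.Phi2 κ v t : ℂ) * ζ) /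
          ((T.Phi3 κ v t₀ : ℂ) * (ζ - (T.vacPole κ t₀ v : ℂ)))
      else (T.Phi3 κ v t : ℂ) / (T.Phi3 κ v t₀ : ℂ)
  | .black b, _, t => (T.Phi3 κ (.inr b) t : ℂ) / (T.Phi3 κ (.inr b) t₀ : ℂ)

open Classical in
/-- The vacuum divisor. -/
noncomputable def vacuumDivisor (T : LeTableau k n) (κ : Fin n → ℝ) (t₀ : KPTime) : T.Point → ℤ
  | (.white v, p) => if T.HasLeft v ∧ p = ((T.vacPole κ t₀ v : ℂ) : OnePoint ℂ) then 1 else 0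
  | _ => 0

open Classical in
/-- The dressed wave function `ψ(ζ, t) = 𝔇 φ̂(ζ, t)`.
If there are isolated boundary sources, `𝔇 = 𝔇' ∘ ∏ (∂_x - κ_i)`, the product being over these sources,
where `𝔇'` is the reduced Darboux operator; the vanishing factors are then removed on `Γ₀` and on the
components of the isolated sources, where `𝔇'` is used. If there are none, `𝔇' = 𝔇`. -/
noncomputable def dressedWave (T : LeTableau k n) (κ : Fin n → ℝ) (A : Matrix (Fin k) (Fin n) ℝ)
    (t₀ : KPTime) : T.Component → ℂ → KPTime → ℂ
  | .base, ζ, t => dress (T.reducedSatoPoly κ A) (T.vacuumWave κ t₀ .base ζ) t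
  | .white (.inl r), ζ, t =>
      if T.RowNonempty r then dress (satoPoly κ A) (T.vacuumWave κ t₀ (.white (.inl r)) ζ) t
      else dress (T.reducedSatoPoly κ A) (T.vacuumWave κ t₀ (.white (.inl r)) ζ) t
  | .white (.inr b), ζ, t => dress (satoPoly κ A) (T.vacuumWave κ t₀ (.white (.inr b)) ζ) t
  | .black b, ζ, t => dress (satoPoly κ A) (T.vacuumWave κ t₀ (.black b) ζ) t

/-- The normalized dressed wave function `ψ̂(ζ, t) = ψ(ζ, t) / ψ(ζ, t₀)`. -/
noncomputable def kpWave (T : LeTableau k n) (κ : Fin n → ℝ) (A : Matrix (Fin k) (Fin n) ℝ)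
    (t₀ : KPTime) (c : T.Component) (ζ : ℂ) (t : KPTime) : ℂ :=
  T.dressedWave κ A t₀ c ζ t / T.dressedWave κ A t₀ c ζ t₀

/-- The initial time is admissible: the vacuum edge wave functions do not vanish at `t₀` on the edges
of the network, and the dressed wave function does not vanish at `t₀` at the double points. -/
def Admissible (T : LeTableau k n) (κ : Fin n → ℝ) (A : Matrix (Fin k) (Fin n) ℝ)
    (t₀ : KPTime) : Prop :=
  (∀ v : T.White, (T.HasLeft v → T.Phi1 κ v t₀ ≠ 0) ∧ T.Phi2 κ v t₀ ≠ 0 ∧ T.Phi3 κ v t₀ ≠ 0) ∧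
  ∀ x : T.RealPoint, T.IsNode κ x →
    ∃ a : ℂ, a ≠ 0 ∧ HasValueAt (fun ζ => T.dressedWave κ A t₀ x.1 ζ t₀) x.toPoint.2 a

open Classical in
/-- `D_dr = D_vac + k P₀ - ∑ P_{i_r}`, where the `P_{i_r}` are the Darboux points (`k` is the order of
the reduced operator, and the sum is over the boundary sources that are not isolated). -/
noncomputable def dressedDivisor (T : LeTableau k n) (κ : Fin n → ℝ) (t₀ : KPTime)
    (P : T.Point) : ℤ :=
  T.vacuumDivisor κ t₀ P + (if P = (.base, ∞) then (T.reducedOrder : ℤ) else 0)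
    - (if ∃ r, T.RowNonempty r ∧ P = (.white (.inl r), ∞) then 1 else 0)

/-- `D_KP = D_dr + (ψ(·, t₀))`. -/
noncomputable def kpDivisor (T : LeTableau k n) (κ : Fin n → ℝ) (A : Matrix (Fin k) (Fin n) ℝ)
    (t₀ : KPTime) (P : T.Point) : ℤ :=
  T.dressedDivisor κ t₀ P + (orderAtPoint (fun ζ => T.dressedWave κ A t₀ P.1 ζ t₀) P.2).untop₀

/-! ### Properties of divisors and wave functions on the curve -/

/-- `f`, a rational function on each component, is a meromorphic function on the curve with
`(f) + D ≥ 0` (`D` contains no node): it takes equal values at glued points. -/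
def InLinearSystem (T : LeTableau k n) (κ : Fin n → ℝ) (D : T.Point → ℤ)
    (f : T.Component → RatFunc ℂ) : Prop :=
  (∀ P : T.Point,
    ((-D P : ℤ) : WithTop ℤ) ≤ orderAtPoint (fun ζ => (f P.1).eval (RingHom.id ℂ) ζ) P.2) ∧
  ∀ x y : T.RealPoint, T.Glued κ x y → ∃ a : ℂ,
    HasValueAt (fun ζ => (f x.1).eval (RingHom.id ℂ) ζ) x.toPoint.2 a ∧
    HasValueAt (fun ζ => (f y.1).eval (RingHom.id ℂ) ζ) y.toPoint.2 a

/-- `D` is an effective divisor of degree `g` with finite support, without nodes and without `P₀`. -/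
def IsEffectiveOfDegree (T : LeTableau k n) (κ : Fin n → ℝ) (D : T.Point → ℤ) (g : ℕ) : Prop :=
  (∀ P, 0 ≤ D P) ∧ (Function.support D).Finite ∧ ∑ᶠ P, D P = (g : ℤ) ∧
  D (.base, ∞) = 0 ∧ ∀ x : T.RealPoint, T.IsNode κ x → D x.toPoint = 0

/-- An effective divisor of degree equal to the arithmetic genus is non-special when the space of
functions with `(f) + D ≥ 0` has dimension `1`, i.e. consists of the constants. -/
def IsNonspecial (T : LeTableau k n) (κ : Fin n → ℝ) (D : T.Point → ℤ) : Prop :=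
  ∀ f : T.Component → RatFunc ℂ, T.InLinearSystem κ D f → ∃ a : ℂ, ∀ c, f c = RatFunc.C a

/-- The restriction of `D` to `Γ₀` is the (reduced) Sato divisor at time `t₀`. -/
def RestrictsToSato (T : LeTableau k n) (κ : Fin n → ℝ) (A : Matrix (Fin k) (Fin n) ℝ)
    (t₀ : KPTime) (D : T.Point → ℤ) : Prop :=
  ∀ z : ℂ, D (.base, (z : OnePoint ℂ)) =
    (((T.reducedSatoPoly κ A t₀).map (algebraMap ℝ ℂ)).rootMultiplicity z : ℤ)

/-- Reality and regularity: all points of `D` are real and lie on finite ovals, and every finite oval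
contains exactly one of them, with multiplicity one. -/
def IsRealRegular (T : LeTableau k n) (κ : Fin n → ℝ) (D : T.Point → ℤ) : Prop :=
  (∀ P, D P ≠ 0 → ∃ x : T.RealPoint, T.OnFiniteOval κ x ∧ x.toPoint = P) ∧
  ∀ x : T.RealPoint, T.OnFiniteOval κ x →
    ∃ y, T.SameOval κ x y ∧ D y.toPoint = 1 ∧
      ∀ z, T.SameOval κ x z → D z.toPoint ≠ 0 → z = y

/-- `ψ` is the KP wave function on the curve for the soliton data, with poles in `D`. -/
structure IsKPWaveFunction (T : LeTableau k n) (κ : Fin n → ℝ) (A : Matrix (Fin k) (Fin n) ℝ)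
    (t₀ : KPTime) (D : T.Point → ℤ) (ψ : T.Component → ℂ → KPTime → ℂ) : Prop where
  /-- `ψ(P, t₀) = 1`. -/
  normalized : ∀ P : T.Point, HasValueAt (fun ζ => ψ P.1 ζ t₀) P.2 1
  /-- `ψ(·, t)` is meromorphic away from `P₀`. -/
  meromorphic : ∀ t, ∀ P : T.Point, P ≠ (.base, ∞) → MeromorphicAtPoint (fun ζ => ψ P.1 ζ t) P.2
  /-- `(ψ(·, t)) + D ≥ 0` away from `P₀`. -/
  divisor : ∀ t, ∀ P : T.Point, P ≠ (.base, ∞) →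
    ((-D P : ℤ) : WithTop ℤ) ≤ orderAtPoint (fun ζ => ψ P.1 ζ t) P.2
  /-- `ψ` takes equal values at glued points. -/
  glued : ∀ t, ∀ x y : T.RealPoint, T.Glued κ x y → ∃ a : ℂ,
    HasValueAt (fun ζ => ψ x.1 ζ t) x.toPoint.2 a ∧ HasValueAt (fun ζ => ψ y.1 ζ t) y.toPoint.2 a
  /-- Essential singularity at `P₀`. -/
  asymptotic : ∀ t, ∃ h : ℂ → ℂ, AnalyticAt ℂ h 0 ∧ h 0 = 1 ∧
    ∀ᶠ ζ in cocompact ℂ, ψ .base ζ t = Complex.exp (kpTheta ζ (t - t₀)) * h ζ⁻¹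
  /-- On `Γ₀` it is the normalized Sato wave function `𝔇 e^{θ}(ζ, t) / 𝔇 e^{θ}(ζ, t₀)`
  (where the right-hand side is not the indeterminate `0 / 0` for all `t`). -/
  sato : ∀ t, ∀ ζ : ℂ, ((T.isolatedFactor κ).map (algebraMap ℝ ℂ)).eval ζ ≠ 0 →
    ψ .base ζ t = dress (satoPoly κ A) (fun s => Complex.exp (kpTheta ζ s)) t /
      dress (satoPoly κ A) (fun s => Complex.exp (kpTheta ζ s)) t₀
  /-- `D` is the exact pole divisor for generic times. -/
  generic : ∀ t, ∀ᶠ x : ℝ in cofinite, ∀ P : T.Point, P ≠ (.base, ∞) →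
    D P = max 0 (-(orderAtPoint (fun ζ => ψ P.1 ζ (shiftX t x)) P.2).untop₀)

end LeTableau

/-! The point of the proof is an explicit form of the wave function. Let Ψ = 𝔇Φ be the dressed edge
functions. On every component ψ(ζ, t) is an exponential (present only on Γ₀) times a quotient of the
polynomials `numer` at t and `denom` at t₀: the quotient is S'_t / 1 on Γ₀, it is (Ψ3 ζ − Ψ1) / (Φ3
ζ − Φ1) on a white component with an edge to the left, and it is constant in ζ elsewhere
(`dressedWave_eq`). The denominators carry D_vac and cancel, so D_KP is the divisor of zeros of the
numerators at t₀ (`kpDivisor_coe`, `kpDivisor_infty`). At a source Ψ3 = 𝔇f = 0, hence the numerator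
is constant there; what remains is k' zeros on Γ₀ and one zero for each box with a filled box to its
left. Every box is either the first of its row or the left neighbour of exactly one box, so the
degree is g (`dim_eq`). The normalized function is e^θ times the numerator at t over the numerator
at t₀. It agrees at glued points because the Ψ at the two ends of an edge differ by a non-zero
factor that does not depend on t (`glued_kpWave`).

The non-negative minors of A enter through Cauchy–Binet and Vandermonde: the Wronskian of the f^(i)
is positive at all times, so 𝔇 exists, and it is the only monic operator of order k that kills all
f^(i).

Non-speciality. A function bounded by D_KP is p_c / numer_c on each component c. Matching at the
nodes propagates p from Γ₀ through the network by the same linear relations as those of the edge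
vectors, so p at a box is a sum ∑ v_j e^{θ_j} P(κ_j) with P = q p_base and v the edge vector
(`Matching.black_eq`). Closing up at the sources gives k linear conditions on P, one for each row of
the matrix; S_{t₀} satisfies them too, and the invertible Wronskian leaves only its multiples
(`Matching.base_eq`).

Position of the points. To an oval one attaches the set of the boxes above and to the left of it. By
the Le-rule this set does not change along the oval (`region_glued`), and its lower right corner is
a box that determines the oval (`sameOval_cornerPoint_iff`); every box occurs, so there are g finite
ovals. The sign pattern of Ψ1, Ψ2, Ψ3 tells on which arc of a white component the zero lies.
Counting modulo 2, the signs cancel along the inner edges and leave a sum over the boundary, where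
the sign of S' at κ_j is the parity of the number of larger roots. The result is that every finite
oval carries an odd number of real points of D_KP (`parity_corner`). As there are g ovals and the
degree is g, all points are real and each finite oval contains exactly one (`countP_realPoints`).

Genericity. In x all quantities involved become, after multiplication by the Wronskian determinant,
exponential polynomials, which have finitely many zeros unless they vanish identically. That they do
not is seen as x → −∞, where the Sato polynomial tends to ∏(ζ − κ_{i_r}) and the lowest exponent
dominates (`finite_zeros_dressedSum_of_ne_zero`, `finite_zeros_reducedSatoPoly`). -/

namespace LeTableau

variable {k n : ℕ}

/-! ### Paths in the Le-network -/

/-- A height function on the vertices of the network that increases along the edges. -/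
def height (T : LeTableau k n) : T.Vertex → ℕ
  | .inl _ => 0
  | .inr (.inl b) => 1 + b.1.1 + b.1.2
  | .inr (.inr _) => k + n + 1

theorem height_lt_of_edgeWeight_ne (T : LeTableau k n) {u v : T.Vertex}
    (h : T.edgeWeight u v ≠ 0) : T.height u < T.height v := by
  classical
  rcases u with r | b | j <;> rcases v with r' | b' | j' <;> simp only [edgeWeight] at h <;>
    try exact absurd rfl h
  · simp [height]
  · split_ifs at h with h1 h2
    · have := h1.1; have h3 := h1.2.1
      simp only [height, this]; have : (b.1.2 : ℕ) < b'.1.2 := h3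
      omega
    · have := h2.1; have h3 := h2.2.1
      simp only [height, this]; have : (b.1.1 : ℕ) < b'.1.1 := h3
      omega
    · exact absurd rfl h
  · simp only [height]; have := b.1.1.2; have := b.1.2.2; omega

theorem height_le_of_pow_ne (T : LeTableau k n) (m : ℕ) {u v : T.Vertex}
    (h : ((Matrix.of T.edgeWeight) ^ m) u v ≠ 0) : T.height u + m ≤ T.height v := by
  induction m generalizing u with
  | zero =>
    rw [pow_zero, Matrix.one_apply] at h
    split_ifs at h with h1
    · subst h1; simp
    · exact absurd rfl h
  | succ m ih =>
    rw [pow_succ', Matrix.mul_apply] at h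
    obtain ⟨w, -, hw⟩ := Finset.exists_ne_zero_of_sum_ne_zero h
    have h1 := T.height_lt_of_edgeWeight_ne (u := u) (v := w) (left_ne_zero_of_mul hw)
    have h2 := ih (right_ne_zero_of_mul hw)
    omega

/-- The height makes the weight matrix nilpotent, so its characteristic polynomial is a pure power
of X, and Cayley–Hamilton brings the exponent down to the number of vertices, the bound at which
`pathSum` is truncated. -/
theorem edgeMatrix_pow_card (T : LeTableau k n) :
    (Matrix.of T.edgeWeight) ^ Fintype.card T.Vertex = 0 := by
  have hnil : IsNilpotent (Matrix.of T.edgeWeight) := by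
    -- Heights lie between 0 and k + n + 1, so no path has k + n + 2 edges.
    refine ⟨k + n + 2, ?_⟩
    ext u v
    by_contra h
    have h1 := T.height_le_of_pow_ne _ h
    have h2 : T.height v ≤ k + n + 1 := by
      rcases v with r | b | j <;> simp only [height]
      · omega
      · have := b.1.1.2; have := b.1.2.2; omega
      · omega
    omega
  have h1 := Matrix.isNilpotent_charpoly_sub_pow_of_isNilpotent hnil
  have h2 := sub_eq_zero.mp h1.eq_zero
  have h3 := Matrix.aeval_self_charpoly (Matrix.of T.edgeWeight)
  rw [h2] at h3
  simpa using h3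

/-- The geometric series S = ∑ M^m of a nilpotent M satisfies S = 1 + M S: a path is trivial or has
a first edge. All later recursions for the edge vectors come from this one. -/
theorem pathSum_eq (T : LeTableau k n) (u v : T.Vertex) :
    T.pathSum u v = (1 : Matrix T.Vertex T.Vertex ℝ) u v +
      ∑ w, T.edgeWeight u w * T.pathSum w v := by
  classical
  set M := Matrix.of T.edgeWeight with hM
  set N := Fintype.card T.Vertex with hN
  have h1 : ∀ u v, T.pathSum u v = (∑ m ∈ Finset.range N, M ^ m) u v := by
    intro u v
    rw [Matrix.sum_apply]; rfl
  have h2 : (∑ m ∈ Finset.range N, M ^ m) = 1 + M * ∑ m ∈ Finset.range N, M ^ m := by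
    have h3 : M ^ N = 0 := T.edgeMatrix_pow_card
    have h4 := Finset.sum_range_succ (fun m => M ^ m) N
    rw [h3, add_zero, Finset.sum_range_succ'] at h4
    conv_lhs => rw [← h4]
    rw [Finset.mul_sum, add_comm, pow_zero]
    simp_rw [pow_succ']
  simp_rw [h1]
  conv_lhs => rw [h2]
  rw [Matrix.add_apply, Matrix.mul_apply]
  rfl

theorem pathSum_sink (T : LeTableau k n) (i j : Fin n) :
    T.pathSum (.inr (.inr i)) (.inr (.inr j)) = if i = j then 1 else 0 := by
  rw [pathSum_eq, Matrix.one_apply]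
  have : ∀ w, T.edgeWeight (.inr (.inr i)) w = 0 := by intro w; simp [edgeWeight]
  simp [this]

theorem not_next_of_below {T : LeTableau k n} {b b' : T.Box} (h : T.Below b b') : ¬ T.Next b b' :=
  fun h' => absurd h'.1 (ne_of_gt h.2.1)

open Classical in
theorem pathSum_box (T : LeTableau k n) (b : T.Box) (j : Fin n) :
    T.pathSum (.inr (.inl b)) (.inr (.inr j)) =
      (∑ b' : T.Box, if T.Next b b' then
        T.weight b'.1.1 b'.1.2 * T.pathSum (.inr (.inl b')) (.inr (.inr j)) else 0) +
      ((if T.Bottom b ∧ b.1.2 = j then 1 else 0) +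
        ∑ b' : T.Box, if T.Below b b' then T.pathSum (.inr (.inl b')) (.inr (.inr j)) else 0) := by
  rw [pathSum_eq, Matrix.one_apply, Fintype.sum_sum_type, Fintype.sum_sum_type]
  have h1 : (Sum.inr (Sum.inl b) : T.Vertex) ≠ .inr (.inr j) := by simp
  simp only [h1, if_false, edgeWeight, zero_mul, Finset.sum_const_zero, zero_add, pathSum_sink]
  rw [add_left_comm, ← Finset.sum_add_distrib, add_comm]
  congr 1
  swap
  · refine Finset.sum_congr rfl fun b' _ => ?_
    by_cases hB : T.Below b b'
    · simp [hB, not_next_of_below hB]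
    · by_cases hN : T.Next b b' <;> simp [hB, hN]
  · rw [Finset.sum_eq_single j]
    · simp
    · intro i _ hij; simp [hij]
    · simp

open Classical in
theorem pathSum_source (T : LeTableau k n) (r : Fin k) (j : Fin n) :
    T.pathSum (.inl r) (.inr (.inr j)) =
      ∑ b : T.Box, if T.First r b then
        T.weight b.1.1 b.1.2 * T.pathSum (.inr (.inl b)) (.inr (.inr j)) else 0 := by
  rw [pathSum_eq, Matrix.one_apply, Fintype.sum_sum_type, Fintype.sum_sum_type]
  have h1 : (Sum.inl r : T.Vertex) ≠ .inr (.inr j) := by simp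
  simp only [h1, if_false, edgeWeight, zero_mul, Finset.sum_const_zero, zero_add, add_zero]
  refine Finset.sum_congr rfl fun b _ => ?_
  split_ifs <;> simp

theorem next_unique {T : LeTableau k n} {b c c' : T.Box} (h : T.Next b c) (h' : T.Next b c') :
    c = c' := by
  apply Subtype.ext; apply Prod.ext
  · rw [h.1, h'.1]
  · exact le_antisymm (h.2.2 _ h'.1 h'.2.1) (h'.2.2 _ h.1 h.2.1)

theorem below_unique {T : LeTableau k n} {b c c' : T.Box} (h : T.Below b c) (h' : T.Below b c') :
    c = c' := by
  apply Subtype.ext; apply Prod.ext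
  · exact le_antisymm (h.2.2 _ h'.1 h'.2.1) (h'.2.2 _ h.1 h.2.1)
  · rw [h.1, h'.1]

theorem first_unique {T : LeTableau k n} {r : Fin k} {c c' : T.Box} (h : T.First r c)
    (h' : T.First r c') : c = c' := by
  apply Subtype.ext; apply Prod.ext
  · rw [h.1, h'.1]
  · exact le_antisymm (h.2 _ h'.1) (h'.2 _ h.1)

theorem next_unique_left {T : LeTableau k n} {b c c' : T.Box} (h : T.Next c b) (h' : T.Next c' b) :
    c = c' := by
  have hr : c.1.1 = c'.1.1 := by rw [← h.1, h'.1]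
  apply Subtype.ext; apply Prod.ext hr
  rcases lt_trichotomy c.1.2 c'.1.2 with h1 | h1 | h1
  · exact absurd (h.2.2 c' hr.symm h1) (not_le.2 h'.2.1)
  · exact h1
  · exact absurd (h'.2.2 c hr h1) (not_le.2 h.2.1)

theorem below_unique_left {T : LeTableau k n} {b c c' : T.Box} (h : T.Below c b)
    (h' : T.Below c' b) : c = c' := by
  have hr : c.1.2 = c'.1.2 := by rw [← h.1, h'.1]
  apply Subtype.ext
  refine Prod.ext ?_ hr
  rcases lt_trichotomy c.1.1 c'.1.1 with h1 | h1 | h1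
  · exact absurd (h.2.2 c' hr.symm h1) (not_le.2 h'.2.1)
  · exact h1
  · exact absurd (h'.2.2 c hr h1) (not_le.2 h.2.1)

theorem not_bottom_of_below {T : LeTableau k n} {b b' : T.Box} (h : T.Below b b') : ¬ T.Bottom b :=
  fun h' => absurd (h' b' h.1) (not_le.2 h.2.1)

theorem bottom_or_below (T : LeTableau k n) (b : T.Box) : T.Bottom b ∨ ∃ b', T.Below b b' := by
  classical
  by_cases h : T.Bottom b
  · exact .inl h
  right
  simp only [Bottom, not_forall, not_le] at h
  obtain ⟨c, hc, hbc⟩ := h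
  obtain ⟨m, hm, hmin⟩ := Finset.exists_min_image
    (Finset.univ.filter fun c : T.Box => c.1.2 = b.1.2 ∧ b.1.1 < c.1.1) (fun c => c.1.1)
    ⟨c, by simp [hc, hbc]⟩
  simp only [Finset.mem_filter, Finset.mem_univ, true_and] at hm hmin
  exact ⟨m, hm.1, hm.2, fun c h1 h2 => hmin c ⟨h1, h2⟩⟩

theorem exists_next (T : LeTableau k n) {b c : T.Box} (hr : c.1.1 = b.1.1) (hc : b.1.2 < c.1.2) :
    ∃ b', T.Next b b' := by
  classical
  obtain ⟨m, hm, hmin⟩ := Finset.exists_min_image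
    (Finset.univ.filter fun c : T.Box => c.1.1 = b.1.1 ∧ b.1.2 < c.1.2) (fun c => c.1.2)
    ⟨c, by simp [hr, hc]⟩
  simp only [Finset.mem_filter, Finset.mem_univ, true_and] at hm hmin
  exact ⟨m, hm.1, hm.2, fun c h1 h2 => hmin c ⟨h1, h2⟩⟩

theorem exists_first (T : LeTableau k n) {r : Fin k} (h : T.RowNonempty r) : ∃ b, T.First r b := by
  classical
  obtain ⟨j, hj⟩ := h
  obtain ⟨m, hm, hmin⟩ := Finset.exists_min_image
    (Finset.univ.filter fun c : T.Box => c.1.1 = r) (fun c => c.1.2)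
    ⟨⟨(r, j), hj⟩, by simp⟩
  simp only [Finset.mem_filter, Finset.mem_univ, true_and] at hm hmin
  exact ⟨m, hm, fun c h1 => hmin c h1⟩

theorem First.rowNonempty {T : LeTableau k n} {r : Fin k} {b : T.Box} (h : T.First r b) :
    T.RowNonempty r := ⟨b.1.2, h.1 ▸ b.2⟩

theorem pivot_lt (T : LeTableau k n) (b : T.Box) : T.pivot b.1.1 < b.1.2 :=
  (T.box_of_weight_ne _ _ b.2).1

theorem not_pivot (T : LeTableau k n) (b : T.Box) (r : Fin k) : T.pivot r ≠ b.1.2 :=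
  fun h => (T.box_of_weight_ne _ _ b.2).2 ⟨r, h⟩

theorem first_or_next (T : LeTableau k n) (b : T.Box) :
    T.First b.1.1 b ∨ ∃ c, T.Next c b := by
  classical
  by_cases h : T.First b.1.1 b
  · exact .inl h
  right
  simp only [First, true_and, not_forall, not_le] at h
  obtain ⟨c, hc, hbc⟩ := h
  obtain ⟨m, hm, hmax⟩ := Finset.exists_max_image
    (Finset.univ.filter fun c : T.Box => c.1.1 = b.1.1 ∧ c.1.2 < b.1.2) (fun c => c.1.2)
    ⟨c, by simp [hc, hbc]⟩
  simp only [Finset.mem_filter, Finset.mem_univ, true_and] at hm hmax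
  refine ⟨m, hm.1.symm, hm.2, fun c h1 h2 => ?_⟩
  by_contra h3
  exact absurd (hmax c ⟨h1.trans hm.1, not_le.1 h3⟩) (not_le.2 h2)

theorem not_first_of_next {T : LeTableau k n} {b c : T.Box} (h : T.Next c b) (r : Fin k) :
    ¬ T.First r b := fun h' => absurd (h'.2 c (h.1.symm.trans h'.1)) (not_le.2 h.2.1)

theorem not_bottom_iff_forall {T : LeTableau k n} {b : T.Box} (h : T.Bottom b) (c : T.Box) :
    ¬ T.Below b c := fun h' => not_bottom_of_below h' h

/-! ### Edge vectors -/

theorem vec1_first {T : LeTableau k n} {r : Fin k} {b : T.Box} (h : T.First r b) :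
    T.vec1 (.inl r) = T.weight b.1.1 b.1.2 • T.boxVec b := by
  classical
  rw [vec1, Finset.sum_eq_single b]
  · simp [h]
  · intro c _ hc
    rw [if_neg fun h' => hc (first_unique h' h)]
  · simp

theorem vec1_next {T : LeTableau k n} {b b' : T.Box} (h : T.Next b b') :
    T.vec1 (.inr b) = T.weight b'.1.1 b'.1.2 • T.boxVec b' := by
  classical
  rw [vec1, Finset.sum_eq_single b']
  · simp [h]
  · intro c _ hc
    rw [if_neg fun h' => hc (next_unique h' h)]
  · simp

theorem vec1_of_not_hasLeft {T : LeTableau k n} {v : T.White} (h : ¬ T.HasLeft v) :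
    T.vec1 v = 0 := by
  classical
  rcases v with r | b
  · simp only [vec1]
    refine Finset.sum_eq_zero fun b _ => if_neg fun h' => h h'.rowNonempty
  · simp only [vec1]
    refine Finset.sum_eq_zero fun c _ => if_neg fun h' => h ⟨c, h'⟩

theorem vec3_box (T : LeTableau k n) (b : T.Box) : T.vec3 (.inr b) = T.boxVec b := by
  classical
  funext j
  simp only [vec3, boxVec, Pi.add_apply, vec2]
  rw [pathSum_box, mul_add _ (Finset.sum _ _)]
  congr 1
  simp only [vec1, Finset.sum_apply, Finset.mul_sum]
  refine Finset.sum_congr rfl fun c _ => ?_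
  split_ifs with h
  · simp only [Pi.smul_apply, smul_eq_mul, boxVec, h.1]; ring
  · simp

/-- Paths go only to the left (larger columns) or down, and they leave the network in a column that
contains a box, hence not at a pivot. -/
theorem pathSum_box_eq_zero (T : LeTableau k n) (b : T.Box) {j : Fin n}
    (hj : j < b.1.2 ∨ j ∈ Set.range T.pivot) : T.pathSum (.inr (.inl b)) (.inr (.inr j)) = 0 := by
  classical
  induction hN : (k + n) - (b.1.1 + b.1.2 : ℕ) using Nat.strong_induction_on generalizing b with
  | _ N ih =>
    have hb1 := b.1.1.2
    have hb2 := b.1.2.2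
    rw [pathSum_box, Finset.sum_eq_zero, Finset.sum_eq_zero, if_neg]
    · simp
    · rintro ⟨-, h⟩
      rcases hj with hj | ⟨r, hr⟩
      · exact absurd h (ne_of_gt hj)
      · exact T.not_pivot b r (hr.trans h.symm)
    · intro c _
      split_ifs with h
      · have h1 : (b.1.1 : ℕ) < c.1.1 := h.2.1
        have h2 : (c.1.2 : ℕ) = b.1.2 := congrArg _ h.1
        have := c.1.1.2
        exact ih _ (by omega) c (by rw [h.1]; exact hj) rfl
      · rfl
    · intro c _
      split_ifs with h
      · have h1 : (b.1.2 : ℕ) < c.1.2 := h.2.1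
        have h2 : (c.1.1 : ℕ) = b.1.1 := congrArg _ h.1
        have := c.1.2.2
        rw [ih _ (by omega) c (hj.imp_left fun h' => h'.trans h.2.1) rfl, mul_zero]
      · rfl

/-- A step to the left can never be undone, so the only path to the sink of the own column goes
straight down, with weight 1. -/
theorem pathSum_box_self (T : LeTableau k n) (b : T.Box) :
    T.pathSum (.inr (.inl b)) (.inr (.inr b.1.2)) = 1 := by
  classical
  induction hN : k - (b.1.1 : ℕ) using Nat.strong_induction_on generalizing b with
  | _ N ih =>
    have hb1 := b.1.1.2
    rw [pathSum_box, Finset.sum_eq_zero]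
    · rcases T.bottom_or_below b with h | ⟨c, h⟩
      · rw [Finset.sum_eq_zero]
        · simp [h]
        · intro c _; rw [if_neg (not_bottom_iff_forall h c)]
      · rw [Finset.sum_eq_single c, if_neg fun h' => not_bottom_of_below h h'.1, if_pos h]
        · have h1 : (b.1.1 : ℕ) < c.1.1 := h.2.1
          have := c.1.1.2
          rw [← h.1, ih _ (by omega) c rfl]; simp
        · intro c' _ hc'
          rw [if_neg fun h' => hc' (below_unique h' h)]
        · simp
    · intro c _
      split_ifs with h
      · rw [pathSum_box_eq_zero _ _ (.inl h.2.1), mul_zero]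
      · rfl

theorem rowSign_ne_zero (T : LeTableau k n) (r : Fin k) (j : Fin n) : T.rowSign r j ≠ 0 := by
  simp [rowSign]

theorem boxVec_eq_zero (T : LeTableau k n) (b : T.Box) {j : Fin n}
    (hj : j < b.1.2 ∨ j ∈ Set.range T.pivot) : T.boxVec b j = 0 := by
  rw [boxVec, pathSum_box_eq_zero _ _ hj, mul_zero]

theorem boxVec_self_ne (T : LeTableau k n) (b : T.Box) : T.boxVec b b.1.2 ≠ 0 := by
  rw [boxVec, pathSum_box_self, mul_one]; exact T.rowSign_ne_zero _ _

/-- This identifies the edge vector on the Darboux edge with a row of the matrix, whence the dressed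
function on that edge vanishes. -/
theorem matrix_row (T : LeTableau k n) (r : Fin k) : T.matrix r = T.vec3 (.inl r) := by
  classical
  funext j
  have hv1 : T.vec1 (.inl r) j = T.rowSign r j * T.pathSum (.inl r) (.inr (.inr j)) := by
    rw [pathSum_source, Finset.mul_sum]
    simp only [vec1, Finset.sum_apply]
    refine Finset.sum_congr rfl fun c _ => ?_
    split_ifs with h
    · simp only [Pi.smul_apply, smul_eq_mul, boxVec, h.1]; ring
    · simp
  simp only [matrix, vec3, Pi.add_apply, vec2]
  split_ifs with h
  · subst h
    rw [hv1, pathSum_source, Finset.sum_eq_zero]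
    · simp
    · intro b _
      rw [pathSum_box_eq_zero _ _ (.inr ⟨r, rfl⟩)]; simp
  · rw [hv1, Pi.single_eq_of_ne h, add_zero]

theorem vec2_below {T : LeTableau k n} {b c : T.Box} (h : T.Below b c) :
    T.vec2 (.inr b) = fun j => T.rowSign b.1.1 j * T.pathSum (.inr (.inl c)) (.inr (.inr j)) := by
  classical
  funext j
  simp only [vec2]
  rw [Finset.sum_eq_single c, if_neg fun h' => not_bottom_of_below h h'.1, if_pos h, zero_add]
  · intro c' _ hc'
    rw [if_neg fun h' => hc' (below_unique h' h)]
  · simp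

theorem vec2_bottom {T : LeTableau k n} {b : T.Box} (h : T.Bottom b) :
    T.vec2 (.inr b) = T.rowSign b.1.1 b.1.2 • Pi.single b.1.2 1 := by
  classical
  funext j
  simp only [vec2]
  rw [Finset.sum_eq_zero fun c _ => if_neg (not_bottom_iff_forall h c)]
  by_cases hj : b.1.2 = j
  · subst hj; simp [h]
  · simp [hj]

/-- The number of pivots left of (i.e. smaller than) the column `j`. -/
noncomputable def pivotCount (T : LeTableau k n) (j : ℕ) : ℕ :=
  (Finset.univ.filter fun s : Fin k => (T.pivot s : ℕ) < j).card

theorem lt_pivotCount_iff (T : LeTableau k n) (s : Fin k) (j : ℕ) :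
    (s : ℕ) < T.pivotCount j ↔ (T.pivot s : ℕ) < j := by
  classical
  have hmono := T.pivot_strictMono
  constructor
  · intro h
    by_contra h'
    have : (Finset.univ.filter fun s : Fin k => (T.pivot s : ℕ) < j) ⊆ Finset.Iio s := by
      intro x hx
      simp only [Finset.mem_filter, Finset.mem_univ, true_and, Finset.mem_Iio] at hx ⊢
      refine hmono.lt_iff_lt.1 (Fin.lt_def.2 (by omega))
    have := Finset.card_le_card this
    simp only [Fin.card_Iio] at this
    simp only [pivotCount] at h
    omega
  · intro h
    have : Finset.Iic s ⊆ (Finset.univ.filter fun s : Fin k => (T.pivot s : ℕ) < j) := by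
      intro x hx
      simp only [Finset.mem_filter, Finset.mem_univ, true_and, Finset.mem_Iic] at hx ⊢
      have := Fin.le_def.1 (hmono.le_iff_le.2 hx)
      omega
    have := Finset.card_le_card this
    simp only [Fin.card_Iic] at this
    simp only [pivotCount]
    omega

theorem pivotCount_pivot (T : LeTableau k n) (r : Fin k) : T.pivotCount (T.pivot r) = r := by
  apply le_antisymm
  · by_contra h
    have h1 := (T.lt_pivotCount_iff r _).1 (not_le.1 h)
    omega
  · by_contra h
    rw [not_le] at h
    have h2 := (T.lt_pivotCount_iff ⟨_, h.trans r.2⟩ (T.pivot r)).2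
      (T.pivot_strictMono (Fin.lt_def.2 h))
    exact absurd h2 (lt_irrefl _)

/-- The pivots smaller than j are those of the rows up to r and those strictly between `pivot r` and
j. The sign therefore splits into a factor of the row and a factor of the column. -/
theorem rowSign_eq (T : LeTableau k n) (r : Fin k) (j : Fin n) (h : T.pivot r < j) :
    T.rowSign r j = -((-1) ^ (r : ℕ) * (-1) ^ T.pivotCount j) := by
  classical
  have h1 : T.pivotCount j = (r + 1) + Nat.card {s : Fin k // T.pivot r < T.pivot s ∧ T.pivot s < j} := by
    rw [Nat.card_eq_fintype_card, Fintype.card_subtype, pivotCount]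
    have h2 : (Finset.univ.filter fun s : Fin k => (T.pivot s : ℕ) < j) =
        Finset.Iic r ∪ Finset.univ.filter fun s => T.pivot r < T.pivot s ∧ T.pivot s < j := by
      ext s
      simp only [Finset.mem_filter, Finset.mem_univ, true_and, Finset.mem_union, Finset.mem_Iic,
        T.pivot_strictMono.lt_iff_lt, ← Fin.lt_def]
      constructor
      · intro hs
        rcases le_or_gt s r with h3 | h3
        · exact .inl h3
        · exact .inr ⟨h3, hs⟩
      · rintro (h3 | h3)
        · exact (T.pivot_strictMono.monotone h3).trans_lt h
        · exact h3.2
    rw [h2, Finset.card_union_of_disjoint, Fin.card_Iic]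
    rw [Finset.disjoint_left]
    intro s hs hs'
    simp only [Finset.mem_filter, Finset.mem_univ, true_and, Finset.mem_Iic,
        T.pivot_strictMono.lt_iff_lt] at hs hs'
    exact absurd hs'.1 (not_lt.2 hs)
  rw [rowSign, h1, ← pow_add]
  rw [show (r : ℕ) + (r + 1 + Nat.card {s : Fin k // T.pivot r < T.pivot s ∧ T.pivot s < j}) =
    2 * r + (Nat.card {s : Fin k // T.pivot r < T.pivot s ∧ T.pivot s < j} + 1) by ring,
    pow_add, pow_mul, pow_succ (-1 : ℝ) (Nat.card _)]
  simp

/-- By `rowSign_eq` the signs of two rows differ by a factor that does not depend on the column, at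
least in the columns reached from the lower box; elsewhere the path sums vanish. The two ends of a
vertical edge thus carry proportional vectors. -/
theorem vec2_below_eq_smul {T : LeTableau k n} {b c : T.Box} (h : T.Below b c) :
    T.vec2 (.inr b) = ((-1 : ℝ) ^ (b.1.1 : ℕ) * (-1) ^ (c.1.1 : ℕ)) • T.boxVec c := by
  rw [vec2_below h]
  funext j
  by_cases hj : j < c.1.2
  · simp [boxVec, pathSum_box_eq_zero _ _ (.inl hj)]
  · have hc : T.pivot c.1.1 < j := (T.pivot_lt c).trans_le (not_lt.1 hj)
    have hb : T.pivot b.1.1 < j := (T.pivot_strictMono h.2.1).trans hc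
    simp only [Pi.smul_apply, smul_eq_mul, boxVec, T.rowSign_eq _ _ hc, T.rowSign_eq _ _ hb]
    have : ((-1 : ℝ) ^ (c.1.1 : ℕ)) * (-1) ^ (c.1.1 : ℕ) = 1 := by
      rw [← mul_pow]; simp
    linear_combination (((-1 : ℝ) ^ (b.1.1 : ℕ)) * (-1) ^ T.pivotCount j *
      T.pathSum (Sum.inr (Sum.inl c)) (Sum.inr (Sum.inr j))) * this

theorem vec1_eq_zero_of_pivot (T : LeTableau k n) (v : T.White) {j : Fin n}
    (hj : j ∈ Set.range T.pivot) : T.vec1 v j = 0 := by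
  by_cases h : T.HasLeft v
  · rcases v with r | b
    · obtain ⟨b, hb⟩ := T.exists_first h
      rw [vec1_first hb, Pi.smul_apply, boxVec_eq_zero _ _ (.inr hj), smul_zero]
    · obtain ⟨b', hb⟩ := h
      rw [vec1_next hb, Pi.smul_apply, boxVec_eq_zero _ _ (.inr hj), smul_zero]
  · rw [vec1_of_not_hasLeft h]; rfl

theorem matrix_pivot (T : LeTableau k n) (r s : Fin k) :
    T.matrix r (T.pivot s) = if r = s then 1 else 0 := by
  rw [matrix_row, vec3, Pi.add_apply, vec1_eq_zero_of_pivot _ _ ⟨s, rfl⟩, zero_add]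
  simp [vec2, Pi.single_apply, T.pivot_strictMono.injective.eq_iff, eq_comm]

theorem matrix_eq_zero_of_lt (T : LeTableau k n) (r : Fin k) {j : Fin n} (h : j < T.pivot r) :
    T.matrix r j = 0 := by
  rw [matrix_row, vec3, Pi.add_apply]
  simp only [vec2, Pi.single_eq_of_ne h.ne, add_zero]
  by_cases hr : T.RowNonempty r
  · obtain ⟨b, hb⟩ := T.exists_first hr
    rw [vec1_first hb, Pi.smul_apply, boxVec_eq_zero, smul_zero]
    left; have := T.pivot_lt b; rw [hb.1] at this; exact h.trans this
  · rw [vec1_of_not_hasLeft (v := .inl r) hr]; rfl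

theorem matrix_row_isolated (T : LeTableau k n) {r : Fin k} (h : ¬ T.RowNonempty r) :
    T.matrix r = Pi.single (T.pivot r) 1 := by
  rw [matrix_row, vec3, vec1_of_not_hasLeft (v := .inl r) h, zero_add, vec2]

end LeTableau

/-! ### A positivity consequence of the Cauchy–Binet formula -/

theorem Matrix.det_mul_eq_sum_prod_mul_det {k n : ℕ} (A : Matrix (Fin k) (Fin n) ℝ)
    (V : Matrix (Fin n) (Fin k) ℝ) :
    (A * V).det = ∑ f : Fin k → Fin n, (∏ m, V (f m) m) * (A.submatrix id f).det := by
  have h1 : (A * V).det = Matrix.detRowAlternating (R := ℝ)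
      (fun m : Fin k => ∑ j, V j m • (fun i => A i j)) := by
    rw [← Matrix.det_transpose]
    change Matrix.det _ = Matrix.det _
    congr 1
    ext m i
    rw [Matrix.transpose_apply, Matrix.mul_apply]
    erw [Finset.sum_apply]
    exact Finset.sum_congr rfl fun j _ => mul_comm _ _
  rw [h1]
  erw [MultilinearMap.map_sum (Matrix.detRowAlternating (R := ℝ) (n := Fin k)).toMultilinearMap
    (fun (m : Fin k) (j : Fin n) => V j m • (fun i => A i j))]
  refine Finset.sum_congr rfl fun f _ => ?_
  erw [MultilinearMap.map_smul_univ]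
  rw [smul_eq_mul]
  congr 1
  rw [← Matrix.det_transpose]
  rfl

/-- Precomposing f with a permutation multiplies the minor of A by the sign. Summation over all
permutations then assembles the products of entries of V into minors. Keeping all maps f, with the
factor k!, avoids a choice of representatives. -/
theorem Matrix.factorial_smul_det_mul {k n : ℕ} (A : Matrix (Fin k) (Fin n) ℝ)
    (V : Matrix (Fin n) (Fin k) ℝ) :
    (Fintype.card (Equiv.Perm (Fin k)) : ℝ) * (A * V).det =
      ∑ f : Fin k → Fin n, (V.submatrix f id).det * (A.submatrix id f).det := by
  have h1 : ∀ σ : Equiv.Perm (Fin k), (A * V).det = ∑ f : Fin k → Fin n,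
      ((Equiv.Perm.sign σ : ℤ) : ℝ) * (∏ m, V (f (σ m)) m) * (A.submatrix id f).det := by
    intro σ
    rw [Matrix.det_mul_eq_sum_prod_mul_det,
      ← Equiv.sum_comp (Equiv.arrowCongr σ.symm (Equiv.refl (Fin n)))]
    refine Finset.sum_congr rfl fun f _ => ?_
    have h2 : (A.submatrix id (f ∘ σ)).det = ((Equiv.Perm.sign σ : ℤ) : ℝ) *
        (A.submatrix id f).det := by
      rw [← Matrix.det_permute', Matrix.submatrix_submatrix]; rfl
    have h3 : (Equiv.arrowCongr σ.symm (Equiv.refl (Fin n))) f = f ∘ σ := rfl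
    rw [h3, h2]
    simp only [Function.comp_apply]; ring
  calc _ = ∑ _σ : Equiv.Perm (Fin k), (A * V).det := by simp
    _ = _ := by
      rw [Finset.sum_congr rfl fun σ _ => h1 σ, Finset.sum_comm]
      refine Finset.sum_congr rfl fun f _ => ?_
      rw [← Finset.sum_mul, Matrix.det_apply' (V.submatrix f id)]
      simp

/-- Sorting f multiplies both minors by the same sign, so their product is that of an increasing
selection. -/
theorem Matrix.exists_orderEmbedding_det_mul_det {k n : ℕ} (A : Matrix (Fin k) (Fin n) ℝ)
    (V : Matrix (Fin n) (Fin k) ℝ) {f : Fin k → Fin n} (hf : Function.Injective f) :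
    ∃ J : Fin k ↪o Fin n, (V.submatrix f id).det * (A.submatrix id f).det =
      (V.submatrix J id).det * (A.submatrix id J).det := by
  have hmono : StrictMono (f ∘ Tuple.sort f) :=
    (Tuple.monotone_sort f).strictMono_of_injective (hf.comp (Equiv.injective _))
  refine ⟨OrderEmbedding.ofStrictMono _ hmono, ?_⟩
  have h1 : (A.submatrix id (f ∘ Tuple.sort f)).det =
      ((Equiv.Perm.sign (Tuple.sort f) : ℤ) : ℝ) * (A.submatrix id f).det := by
    rw [← Matrix.det_permute', Matrix.submatrix_submatrix]; rfl
  have h2 : (V.submatrix (f ∘ Tuple.sort f) id).det =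
      ((Equiv.Perm.sign (Tuple.sort f) : ℤ) : ℝ) * (V.submatrix f id).det := by
    rw [← Matrix.det_permute, Matrix.submatrix_submatrix]; rfl
  change _ = (V.submatrix (f ∘ Tuple.sort f) id).det * (A.submatrix id (f ∘ Tuple.sort f)).det
  have h3 : ((Equiv.Perm.sign (Tuple.sort f) : ℤ) : ℝ) *
      ((Equiv.Perm.sign (Tuple.sort f) : ℤ) : ℝ) = 1 := by
    rw [← Int.cast_mul, ← Units.val_mul, Int.units_mul_self]; simp
  rw [h1, h2]
  linear_combination (-(V.submatrix f id).det * (A.submatrix id f).det) * h3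

theorem Matrix.det_mul_pos_of_minors {k n : ℕ} (A : Matrix (Fin k) (Fin n) ℝ)
    (V : Matrix (Fin n) (Fin k) ℝ) (hA : ∀ J : Fin k ↪o Fin n, 0 ≤ (A.submatrix id J).det)
    (hV : ∀ J : Fin k ↪o Fin n, 0 < (V.submatrix J id).det)
    (J₀ : Fin k ↪o Fin n) (hJ₀ : (A.submatrix id J₀).det ≠ 0) : 0 < (A * V).det := by
  have h := Matrix.factorial_smul_det_mul A V
  have hpos : (0 : ℝ) < Fintype.card (Equiv.Perm (Fin k)) := by
    exact_mod_cast Fintype.card_pos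
  rw [← mul_pos_iff_of_pos_left hpos, h]
  refine Finset.sum_pos' (fun f _ => ?_) ⟨J₀, Finset.mem_univ _, ?_⟩
  · by_cases hf : Function.Injective f
    · obtain ⟨J, hJ⟩ := Matrix.exists_orderEmbedding_det_mul_det A V hf
      rw [hJ]; exact mul_nonneg (hV J).le (hA J)
    · simp only [Function.Injective, not_forall] at hf
      obtain ⟨a, b, hab, hne⟩ := hf
      rw [Matrix.det_zero_of_column_eq (M := A.submatrix id f) hne fun i => by simp [hab], mul_zero]
  · exact mul_pos (hV J₀) (lt_of_le_of_ne (hA J₀) hJ₀.symm)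

/-! ### Phases and exponential sums -/

theorem kpTheta_add (ζ : ℂ) (s t : KPTime) : kpTheta ζ (s + t) = kpTheta ζ s + kpTheta ζ t := by
  unfold kpTheta
  exact Finsupp.sum_add_index' (by simp) (by intros; push_cast; ring)

theorem kpTheta_zero (ζ : ℂ) : kpTheta ζ 0 = 0 := by simp [kpTheta]

theorem kpTheta_single (ζ : ℂ) (x : ℝ) : kpTheta ζ (Finsupp.single 0 x) = x * ζ := by
  simp [kpTheta]

theorem kpTheta_sub (ζ : ℂ) (s t : KPTime) : kpTheta ζ (s - t) = kpTheta ζ s - kpTheta ζ t := by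
  have := kpTheta_add ζ (s - t) t
  rw [sub_add_cancel] at this
  rw [this]; ring

theorem kpThetaReal_cast (ζ : ℝ) (t : KPTime) : ((kpThetaReal ζ t : ℝ) : ℂ) = kpTheta ζ t := by
  simp [kpThetaReal, kpTheta, Finsupp.sum]

theorem kpThetaReal_shiftX (ζ : ℝ) (t : KPTime) (x : ℝ) :
    kpThetaReal ζ (shiftX t x) = kpThetaReal ζ t + ζ * x := by
  have : ((kpThetaReal ζ (shiftX t x) : ℝ) : ℂ) = ((kpThetaReal ζ t + ζ * x : ℝ) : ℂ) := by
    push_cast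
    rw [kpThetaReal_cast, kpThetaReal_cast, shiftX, kpTheta_add, kpTheta_single]; ring
  exact_mod_cast this

theorem kpTheta_shiftX (ζ : ℂ) (t : KPTime) (x : ℝ) :
    kpTheta ζ (shiftX t x) = kpTheta ζ t + ζ * x := by
  rw [shiftX, kpTheta_add, kpTheta_single]; ring

theorem differentiable_kpTheta (t : KPTime) : Differentiable ℂ fun ζ => kpTheta ζ t := by
  unfold kpTheta Finsupp.sum
  fun_prop

theorem expSum_add {n : ℕ} (κ v w : Fin n → ℝ) (t : KPTime) :
    expSum κ (v + w) t = expSum κ v t + expSum κ w t := by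
  simp [expSum, add_mul, Finset.sum_add_distrib]

theorem expSum_single {n : ℕ} (κ : Fin n → ℝ) (j : Fin n) (t : KPTime) :
    expSum κ (Pi.single j 1) t = Real.exp (kpThetaReal (κ j) t) := by
  simp [expSum, Pi.single_apply]

theorem expSum_shiftX {n : ℕ} (κ v : Fin n → ℝ) (t : KPTime) (x : ℝ) :
    expSum κ v (shiftX t x) =
      ∑ j, v j * Real.exp (kpThetaReal (κ j) t) * Real.exp (κ j * x) := by
  simp [expSum, kpThetaReal_shiftX, Real.exp_add, mul_assoc]

theorem iteratedDeriv_sum_cexp {ι : Type*} [Fintype ι] (c a : ι → ℂ) (m : ℕ) :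
    iteratedDeriv m (fun x : ℝ => ∑ j, c j * Complex.exp (a j * x)) =
      fun x : ℝ => ∑ j, c j * a j ^ m * Complex.exp (a j * x) := by
  induction m with
  | zero => simp
  | succ m ih =>
    rw [iteratedDeriv_succ, ih]
    funext x
    refine HasDerivAt.deriv ?_
    refine HasDerivAt.fun_sum fun j _ => ?_
    have h1 : HasDerivAt (fun x : ℝ => (x : ℂ)) 1 x := Complex.ofRealCLM.hasDerivAt
    have h2 := ((h1.const_mul (a j)).cexp).const_mul (c j * a j ^ m)
    exact h2.congr_deriv (by ring)

theorem iteratedDeriv_sum_exp {ι : Type*} [Fintype ι] (c a : ι → ℝ) (m : ℕ) :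
    iteratedDeriv m (fun x : ℝ => ∑ j, c j * Real.exp (a j * x)) =
      fun x : ℝ => ∑ j, c j * a j ^ m * Real.exp (a j * x) := by
  induction m with
  | zero => simp
  | succ m ih =>
    rw [iteratedDeriv_succ, ih]
    funext x
    refine HasDerivAt.deriv ?_
    refine HasDerivAt.fun_sum fun j _ => ?_
    have h2 := (((hasDerivAt_id x).const_mul (a j)).exp).const_mul (c j * a j ^ m)
    exact h2.congr_deriv (by simp only [id]; ring)

/-- The operator with symbol p multiplies e^{ax} by p(a). -/
theorem dress_eq_sum {ι : Type*} [Fintype ι] (p : KPTime → Polynomial ℝ) (F : KPTime → ℂ)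
    (t : KPTime) (c a : ι → ℂ) (hF : ∀ x : ℝ, F (shiftX t x) = ∑ j, c j * Complex.exp (a j * x)) :
    dress p F t = ∑ j, c j * ((p t).map (algebraMap ℝ ℂ)).eval (a j) := by
  unfold dress
  simp_rw [hF, iteratedDeriv_sum_cexp, Polynomial.eval_map, Polynomial.eval₂_eq_sum,
    Polynomial.sum_def, Finset.mul_sum]
  rw [Finset.sum_comm]
  refine Finset.sum_congr rfl fun j _ => Finset.sum_congr rfl fun m _ => ?_
  simp; ring

theorem iteratedDeriv_expSum {n : ℕ} (κ v : Fin n → ℝ) (t : KPTime) (m : ℕ) :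
    iteratedDeriv m (fun x => expSum κ v (shiftX t x)) 0 =
      ∑ j, v j * Real.exp (kpThetaReal (κ j) t) * κ j ^ m := by
  simp_rw [expSum_shiftX]
  rw [iteratedDeriv_sum_exp]
  simp

/-! ### The Wronskian and the Darboux operator -/

section Sato

variable {k n : ℕ}

/-- The Wronskian matrix of the heat hierarchy solutions given by the rows of `A`. -/
noncomputable def wronskian (κ : Fin n → ℝ) (A : Matrix (Fin k) (Fin n) ℝ) (t : KPTime) :
    Matrix (Fin k) (Fin k) ℝ :=
  A * Matrix.of fun (j : Fin n) (m : Fin k) => Real.exp (kpThetaReal (κ j) t) * κ j ^ (m : ℕ)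

/-- The `k`-th derivatives of the heat hierarchy solutions given by the rows of `A`. -/
noncomputable def topDeriv (κ : Fin n → ℝ) (A : Matrix (Fin k) (Fin n) ℝ) (t : KPTime) :
    Fin k → ℝ :=
  A.mulVec fun j => Real.exp (kpThetaReal (κ j) t) * κ j ^ k

theorem dressingCoeff_eq (κ : Fin n → ℝ) (A : Matrix (Fin k) (Fin n) ℝ) (t : KPTime) :
    dressingCoeff κ A t = (wronskian κ A t)⁻¹.mulVec (topDeriv κ A t) := by
  unfold dressingCoeff
  congr 1
  · congr 1
    ext i m
    simp [iteratedDeriv_expSum, wronskian, Matrix.mul_apply, mul_assoc]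
  · funext i
    simp [iteratedDeriv_expSum, topDeriv, Matrix.mulVec, dotProduct, mul_assoc]

/-- The maximal minors of the second factor are products of exponentials and of a Vandermonde
determinant with increasing nodes, hence positive; one non-zero minor of A suffices to make the
Cauchy–Binet sum positive. -/
theorem wronskian_det_pos {κ : Fin n → ℝ} (hκ : StrictMono κ) {A : Matrix (Fin k) (Fin n) ℝ}
    (hA : ∀ J : Fin k ↪o Fin n, 0 ≤ (A.submatrix id J).det) (J₀ : Fin k ↪o Fin n)
    (hJ₀ : (A.submatrix id J₀).det ≠ 0) (t : KPTime) : 0 < (wronskian κ A t).det := by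
  refine Matrix.det_mul_pos_of_minors A _ hA (fun J => ?_) J₀ hJ₀
  have h1 : (Matrix.of fun (j : Fin n) (m : Fin k) =>
      Real.exp (kpThetaReal (κ j) t) * κ j ^ (m : ℕ)).submatrix J id =
      Matrix.of fun i m => Real.exp (kpThetaReal (κ (J i)) t) *
        Matrix.vandermonde (fun i => κ (J i)) i m := by
    ext i m; simp [Matrix.vandermonde]
  rw [h1, Matrix.det_mul_column, Matrix.det_vandermonde]
  refine mul_pos (Finset.prod_pos fun i _ => Real.exp_pos _)
    (Finset.prod_pos fun i _ => Finset.prod_pos fun j hj => ?_)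
  exact sub_pos.2 (hκ (J.strictMono (Finset.mem_Ioi.1 hj)))

/-- A change of basis of the span of the f^(i) does not change the operator that annihilates them.
-/
theorem satoPoly_eq_of_eq_mul {κ : Fin n → ℝ} {A B : Matrix (Fin k) (Fin n) ℝ}
    {G : Matrix (Fin k) (Fin k) ℝ} (hG : G.det ≠ 0) (h : A = G * B) :
    satoPoly κ A = satoPoly κ B := by
  funext t
  have h1 : dressingCoeff κ A t = dressingCoeff κ B t := by
    rw [dressingCoeff_eq, dressingCoeff_eq, wronskian, topDeriv, h, Matrix.mul_assoc,
      Matrix.mul_inv_rev, ← Matrix.mulVec_mulVec _ G B, Matrix.mulVec_mulVec _ _ G,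
      Matrix.mul_assoc _ G⁻¹ G, Matrix.nonsing_inv_mul _ (isUnit_iff_ne_zero.2 hG), Matrix.mul_one]
    rfl
  simp only [satoPoly, h1]

theorem satoPoly_aux_degree (κ : Fin n → ℝ) (A : Matrix (Fin k) (Fin n) ℝ) (t : KPTime) :
    (∑ m : Fin k, Polynomial.C (dressingCoeff κ A t m) * Polynomial.X ^ (m : ℕ)).degree < (k : WithBot ℕ) := by
  refine (Polynomial.degree_sum_le _ _).trans_lt ?_
  refine (Finset.sup_lt_iff (WithBot.bot_lt_coe k)).2 fun m _ => ?_
  exact (Polynomial.degree_C_mul_X_pow_le _ _).trans_lt (WithBot.coe_lt_coe.2 m.2)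

theorem satoPoly_monic (κ : Fin n → ℝ) (A : Matrix (Fin k) (Fin n) ℝ) (t : KPTime) :
    (satoPoly κ A t).Monic :=
  Polynomial.monic_X_pow_sub (satoPoly_aux_degree κ A t)

theorem satoPoly_natDegree (κ : Fin n → ℝ) (A : Matrix (Fin k) (Fin n) ℝ) (t : KPTime) :
    (satoPoly κ A t).natDegree = k := by
  refine Polynomial.natDegree_eq_of_degree_eq_some ?_
  rw [satoPoly, Polynomial.degree_sub_eq_left_of_degree_lt, Polynomial.degree_X_pow]
  rw [Polynomial.degree_X_pow]
  exact satoPoly_aux_degree κ A t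

theorem satoPoly_eval (κ : Fin n → ℝ) (A : Matrix (Fin k) (Fin n) ℝ) (t : KPTime) (z : ℝ) :
    (satoPoly κ A t).eval z = z ^ k - ∑ m : Fin k, dressingCoeff κ A t m * z ^ (m : ℕ) := by
  simp [satoPoly, Polynomial.eval_finsetSum]

/-- The dressing `𝔇 ∑_j v_j e^{θ_j}` of an exponential sum. -/
noncomputable def dressedSum (κ : Fin n → ℝ) (S : KPTime → Polynomial ℝ) (v : Fin n → ℝ)
    (t : KPTime) : ℝ :=
  ∑ j, v j * Real.exp (kpThetaReal (κ j) t) * (S t).eval (κ j)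

theorem dressedSum_add (κ : Fin n → ℝ) (S : KPTime → Polynomial ℝ) (v w : Fin n → ℝ)
    (t : KPTime) : dressedSum κ S (v + w) t = dressedSum κ S v t + dressedSum κ S w t := by
  simp [dressedSum, add_mul, Finset.sum_add_distrib]

theorem dressedSum_smul (κ : Fin n → ℝ) (S : KPTime → Polynomial ℝ) (a : ℝ) (v : Fin n → ℝ)
    (t : KPTime) : dressedSum κ S (a • v) t = a * dressedSum κ S v t := by
  simp [dressedSum, Finset.mul_sum, mul_assoc]

theorem dressedSum_zero (κ : Fin n → ℝ) (S : KPTime → Polynomial ℝ) (t : KPTime) :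
    dressedSum κ S 0 t = 0 := by simp [dressedSum]

theorem dressedSum_single (κ : Fin n → ℝ) (S : KPTime → Polynomial ℝ) (j : Fin n)
    (t : KPTime) : dressedSum κ S (Pi.single j 1) t =
      Real.exp (kpThetaReal (κ j) t) * (S t).eval (κ j) := by
  simp [dressedSum, Pi.single_apply]

/-- This is 𝔇f^(i) = 0: the coefficients were defined as the solution of the linear system with the
Wronskian matrix. -/
theorem dressedSum_satoPoly_row {κ : Fin n → ℝ} {A : Matrix (Fin k) (Fin n) ℝ} {t : KPTime}
    (h : (wronskian κ A t).det ≠ 0) (i : Fin k) : dressedSum κ (satoPoly κ A) (A i) t = 0 := by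
  have h1 : (wronskian κ A t).mulVec (dressingCoeff κ A t) = topDeriv κ A t := by
    rw [dressingCoeff_eq, Matrix.mulVec_mulVec, Matrix.mul_nonsing_inv _ (isUnit_iff_ne_zero.2 h),
      Matrix.one_mulVec]
  have h2 := congrFun h1 i
  simp only [wronskian, topDeriv, Matrix.mulVec, dotProduct, Matrix.mul_apply, Matrix.of_apply,
    Finset.sum_mul] at h2
  rw [Finset.sum_comm] at h2
  simp only [dressedSum, satoPoly_eval, mul_sub, Finset.sum_sub_distrib, Finset.mul_sum]
  rw [sub_eq_zero]
  refine Eq.trans ?_ (h2.symm.trans ?_)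
  · exact Finset.sum_congr rfl fun j _ => by ring
  · exact Finset.sum_congr rfl fun j _ => Finset.sum_congr rfl fun m _ => by ring

/-- An operator of order less than k that kills k functions with non-zero Wronskian is zero, as its
coefficients form a vector in the kernel of the Wronskian matrix. Complex coefficients are needed
for the functions in the linear system of the divisor. -/
theorem eq_zero_of_annihilates_rows {κ : Fin n → ℝ} {A : Matrix (Fin k) (Fin n) ℝ} {t : KPTime}
    (h : (wronskian κ A t).det ≠ 0) (Q : Polynomial ℂ) (hQ : Q.degree < k)
    (hz : ∀ i, ∑ j, (A i j : ℂ) * Real.exp (kpThetaReal (κ j) t) * Q.eval (κ j : ℂ) = 0) :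
    Q = 0 := by
  have h1 : ((wronskian κ A t).map (algebraMap ℝ ℂ)).mulVec (fun m : Fin k => Q.coeff m) = 0 := by
    funext i
    rw [Pi.zero_apply, ← hz i]
    simp only [wronskian, Matrix.mulVec, dotProduct, Matrix.map_apply, Matrix.mul_apply,
      Matrix.of_apply, map_sum, Finset.sum_mul]
    rw [Finset.sum_comm]
    refine Finset.sum_congr rfl fun j _ => ?_
    rcases eq_or_ne Q 0 with rfl | hQ0
    · simp
    rw [Polynomial.eval_eq_sum_range' (n := k)
      ((Polynomial.natDegree_lt_iff_degree_lt hQ0).2 hQ), Finset.mul_sum,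
      ← Fin.sum_univ_eq_sum_range (fun m => (A i j : ℂ) * Real.exp (kpThetaReal (κ j) t) *
        (Q.coeff m * (κ j : ℂ) ^ m))]
    refine Finset.sum_congr rfl fun m _ => ?_
    simp; ring
  have h2 : ((wronskian κ A t).map (algebraMap ℝ ℂ)).det ≠ 0 := by
    rw [← RingHom.mapMatrix_apply, ← RingHom.map_det]
    simpa using h
  have h3 := Matrix.eq_zero_of_mulVec_eq_zero h2 h1
  ext m
  rw [Polynomial.coeff_zero]
  by_cases hm : m < k
  · exact congrFun h3 ⟨m, hm⟩
  · exact Polynomial.coeff_eq_zero_of_degree_lt (hQ.trans_le (by exact_mod_cast not_lt.1 hm))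

end Sato

/-! ### Exponential polynomials in one variable -/

/-- Evaluation at `x` of the exponential polynomial `∑_a c_a e^{a x}`. -/
noncomputable def expEval (x : ℝ) : AddMonoidAlgebra ℝ ℝ →ₐ[ℝ] ℝ :=
  AddMonoidAlgebra.lift ℝ ℝ ℝ
    { toFun := fun a => Real.exp (a.toAdd * x)
      map_one' := by simp
      map_mul' := fun a b => by rw [toAdd_mul, add_mul, Real.exp_add] }

theorem expEval_single (x a c : ℝ) :
    expEval x (AddMonoidAlgebra.single a c) = c * Real.exp (a * x) := by
  rw [expEval, AddMonoidAlgebra.lift_single]; rfl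

theorem expEval_apply (x : ℝ) (p : AddMonoidAlgebra ℝ ℝ) :
    expEval x p = ∑ a ∈ p.coeff.support, p.coeff a * Real.exp (a * x) := by
  rw [expEval, AddMonoidAlgebra.lift_apply]; rfl

/-- Relative to the smallest exponent all other exponentials decay at −∞. The coefficients may still
depend on x, as those with the Sato polynomial do; terms with vanishing coefficient are exempt from
the comparison of exponents. -/
theorem tendsto_sum_exp_atBot {ι : Type*} (s : Finset ι) (e : ι → ℝ) (c : ι → ℝ → ℝ)
    (C : ι → ℝ) {i₀ : ι} (hi₀ : i₀ ∈ s)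
    (hmin : ∀ i ∈ s, i ≠ i₀ → e i₀ < e i ∨ c i = 0)
    (hc : ∀ i ∈ s, Tendsto (c i) atBot (𝓝 (C i))) :
    Tendsto (fun x => ∑ i ∈ s, c i x * Real.exp ((e i - e i₀) * x)) atBot (𝓝 (C i₀)) := by
  classical
  have h1 : ∀ i ∈ s, Tendsto (fun x => c i x * Real.exp ((e i - e i₀) * x)) atBot
      (𝓝 (if i = i₀ then C i₀ else 0)) := by
    intro i hi
    split_ifs with h
    · subst h; simpa using hc i hi
    · rcases hmin i hi h with h' | h'
      · have h2 : Tendsto (fun x => Real.exp ((e i - e i₀) * x)) atBot (𝓝 0) :=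
          Real.tendsto_exp_atBot.comp (tendsto_id.const_mul_atBot (sub_pos.2 h'))
        simpa using (hc i hi).mul h2
      · simp [h']
  have h2 := tendsto_finsetSum s h1
  simpa [hi₀] using h2

theorem eventually_expEval_ne_zero_atBot {p : AddMonoidAlgebra ℝ ℝ} (hp : p ≠ 0) :
    ∀ᶠ x in atBot, expEval x p ≠ 0 := by
  have hs : p.coeff.support.Nonempty := by
    rw [Finsupp.support_nonempty_iff]; simpa using hp
  obtain ⟨a₀, ha₀, hmin⟩ := Finset.exists_min_image _ id hs
  have h := tendsto_sum_exp_atBot p.coeff.support id (fun a _ => p.coeff a) p.coeff ha₀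
    (fun i hi hne => .inl (lt_of_le_of_ne (hmin i hi) hne.symm)) (fun i _ => tendsto_const_nhds)
  filter_upwards [h.eventually_ne (Finsupp.mem_support_iff.1 ha₀)] with x hx h0
  apply hx
  have : expEval x p * Real.exp (-a₀ * x) = 0 := by rw [h0, zero_mul]
  rw [expEval_apply, Finset.sum_mul] at this
  rw [← this]
  refine Finset.sum_congr rfl fun a _ => ?_
  rw [mul_assoc, ← Real.exp_add, id, id]; ring_nf

theorem eventually_expEval_ne_zero_atTop {p : AddMonoidAlgebra ℝ ℝ} (hp : p ≠ 0) :
    ∀ᶠ x in atTop, expEval x p ≠ 0 := by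
  have hs : p.coeff.support.Nonempty := by
    rw [Finsupp.support_nonempty_iff]; simpa using hp
  obtain ⟨a₀, ha₀, hmax⟩ := Finset.exists_max_image _ id hs
  -- The behaviour at +∞ is that at −∞ after x ↦ −x, which negates the exponents.
  have h := tendsto_sum_exp_atBot p.coeff.support (fun a => -a) (fun a _ => p.coeff a) p.coeff ha₀
    (fun i hi hne => .inl (neg_lt_neg (lt_of_le_of_ne (hmax i hi) hne)))
    (fun i _ => tendsto_const_nhds)
  filter_upwards [tendsto_neg_atTop_atBot.eventually
    (h.eventually_ne (Finsupp.mem_support_iff.1 ha₀))] with x hx h0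
  apply hx
  have : expEval x p * Real.exp (-a₀ * x) = 0 := by rw [h0, zero_mul]
  rw [expEval_apply, Finset.sum_mul] at this
  rw [← this]
  refine Finset.sum_congr rfl fun a _ => ?_
  rw [mul_assoc, ← Real.exp_add]; ring_nf

theorem analyticOnNhd_expEval (p : AddMonoidAlgebra ℝ ℝ) :
    AnalyticOnNhd ℝ (fun x => expEval x p) Set.univ := by
  intro x _
  simp_rw [expEval_apply]
  fun_prop

/-- A non-zero exponential polynomial has finitely many zeros. -/
theorem finite_zeros_expEval {p : AddMonoidAlgebra ℝ ℝ} (hp : p ≠ 0) :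
    {x | expEval x p = 0}.Finite := by
  obtain ⟨a, ha⟩ := eventually_atBot.1 (eventually_expEval_ne_zero_atBot hp)
  obtain ⟨b, hb⟩ := eventually_atTop.1 (eventually_expEval_ne_zero_atTop hp)
  -- All zeros lie in a compact interval. Infinitely many of them would accumulate, and the identity
  -- theorem would make the function vanish at the left end too.
  by_contra hinf
  have hsub : {x | expEval x p = 0} ⊆ Set.Icc a b := by
    intro x hx
    constructor
    · by_contra h; exact ha x (not_le.1 h).le hx
    · by_contra h; exact hb x (not_le.1 h).le hx
  obtain ⟨z, -, hz⟩ := Set.Infinite.exists_accPt_of_subset_isCompact hinf isCompact_Icc hsub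
  have h1 := (analyticOnNhd_expEval p).eqOn_zero_of_preconnected_of_frequently_eq_zero
    isPreconnected_univ (Set.mem_univ z) (accPt_iff_frequently_nhdsNE.1 hz)
  exact ha a le_rfl (h1 (Set.mem_univ a))

section Sato

variable {k n : ℕ}

/-- The exponential sum `∑_j v_j c_j e^{θ_j(t + x)}` as an exponential polynomial in `x`. -/
noncomputable def expPolyOf (κ v : Fin n → ℝ) (t : KPTime) : AddMonoidAlgebra ℝ ℝ :=
  ∑ j, AddMonoidAlgebra.single (κ j) (v j * Real.exp (kpThetaReal (κ j) t))

theorem expEval_expPolyOf (κ v : Fin n → ℝ) (t : KPTime) (x : ℝ) :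
    expEval x (expPolyOf κ v t) = expSum κ v (shiftX t x) := by
  simp [expPolyOf, expEval_single, expSum_shiftX]

theorem expPolyOf_ne_zero {κ v : Fin n → ℝ} (hκ : Function.Injective κ) (hv : v ≠ 0)
    (t : KPTime) : expPolyOf κ v t ≠ 0 := by
  classical
  obtain ⟨j, hj⟩ := Function.ne_iff.1 hv
  intro h
  have h1 : (expPolyOf κ v t).coeff (κ j) = 0 := by rw [h]; rfl
  apply mul_ne_zero hj (Real.exp_pos (kpThetaReal (κ j) t)).ne'
  rw [← h1, expPolyOf, AddMonoidAlgebra.coeff_sum, Finsupp.finsetSum_apply, Finset.sum_eq_single j]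
  · simp
  · intro i _ hij
    simp [hκ.ne hij]
  · simp

theorem finite_zeros_expSum {κ v : Fin n → ℝ} (hκ : Function.Injective κ) (hv : v ≠ 0)
    (t : KPTime) : {x | expSum κ v (shiftX t x) = 0}.Finite := by
  simp_rw [← expEval_expPolyOf]
  exact finite_zeros_expEval (expPolyOf_ne_zero hκ hv t)

/-- Cramer's rule: the Wronskian determinant and the adjugate applied to the top derivatives are
exponential polynomials in x, and the determinant has no zero. -/
theorem exists_expPoly_dressingCoeff (κ : Fin n → ℝ) (A : Matrix (Fin k) (Fin n) ℝ)
    (hW : ∀ t, (wronskian κ A t).det ≠ 0) (t : KPTime) :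
    ∃ (τ : AddMonoidAlgebra ℝ ℝ) (N : Fin k → AddMonoidAlgebra ℝ ℝ),
      (∀ x, expEval x τ ≠ 0) ∧
      ∀ x m, expEval x τ * dressingCoeff κ A (shiftX t x) m = expEval x (N m) := by
  classical
  let WE : Matrix (Fin k) (Fin k) (AddMonoidAlgebra ℝ ℝ) :=
    Matrix.of fun i m => expPolyOf κ (fun j => A i j * κ j ^ (m : ℕ)) t
  let bE : Fin k → AddMonoidAlgebra ℝ ℝ := fun i => expPolyOf κ (fun j => A i j * κ j ^ k) t
  have h1 : ∀ x, (expEval x : AddMonoidAlgebra ℝ ℝ →+* ℝ).mapMatrix WE =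
      wronskian κ A (shiftX t x) := by
    intro x; ext i m
    simp only [RingHom.mapMatrix_apply, Matrix.map_apply, WE, Matrix.of_apply, RingHom.coe_coe,
      expEval_expPolyOf, wronskian, Matrix.mul_apply, expSum]
    exact Finset.sum_congr rfl fun j _ => by ring
  have h2 : ∀ x i, expEval x (bE i) = topDeriv κ A (shiftX t x) i := by
    intro x i
    simp only [bE, expEval_expPolyOf, topDeriv, Matrix.mulVec, dotProduct, expSum]
    exact Finset.sum_congr rfl fun j _ => by ring
  have h3 : ∀ x, expEval x WE.det = (wronskian κ A (shiftX t x)).det := by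
    intro x
    rw [← h1, ← RingHom.map_det]; rfl
  refine ⟨WE.det, (WE.adjugate).mulVec bE, fun x => (h3 x).symm ▸ hW _, fun x m => ?_⟩
  rw [h3, dressingCoeff_eq, Matrix.inv_def, Ring.inverse_eq_inv, Matrix.smul_mulVec, Pi.smul_apply,
    smul_eq_mul, mul_inv_cancel_left₀ (hW _), ← h1, ← RingHom.map_adjugate]
  simp only [Matrix.mulVec, dotProduct, map_sum, map_mul, h2]
  rfl

/-- After multiplication by the nowhere vanishing common denominator of the coefficients, F becomes
a single exponential polynomial, so one non-zero value is enough. -/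
theorem finite_zeros_satoPoly_combination {κ : Fin n → ℝ} {A : Matrix (Fin k) (Fin n) ℝ}
    (hW : ∀ t, (wronskian κ A t).det ≠ 0) (t : KPTime) (a : ℕ → AddMonoidAlgebra ℝ ℝ) {F : ℝ → ℝ}
    (hF : ∀ x, F x = ∑ m ∈ Finset.range (k + 1),
      (satoPoly κ A (shiftX t x)).coeff m * expEval x (a m))
    (hne : ∃ x, F x ≠ 0) : {x | F x = 0}.Finite := by
  obtain ⟨τ, N, hτ, hN⟩ := exists_expPoly_dressingCoeff κ A hW t
  let p := τ * a k - ∑ m : Fin k, N m * a m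
  have hcoeff : ∀ s (m : Fin k), (satoPoly κ A s).coeff m = - dressingCoeff κ A s m := by
    intro s m
    rw [satoPoly, Polynomial.coeff_sub, Polynomial.coeff_X_pow, if_neg m.2.ne,
      Polynomial.finsetSum_coeff, Finset.sum_eq_single m]
    · simp
    · intro b _ hb
      rw [Polynomial.coeff_C_mul_X_pow, if_neg]
      exact fun h => hb (Fin.ext h.symm)
    · simp
  have hcoeffk : ∀ s, (satoPoly κ A s).coeff k = 1 := by
    intro s
    have := satoPoly_monic κ A s
    rwa [Polynomial.Monic, Polynomial.leadingCoeff, satoPoly_natDegree] at this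
  have h1 : ∀ x, expEval x p = expEval x τ * F x := by
    intro x
    rw [hF, Finset.sum_range_succ, hcoeffk, ← Fin.sum_univ_eq_sum_range
      (fun m => (satoPoly κ A (shiftX t x)).coeff m * expEval x (a m))]
    simp only [p, map_sub, map_mul, map_sum, hcoeff, ← hN, mul_add, Finset.mul_sum]
    rw [one_mul, sub_eq_neg_add, ← Finset.sum_neg_distrib]
    congr 1
    exact Finset.sum_congr rfl fun m _ => by ring
  have hp : p ≠ 0 := by
    rintro hp
    obtain ⟨x, hx⟩ := hne
    have := h1 x
    rw [hp, map_zero] at this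
    exact mul_ne_zero (hτ x) hx this.symm
  refine (finite_zeros_expEval hp).subset fun x hx => ?_
  simp only [Set.mem_ofPred_eq] at hx ⊢
  rw [h1, hx, mul_zero]

theorem finite_zeros_dressedSum {κ : Fin n → ℝ} {A : Matrix (Fin k) (Fin n) ℝ}
    (hW : ∀ t, (wronskian κ A t).det ≠ 0) (v : Fin n → ℝ) (t : KPTime)
    (hne : ∃ x, dressedSum κ (satoPoly κ A) v (shiftX t x) ≠ 0) :
    {x | dressedSum κ (satoPoly κ A) v (shiftX t x) = 0}.Finite := by
  refine finite_zeros_satoPoly_combination hW t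
    (fun m => expPolyOf κ (fun j => v j * κ j ^ m) t) (fun x => ?_) hne
  simp only [dressedSum, expEval_expPolyOf, expSum, Finset.mul_sum]
  rw [Finset.sum_comm]
  refine Finset.sum_congr rfl fun j _ => ?_
  rw [Polynomial.eval_eq_sum_range' (n := k + 1) (by rw [satoPoly_natDegree]; omega),
    Finset.mul_sum]
  exact Finset.sum_congr rfl fun m _ => by ring

end Sato

/-! ### Behaviour of the Sato polynomial as x tends to −∞ -/

namespace LeTableau

variable {k n : ℕ}

/-- The polynomial with the roots `κ_i`, `i` a pivot: the limit of the Sato polynomials as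
`x → -∞`. -/
noncomputable def pivotPoly (T : LeTableau k n) (κ : Fin n → ℝ) : Polynomial ℝ :=
  ∏ r : Fin k, (Polynomial.X - Polynomial.C (κ (T.pivot r)))

theorem pivotPoly_monic (T : LeTableau k n) (κ : Fin n → ℝ) : (T.pivotPoly κ).Monic :=
  Polynomial.monic_prod_of_monic _ _ fun _ _ => Polynomial.monic_X_sub_C _

theorem pivotPoly_natDegree (T : LeTableau k n) (κ : Fin n → ℝ) :
    (T.pivotPoly κ).natDegree = k := by
  rw [pivotPoly, Polynomial.natDegree_prod_of_monic _ _ fun _ _ => Polynomial.monic_X_sub_C _]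
  simp

/-- Row r starts with the entry 1 in its pivot column, so the pivot carries the smallest exponent of
f^(r), which dominates at −∞. -/
theorem tendsto_scaled_sum (T : LeTableau k n) {κ : Fin n → ℝ} (hκ : StrictMono κ) (t : KPTime)
    (r : Fin k) (d : Fin n → ℝ) :
    Tendsto (fun x => Real.exp (-κ (T.pivot r) * x) *
      ∑ j, T.matrix r j * (Real.exp (kpThetaReal (κ j) (shiftX t x)) * d j)) atBot
      (𝓝 (Real.exp (kpThetaReal (κ (T.pivot r)) t) * d (T.pivot r))) := by
  have h := tendsto_sum_exp_atBot Finset.univ κ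
    (fun j _ => T.matrix r j * (Real.exp (kpThetaReal (κ j) t) * d j))
    (fun j => T.matrix r j * (Real.exp (kpThetaReal (κ j) t) * d j)) (Finset.mem_univ (T.pivot r))
    (fun j _ hj => by
      rcases lt_or_gt_of_ne hj with h | h
      · right; funext x; simp [T.matrix_eq_zero_of_lt r h]
      · exact .inl (hκ h)) (fun i _ => tendsto_const_nhds)
  rw [matrix_pivot, if_pos rfl, one_mul] at h
  refine h.congr fun x => ?_
  rw [Finset.mul_sum]
  refine Finset.sum_congr rfl fun j _ => ?_
  rw [kpThetaReal_shiftX, Real.exp_add,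
    show (κ j - κ (T.pivot r)) * x = κ j * x + -κ (T.pivot r) * x by ring, Real.exp_add]
  ring

/-- Scaling the rows by e^{−κx}, with κ at the pivot of the row, does not change the solution of the
linear system. The scaled Wronskian converges to a Vandermonde matrix at the pivots with scaled
rows, and the limit system says that the limit polynomial vanishes at all pivots. -/
theorem tendsto_dressingCoeff (T : LeTableau k n) {κ : Fin n → ℝ} (hκ : StrictMono κ)
    (t : KPTime) (m : Fin k) :
    Tendsto (fun x => dressingCoeff κ T.matrix (shiftX t x) m) atBot
      (𝓝 (-(T.pivotPoly κ).coeff m)) := by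
  let e : Fin k → ℝ := fun r => Real.exp (kpThetaReal (κ (T.pivot r)) t)
  let D : ℝ → Matrix (Fin k) (Fin k) ℝ :=
    fun x => Matrix.diagonal fun r => Real.exp (-κ (T.pivot r) * x)
  let L : Matrix (Fin k) (Fin k) ℝ :=
    Matrix.of fun r m => e r * Matrix.vandermonde (fun r => κ (T.pivot r)) r m
  let ℓ : Fin k → ℝ := fun r => e r * κ (T.pivot r) ^ k
  have hL : L.det ≠ 0 := by
    rw [Matrix.det_mul_column]
    refine mul_ne_zero (Finset.prod_ne_zero_iff.2 fun r _ => (Real.exp_pos _).ne') ?_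
    exact Matrix.det_vandermonde_ne_zero_iff.2 (hκ.injective.comp T.pivot_strictMono.injective)
  have hW : Tendsto (fun x => D x * wronskian κ T.matrix (shiftX t x)) atBot (𝓝 L) := by
    refine tendsto_pi_nhds.2 fun r => tendsto_pi_nhds.2 fun m => ?_
    have := T.tendsto_scaled_sum hκ t r (fun j => κ j ^ (m : ℕ))
    refine this.congr fun x => ?_
    rw [Matrix.diagonal_mul, wronskian, Matrix.mul_apply]; rfl
  have hb : Tendsto (fun x => (D x).mulVec (topDeriv κ T.matrix (shiftX t x))) atBot (𝓝 ℓ) := by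
    refine tendsto_pi_nhds.2 fun r => ?_
    have := T.tendsto_scaled_sum hκ t r (fun j => κ j ^ k)
    refine this.congr fun x => ?_
    rw [Matrix.mulVec_diagonal]; rfl
  have hD : ∀ x, (D x).det ≠ 0 := fun x => by
    rw [Matrix.det_diagonal]
    exact Finset.prod_ne_zero_iff.2 fun r _ => (Real.exp_pos _).ne'
  have hcoeff : ∀ x, dressingCoeff κ T.matrix (shiftX t x) =
      (D x * wronskian κ T.matrix (shiftX t x))⁻¹.mulVec
        ((D x).mulVec (topDeriv κ T.matrix (shiftX t x))) := by
    intro x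
    rw [dressingCoeff_eq, Matrix.mul_inv_rev, Matrix.mulVec_mulVec, Matrix.mul_assoc,
      Matrix.nonsing_inv_mul _ (isUnit_iff_ne_zero.2 (hD x)), Matrix.mul_one]
  have hinv : Tendsto (fun x => (D x * wronskian κ T.matrix (shiftX t x))⁻¹) atBot (𝓝 L⁻¹) := by
    simp only [Matrix.inv_def, Ring.inverse_eq_inv]
    refine Tendsto.smul ?_ ?_
    · exact ((continuous_id.matrix_det.tendsto L).comp hW).inv₀ hL
    · exact (continuous_id.matrix_adjugate.tendsto L).comp hW
  have hlim : Tendsto (fun x => dressingCoeff κ T.matrix (shiftX t x)) atBot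
      (𝓝 (L⁻¹.mulVec ℓ)) := by
    simp only [hcoeff]
    have hcont : Continuous fun p : Matrix (Fin k) (Fin k) ℝ × (Fin k → ℝ) => p.1.mulVec p.2 :=
      continuous_fst.matrix_mulVec continuous_snd
    have h1 := hinv.prodMk_nhds hb
    have h2 := (hcont.tendsto (L⁻¹, ℓ)).comp h1
    simpa only [Function.comp_def] using h2
  have hsol : L⁻¹.mulVec ℓ = fun m : Fin k => -(T.pivotPoly κ).coeff m := by
    have h1 : L.mulVec (fun m : Fin k => -(T.pivotPoly κ).coeff m) = ℓ := by
      funext r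
      have h2 : (T.pivotPoly κ).eval (κ (T.pivot r)) = 0 := by
        rw [pivotPoly, Polynomial.eval_prod]
        exact Finset.prod_eq_zero (Finset.mem_univ r) (by simp)
      rw [Polynomial.eval_eq_sum_range, pivotPoly_natDegree, Finset.sum_range_succ] at h2
      have h3 : (T.pivotPoly κ).coeff k = 1 := by
        have := T.pivotPoly_monic κ
        rwa [Polynomial.Monic, Polynomial.leadingCoeff, pivotPoly_natDegree] at this
      rw [h3, one_mul, ← Fin.sum_univ_eq_sum_range
        (fun m => (T.pivotPoly κ).coeff m * κ (T.pivot r) ^ m)] at h2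
      simp only [Matrix.mulVec, dotProduct, L, ℓ, Matrix.of_apply, Matrix.vandermonde_apply]
      rw [← neg_eq_iff_add_eq_zero.2 h2, mul_neg, Finset.mul_sum, ← Finset.sum_neg_distrib]
      exact Finset.sum_congr rfl fun m _ => by ring
    rw [← h1, Matrix.mulVec_mulVec, Matrix.nonsing_inv_mul _ (isUnit_iff_ne_zero.2 hL),
      Matrix.one_mulVec]
  rw [hsol] at hlim
  exact tendsto_pi_nhds.1 hlim m

theorem tendsto_satoPoly_coeff (T : LeTableau k n) {κ : Fin n → ℝ} (hκ : StrictMono κ)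
    (t : KPTime) (m : ℕ) :
    Tendsto (fun x => (satoPoly κ T.matrix (shiftX t x)).coeff m) atBot
      (𝓝 ((T.pivotPoly κ).coeff m)) := by
  rcases lt_trichotomy m k with h | rfl | h
  · have h1 := (T.tendsto_dressingCoeff hκ t ⟨m, h⟩).neg
    rw [neg_neg] at h1
    refine h1.congr fun x => ?_
    rw [satoPoly, Polynomial.coeff_sub, Polynomial.coeff_X_pow, if_neg h.ne,
      Polynomial.finsetSum_coeff, Finset.sum_eq_single ⟨m, h⟩]
    · simp
    · intro b _ hb
      rw [Polynomial.coeff_C_mul_X_pow, if_neg]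
      exact fun h => hb (Fin.ext h.symm)
    · simp
  · have h3 : (T.pivotPoly κ).coeff m = 1 := by
      have := T.pivotPoly_monic κ
      rwa [Polynomial.Monic, Polynomial.leadingCoeff, pivotPoly_natDegree] at this
    have h4 : ∀ s, (satoPoly κ T.matrix s).coeff m = 1 := by
      intro s
      have := satoPoly_monic κ T.matrix s
      rwa [Polynomial.Monic, Polynomial.leadingCoeff, satoPoly_natDegree] at this
    simp [h3, h4]
  · rw [Polynomial.coeff_eq_zero_of_natDegree_lt (by rwa [pivotPoly_natDegree])]
    refine tendsto_const_nhds.congr fun x => ?_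
    rw [Polynomial.coeff_eq_zero_of_natDegree_lt (by rwa [satoPoly_natDegree])]

theorem tendsto_satoPoly_eval (T : LeTableau k n) {κ : Fin n → ℝ} (hκ : StrictMono κ)
    (t : KPTime) (z : ℝ) :
    Tendsto (fun x => (satoPoly κ T.matrix (shiftX t x)).eval z) atBot
      (𝓝 ((T.pivotPoly κ).eval z)) := by
  rw [Polynomial.eval_eq_sum_range, pivotPoly_natDegree]
  simp_rw [Polynomial.eval_eq_sum_range, satoPoly_natDegree]
  exact tendsto_finsetSum _ fun m _ => (T.tendsto_satoPoly_coeff hκ t m).mul_const _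

theorem pivotPoly_eval_ne_zero (T : LeTableau k n) {κ : Fin n → ℝ} {z : ℝ}
    (hz : ∀ r, z ≠ κ (T.pivot r)) : (T.pivotPoly κ).eval z ≠ 0 := by
  rw [pivotPoly, Polynomial.eval_prod]
  exact Finset.prod_ne_zero_iff.2 fun r _ => by simpa [sub_eq_zero] using hz r

/-- Take the first column j₀ in the support of v. It is not a pivot, so the limit polynomial does
not vanish at κ_{j₀}, and the sum divided by e^{κ_{j₀} x} has a non-zero limit at −∞. -/
theorem finite_zeros_dressedSum_of_ne_zero (T : LeTableau k n) {κ : Fin n → ℝ}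
    (hκ : StrictMono κ) (hW : ∀ t, (wronskian κ T.matrix t).det ≠ 0) {v : Fin n → ℝ}
    (hv : v ≠ 0) (hp : ∀ r, v (T.pivot r) = 0) (t : KPTime) :
    {x | dressedSum κ (satoPoly κ T.matrix) v (shiftX t x) = 0}.Finite := by
  classical
  refine finite_zeros_dressedSum hW v t ?_
  obtain ⟨j, hj⟩ := Function.ne_iff.1 hv
  obtain ⟨j₀, hj₀, hmin⟩ := Finset.exists_min_image (Finset.univ.filter fun j => v j ≠ 0) id
    ⟨j, by simpa using hj⟩
  simp only [Finset.mem_filter, Finset.mem_univ, true_and, id] at hj₀ hmin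
  have h := tendsto_sum_exp_atBot Finset.univ κ
    (fun j x => v j * Real.exp (kpThetaReal (κ j) t) *
      (satoPoly κ T.matrix (shiftX t x)).eval (κ j))
    (fun j => v j * Real.exp (kpThetaReal (κ j) t) * (T.pivotPoly κ).eval (κ j))
    (Finset.mem_univ j₀)
    (fun j _ hj => by
      by_cases hvj : v j = 0
      · right; funext x; simp [hvj]
      · exact .inl (hκ (lt_of_le_of_ne (hmin j hvj) hj.symm)))
    (fun j _ => (T.tendsto_satoPoly_eval hκ t (κ j)).const_mul _)
  have hne : v j₀ * Real.exp (kpThetaReal (κ j₀) t) * (T.pivotPoly κ).eval (κ j₀) ≠ 0 := by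
    refine mul_ne_zero (mul_ne_zero hj₀ (Real.exp_pos _).ne') ?_
    refine T.pivotPoly_eval_ne_zero fun r hr => hj₀ ?_
    rw [hκ.injective hr, hp]
  obtain ⟨x, hx⟩ := (h.eventually_ne hne).exists
  refine ⟨x, fun h0 => hx ?_⟩
  have : dressedSum κ (satoPoly κ T.matrix) v (shiftX t x) * Real.exp (-κ j₀ * x) = 0 := by
    rw [h0, zero_mul]
  rw [← this, dressedSum, Finset.sum_mul]
  refine Finset.sum_congr rfl fun j _ => ?_
  rw [kpThetaReal_shiftX, Real.exp_add, sub_mul, sub_eq_add_neg, Real.exp_add, neg_mul]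
  ring

end LeTableau

/-! ### The reduced Sato polynomial -/

namespace LeTableau

variable {k n : ℕ}

theorem isolatedFactor_monic (T : LeTableau k n) (κ : Fin n → ℝ) :
    (T.isolatedFactor κ).Monic := by
  classical
  refine Polynomial.monic_prod_of_monic _ _ fun r _ => ?_
  split_ifs
  · exact Polynomial.monic_one
  · exact Polynomial.monic_X_sub_C _

theorem isolatedFactor_natDegree_add (T : LeTableau k n) (κ : Fin n → ℝ) :
    (T.isolatedFactor κ).natDegree + T.reducedOrder = k := by
  classical
  rw [isolatedFactor, Polynomial.natDegree_prod_of_monic, reducedOrder, Nat.card_eq_fintype_card,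
    Fintype.card_subtype, Finset.card_filter, ← Finset.sum_add_distrib]
  · rw [Finset.sum_congr rfl (g := fun _ => 1)]
    · simp
    · intro r _
      split_ifs <;> simp
  · intro r _
    split_ifs
    · exact Polynomial.monic_one
    · exact Polynomial.monic_X_sub_C _

theorem isolatedFactor_eval_eq_zero_iff (T : LeTableau k n) (κ : Fin n → ℝ) (z : ℝ) :
    (T.isolatedFactor κ).eval z = 0 ↔ ∃ r, ¬ T.RowNonempty r ∧ z = κ (T.pivot r) := by
  classical
  rw [isolatedFactor, Polynomial.eval_prod, Finset.prod_eq_zero_iff]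
  refine exists_congr fun r => ?_
  by_cases h : T.RowNonempty r <;> simp [h, sub_eq_zero]

/-- For an isolated row f is the single exponential e^θ at the pivot, and 𝔇 multiplies it by the
value of its symbol there. -/
theorem satoPoly_eval_isolated (T : LeTableau k n) {κ : Fin n → ℝ} {t : KPTime}
    (hW : (wronskian κ T.matrix t).det ≠ 0) {r : Fin k} (hr : ¬ T.RowNonempty r) :
    (satoPoly κ T.matrix t).eval (κ (T.pivot r)) = 0 := by
  have h := dressedSum_satoPoly_row hW r
  rw [matrix_row_isolated _ hr, dressedSum_single] at h
  exact (mul_eq_zero.1 h).resolve_left (Real.exp_pos _).ne'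

theorem isolatedFactor_dvd (T : LeTableau k n) {κ : Fin n → ℝ} (hκ : StrictMono κ) {t : KPTime}
    (hW : (wronskian κ T.matrix t).det ≠ 0) : T.isolatedFactor κ ∣ satoPoly κ T.matrix t := by
  classical
  refine Finset.prod_dvd_of_coprime (fun r _ s _ hrs => ?_) fun r _ => ?_
  · simp only [Function.onFun]
    split_ifs
    · exact isCoprime_one_left
    · exact isCoprime_one_left
    · exact isCoprime_one_right
    · refine Polynomial.isCoprime_X_sub_C_of_isUnit_sub (isUnit_iff_ne_zero.2 (sub_ne_zero.2 ?_))
      exact (hκ.injective.comp T.pivot_strictMono.injective).ne hrs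
  · split_ifs with h
    · exact one_dvd _
    · exact Polynomial.dvd_iff_isRoot.2 (T.satoPoly_eval_isolated hW h)

theorem satoPoly_eq_mul (T : LeTableau k n) {κ : Fin n → ℝ} (hκ : StrictMono κ) {t : KPTime}
    (hW : (wronskian κ T.matrix t).det ≠ 0) :
    satoPoly κ T.matrix t = T.isolatedFactor κ * T.reducedSatoPoly κ T.matrix t := by
  obtain ⟨R, hR⟩ := T.isolatedFactor_dvd hκ hW
  rw [reducedSatoPoly, hR, Polynomial.mul_divByMonic_cancel_left _ (T.isolatedFactor_monic κ)]

theorem reducedSatoPoly_monic (T : LeTableau k n) {κ : Fin n → ℝ} (hκ : StrictMono κ) {t : KPTime}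
    (hW : (wronskian κ T.matrix t).det ≠ 0) : (T.reducedSatoPoly κ T.matrix t).Monic := by
  have h := satoPoly_monic κ T.matrix t
  rw [T.satoPoly_eq_mul hκ hW] at h
  exact (T.isolatedFactor_monic κ).of_mul_monic_left h

theorem reducedSatoPoly_natDegree (T : LeTableau k n) (κ : Fin n → ℝ) (t : KPTime) :
    (T.reducedSatoPoly κ T.matrix t).natDegree = T.reducedOrder := by
  rw [reducedSatoPoly, Polynomial.natDegree_divByMonic _ (T.isolatedFactor_monic κ),
    satoPoly_natDegree]
  have := T.isolatedFactor_natDegree_add κ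
  omega

theorem pivotPoly_derivative_ne_zero (T : LeTableau k n) {κ : Fin n → ℝ} (hκ : StrictMono κ)
    (r : Fin k) : (T.pivotPoly κ).derivative.eval (κ (T.pivot r)) ≠ 0 := by
  classical
  rw [pivotPoly, ← Finset.mul_prod_erase _ _ (Finset.mem_univ r)]
  simp only [Polynomial.derivative_mul, Polynomial.derivative_sub, Polynomial.derivative_X,
    Polynomial.derivative_C, Polynomial.eval_add, Polynomial.eval_mul, Polynomial.eval_sub,
    Polynomial.eval_X, Polynomial.eval_C, sub_self, zero_mul, add_zero, sub_zero,
    one_mul, Polynomial.eval_prod]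
  refine Finset.prod_ne_zero_iff.2 fun s hs => sub_ne_zero.2 ?_
  exact (hκ.injective.comp T.pivot_strictMono.injective).ne (Finset.ne_of_mem_erase hs).symm

/-- The reduced Sato polynomial vanishes at a given point, other than the pivots of the non-empty
rows, for finitely many `x` only. -/
theorem finite_zeros_reducedSatoPoly (T : LeTableau k n) {κ : Fin n → ℝ} (hκ : StrictMono κ)
    (hW : ∀ t, (wronskian κ T.matrix t).det ≠ 0) (t : KPTime) {z : ℝ}
    (hz : ∀ r, T.RowNonempty r → z ≠ κ (T.pivot r)) :
    {x | (T.reducedSatoPoly κ T.matrix (shiftX t x)).eval z = 0}.Finite := by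
  by_cases hq : (T.isolatedFactor κ).eval z = 0
  -- At an isolated pivot S = q S' vanishes at all times and gives no information. Since q has the
  -- root z, the derivative of S there is q' S', and it tends to the derivative of `pivotPoly` at a
  -- simple root, which is not zero.
  · obtain ⟨r, hr, rfl⟩ := (T.isolatedFactor_eval_eq_zero_iff κ z).1 hq
    have hF : ∀ x, (satoPoly κ T.matrix (shiftX t x)).derivative.eval (κ (T.pivot r)) =
        ∑ m ∈ Finset.range (k + 1), (satoPoly κ T.matrix (shiftX t x)).coeff m *
          (m * κ (T.pivot r) ^ (m - 1)) := by
      intro x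
      rw [Polynomial.derivative_eval, Polynomial.sum_over_range' _ _ (k + 1)]
      · exact Finset.sum_congr rfl fun m _ => by ring
      · rw [satoPoly_natDegree]; omega
      · simp
    refine (finite_zeros_satoPoly_combination hW t
      (fun m => AddMonoidAlgebra.single 0 (m * κ (T.pivot r) ^ (m - 1)))
      (F := fun x => (satoPoly κ T.matrix (shiftX t x)).derivative.eval (κ (T.pivot r)))
      (fun x => ?_) ?_).subset fun x hx => ?_
    · simp only [hF, expEval_single, zero_mul, Real.exp_zero, mul_one]
    · have h1 : Tendsto (fun x => (satoPoly κ T.matrix (shiftX t x)).derivative.eval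
          (κ (T.pivot r))) atBot (𝓝 ((T.pivotPoly κ).derivative.eval (κ (T.pivot r)))) := by
        have h2 : (T.pivotPoly κ).derivative.eval (κ (T.pivot r)) =
            ∑ m ∈ Finset.range (k + 1), (T.pivotPoly κ).coeff m *
              (m * κ (T.pivot r) ^ (m - 1)) := by
          rw [Polynomial.derivative_eval, Polynomial.sum_over_range' _ _ (k + 1)]
          · exact Finset.sum_congr rfl fun m _ => by ring
          · rw [pivotPoly_natDegree]; omega
          · simp
        rw [h2]
        simp_rw [hF]
        exact tendsto_finsetSum _ fun m _ => (T.tendsto_satoPoly_coeff hκ t m).mul_const _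
      exact (h1.eventually_ne (T.pivotPoly_derivative_ne_zero hκ r)).exists
    · simp only [Set.mem_ofPred_eq] at hx ⊢
      rw [T.satoPoly_eq_mul hκ (hW _), Polynomial.derivative_mul, Polynomial.eval_add,
        Polynomial.eval_mul, Polynomial.eval_mul, hx, hq]
      ring
  · have hz' : ∀ r, z ≠ κ (T.pivot r) := by
      intro r
      by_cases hr : T.RowNonempty r
      · exact hz r hr
      · exact fun h => hq ((T.isolatedFactor_eval_eq_zero_iff κ z).2 ⟨r, hr, h⟩)
    refine (finite_zeros_satoPoly_combination hW t
      (fun m => AddMonoidAlgebra.single 0 (z ^ m))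
      (F := fun x => (satoPoly κ T.matrix (shiftX t x)).eval z)
      (fun x => ?_) ?_).subset fun x hx => ?_
    · simp only [Polynomial.eval_eq_sum_range, satoPoly_natDegree, expEval_single, zero_mul,
        Real.exp_zero, mul_one]
    · exact ((T.tendsto_satoPoly_eval hκ t z).eventually_ne (T.pivotPoly_eval_ne_zero hz')).exists
    · simp only [Set.mem_ofPred_eq] at hx ⊢
      rw [T.satoPoly_eq_mul hκ (hW _), Polynomial.eval_mul, hx, mul_zero]

end LeTableau

/-! ### Limits and orders of rational functions on the projective line -/

theorem comap_coe_nhdsNE_coe (z : ℂ) :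
    comap ((↑) : ℂ → OnePoint ℂ) (𝓝[≠] (z : OnePoint ℂ)) = 𝓝[≠] z := by
  have h : ((↑) : ℂ → OnePoint ℂ) ⁻¹' {(z : OnePoint ℂ)}ᶜ = {z}ᶜ := by
    ext w; simp
  rw [OnePoint.nhdsWithin_coe, comap_map OnePoint.coe_injective, h]

theorem comap_coe_nhdsNE_infty :
    comap ((↑) : ℂ → OnePoint ℂ) (𝓝[≠] ∞) = cocompact ℂ := by
  rw [OnePoint.nhdsNE_infty_eq, comap_map OnePoint.coe_injective, coclosedCompact_eq_cocompact]

theorem hasValueAt_coe {f : ℂ → ℂ} {z v : ℂ} :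
    HasValueAt f (z : OnePoint ℂ) v ↔ Tendsto f (𝓝[≠] z) (𝓝 v) := by
  rw [HasValueAt, comap_coe_nhdsNE_coe]

theorem hasValueAt_infty {f : ℂ → ℂ} {v : ℂ} :
    HasValueAt f ∞ v ↔ Tendsto f (cocompact ℂ) (𝓝 v) := by
  rw [HasValueAt, comap_coe_nhdsNE_infty]

instance comap_coe_nhdsNE_neBot (p : OnePoint ℂ) :
    (comap ((↑) : ℂ → OnePoint ℂ) (𝓝[≠] p)).NeBot := by
  induction p using OnePoint.rec with
  | infty => rw [comap_coe_nhdsNE_infty]; infer_instance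
  | coe z => rw [comap_coe_nhdsNE_coe]; infer_instance

theorem HasValueAt.unique {f : ℂ → ℂ} {p : OnePoint ℂ} {v w : ℂ} (h : HasValueAt f p v)
    (h' : HasValueAt f p w) : v = w := tendsto_nhds_unique h h'

theorem HasValueAt.div {f g : ℂ → ℂ} {p : OnePoint ℂ} {v w : ℂ} (h : HasValueAt f p v)
    (h' : HasValueAt g p w) (hw : w ≠ 0) : HasValueAt (fun ζ => f ζ / g ζ) p (v / w) :=
  Tendsto.div h h' hw

/-- Limits and orders do not see finitely many points. This allows to replace a quotient by its
reduced form, although the two may differ at the zeros of the denominators. -/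
theorem comap_coe_nhdsNE_le_cofinite (p : OnePoint ℂ) :
    comap ((↑) : ℂ → OnePoint ℂ) (𝓝[≠] p) ≤ cofinite := by
  induction p using OnePoint.rec with
  | infty => rw [comap_coe_nhdsNE_infty]; exact cocompact_le_cofinite
  | coe z => rw [comap_coe_nhdsNE_coe]; exact nhdsNE_le_cofinite z

theorem HasValueAt.congr {f g : ℂ → ℂ} {p : OnePoint ℂ} {v : ℂ} (h : HasValueAt f p v)
    (hfg : f =ᶠ[cofinite] g) : HasValueAt g p v :=
  Tendsto.congr' (comap_coe_nhdsNE_le_cofinite p hfg) h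

theorem hasValueAt_const (c : ℂ) (p : OnePoint ℂ) : HasValueAt (fun _ => c) p c :=
  tendsto_const_nhds

theorem hasValueAt_of_continuousAt {f : ℂ → ℂ} {z : ℂ} (h : ContinuousAt f z) :
    HasValueAt f (z : OnePoint ℂ) (f z) :=
  hasValueAt_coe.2 (h.tendsto.mono_left nhdsWithin_le_nhds)

theorem eventually_comp_inv_of_cofinite {p : ℂ → Prop} (h : ∀ᶠ ζ in cofinite, p ζ) :
    ∀ᶠ u in 𝓝[≠] (0 : ℂ), p u⁻¹ :=
  tendsto_inv₀_nhdsNE_zero.eventually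
    ((Metric.cobounded_eq_cocompact (α := ℂ) ▸ cocompact_le_cofinite) h)

theorem meromorphicAtPoint_congr {f g : ℂ → ℂ} {p : OnePoint ℂ} (hfg : f =ᶠ[cofinite] g)
    (h : MeromorphicAtPoint f p) : MeromorphicAtPoint g p := by
  induction p using OnePoint.rec with
  | infty => exact MeromorphicAt.congr h (eventually_comp_inv_of_cofinite hfg)
  | coe z => exact MeromorphicAt.congr h (nhdsNE_le_cofinite z hfg)

theorem orderAtPoint_congr {f g : ℂ → ℂ} {p : OnePoint ℂ} (hfg : f =ᶠ[cofinite] g) :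
    orderAtPoint f p = orderAtPoint g p := by
  induction p using OnePoint.rec with
  | infty => exact meromorphicOrderAt_congr (eventually_comp_inv_of_cofinite hfg)
  | coe z => exact meromorphicOrderAt_congr (nhdsNE_le_cofinite z hfg)

theorem orderAtPoint_div {f g : ℂ → ℂ} {p : OnePoint ℂ} (hf : MeromorphicAtPoint f p)
    (hg : MeromorphicAtPoint g p) :
    orderAtPoint (fun ζ => f ζ / g ζ) p = orderAtPoint f p - orderAtPoint g p := by
  induction p using OnePoint.rec with
  | infty => exact fun_meromorphicOrderAt_div hf hg
  | coe z => exact fun_meromorphicOrderAt_div hf hg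

theorem MeromorphicAtPoint.div {f g : ℂ → ℂ} {p : OnePoint ℂ} (hf : MeromorphicAtPoint f p)
    (hg : MeromorphicAtPoint g p) : MeromorphicAtPoint (fun ζ => f ζ / g ζ) p := by
  induction p using OnePoint.rec with
  | infty => exact MeromorphicAt.fun_div hf hg
  | coe z => exact MeromorphicAt.fun_div hf hg

namespace Polynomial

/-- The order of a polynomial at a point of the projective line. -/
noncomputable def orderAt (p : ℂ[X]) (P : OnePoint ℂ) : ℤ :=
  P.elim (-(p.natDegree : ℤ)) (fun z => (p.rootMultiplicity z : ℤ))

theorem orderAt_coe (p : ℂ[X]) (z : ℂ) : p.orderAt (z : OnePoint ℂ) = p.rootMultiplicity z := rfl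

theorem orderAt_infty (p : ℂ[X]) : p.orderAt ∞ = -(p.natDegree : ℤ) := rfl

/-- This is the passage to the local parameter at infinity: the reflected polynomial is regular at
0, and the power of ζ carries the order. -/
theorem eval_eq_pow_mul_eval_reflect (p : ℂ[X]) {N : ℕ} (hN : p.natDegree ≤ N) {ζ : ℂ}
    (hζ : ζ ≠ 0) : p.eval ζ = (reflect N p).eval ζ⁻¹ * ζ ^ N := by
  let : Invertible ζ := invertibleOfNonzero hζ
  have := eval₂_reflect_mul_pow (RingHom.id ℂ) ζ N p hN
  rw [invOf_eq_inv] at this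
  exact this.symm

theorem eval_reflect_zero (p : ℂ[X]) (N : ℕ) : (reflect N p).eval 0 = p.coeff N := by
  rw [← coeff_zero_eq_eval_zero, coeff_reflect, revAt_zero]

theorem meromorphicAtPoint (p : ℂ[X]) (P : OnePoint ℂ) :
    MeromorphicAtPoint (fun ζ => p.eval ζ) P := by
  induction P using OnePoint.rec with
  | infty =>
    have h : MeromorphicAt (fun u : ℂ => (p.reverse).eval u * (u⁻¹) ^ p.natDegree) 0 := by
      refine MeromorphicAt.fun_mul (AnalyticAt.meromorphicAt ?_) ?_
      · exact (p.reverse.differentiable).analyticAt 0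
      · exact (MeromorphicAt.id 0).fun_inv.fun_pow _
    refine h.congr ?_
    filter_upwards [self_mem_nhdsWithin] with u hu
    rw [eval_eq_pow_mul_eval_reflect p le_rfl (inv_ne_zero hu), inv_inv]; rfl
  | coe z => exact ((p.differentiable).analyticAt z).meromorphicAt

theorem orderAtPoint_eq {p : ℂ[X]} (hp : p ≠ 0) (P : OnePoint ℂ) :
    orderAtPoint (fun ζ => p.eval ζ) P = (p.orderAt P : ℤ) := by
  induction P using OnePoint.rec with
  | infty =>
    refine (meromorphicOrderAt_eq_int_iff (meromorphicAtPoint p ∞)).2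
      ⟨fun u => p.reverse.eval u, (p.reverse.differentiable).analyticAt 0, ?_, ?_⟩
    · change p.reverse.eval 0 ≠ 0
      rw [reverse, eval_reflect_zero]; simpa using hp
    · filter_upwards [self_mem_nhdsWithin] with u hu
      rw [eval_eq_pow_mul_eval_reflect p le_rfl (inv_ne_zero hu), inv_inv, orderAt_infty,
        zpow_neg, sub_zero, smul_eq_mul, zpow_natCast, inv_pow, mul_comm]; rfl
  | coe z =>
    refine (meromorphicOrderAt_eq_int_iff (meromorphicAtPoint p z)).2
      ⟨fun u => (p /ₘ (X - C z) ^ p.rootMultiplicity z).eval u,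
        (Polynomial.differentiable _).analyticAt z,
        eval_divByMonic_pow_rootMultiplicity_ne_zero z hp, ?_⟩
    refine Eventually.of_forall fun u => ?_
    conv_lhs => rw [← pow_mul_divByMonic_rootMultiplicity_eq p z]
    simp [orderAt_coe]

theorem orderAtPoint_div_eq {p q : ℂ[X]} (hp : p ≠ 0) (hq : q ≠ 0) (P : OnePoint ℂ) :
    orderAtPoint (fun ζ => p.eval ζ / q.eval ζ) P = ((p.orderAt P - q.orderAt P : ℤ) : WithTop ℤ) := by
  rw [orderAtPoint_div (meromorphicAtPoint p P) (meromorphicAtPoint q P), orderAtPoint_eq hp,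
    orderAtPoint_eq hq]
  rfl

theorem orderAtPoint_zero (P : OnePoint ℂ) : orderAtPoint (fun _ => 0) P = ⊤ := by
  induction P using OnePoint.rec with
  | infty => exact meromorphicOrderAt_eq_top_iff.2 (by simp)
  | coe z => exact meromorphicOrderAt_eq_top_iff.2 (by simp)

theorem hasValueAt_div_coe (p q : ℂ[X]) {z : ℂ} (hq : q.eval z ≠ 0) :
    HasValueAt (fun ζ => p.eval ζ / q.eval ζ) (z : OnePoint ℂ) (p.eval z / q.eval z) :=
  hasValueAt_of_continuousAt (p.continuous.continuousAt.div q.continuous.continuousAt hq)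

theorem hasValueAt_div_infty {p q : ℂ[X]} {N : ℕ} (hp : p.natDegree ≤ N) (hqN : q.natDegree ≤ N)
    (hq : q.coeff N ≠ 0) :
    HasValueAt (fun ζ => p.eval ζ / q.eval ζ) ∞ (p.coeff N / q.coeff N) := by
  rw [hasValueAt_infty]
  have h1 : Tendsto (fun ζ : ℂ => ζ⁻¹) (cocompact ℂ) (𝓝 0) := by
    rw [← Metric.cobounded_eq_cocompact]; exact tendsto_inv₀_cobounded
  have h2 : Tendsto (fun ζ : ℂ => (reflect N p).eval ζ⁻¹ / (reflect N q).eval ζ⁻¹) (cocompact ℂ)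
      (𝓝 (p.coeff N / q.coeff N)) := by
    rw [← eval_reflect_zero, ← eval_reflect_zero]
    rw [← eval_reflect_zero] at hq
    exact (((reflect N p).continuous.tendsto 0).comp h1).div
      (((reflect N q).continuous.tendsto 0).comp h1) hq
  refine h2.congr' ?_
  have h3 : ∀ᶠ ζ : ℂ in cocompact ℂ, ζ ≠ 0 := by
    have := (Set.finite_singleton (0 : ℂ)).compl_mem_cofinite
    exact cocompact_le_cofinite this
  filter_upwards [h3] with ζ hζ
  rw [eval_eq_pow_mul_eval_reflect p hp hζ, eval_eq_pow_mul_eval_reflect q hqN hζ,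
    mul_div_mul_right _ _ (pow_ne_zero _ hζ)]

theorem eventually_cofinite_eval_ne_zero {p : ℂ[X]} (hp : p ≠ 0) :
    ∀ᶠ ζ in cofinite, p.eval ζ ≠ 0 := by
  rw [eventually_cofinite]
  simpa using p.finite_setOfPred_isRoot hp

end Polynomial

/-- Numerator and denominator of f are coprime, so every root of the denominator is a pole of the
same order, bounded by the multiplicity in Q. Over ℂ this means that the denominator divides Q; the
condition at infinity bounds the degree. -/
theorem RatFunc.exists_polynomial_of_order_ge (f : RatFunc ℂ) {Q : Polynomial ℂ} (hQ : Q ≠ 0)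
    (hfin : ∀ z : ℂ, ((-(Q.rootMultiplicity z : ℤ) : ℤ) : WithTop ℤ) ≤
      orderAtPoint (fun ζ => f.eval (RingHom.id ℂ) ζ) (z : OnePoint ℂ))
    (hinf : 0 ≤ orderAtPoint (fun ζ => f.eval (RingHom.id ℂ) ζ) ∞) :
    ∃ p : Polynomial ℂ, p.natDegree ≤ Q.natDegree ∧
      f = algebraMap _ _ p / algebraMap _ _ Q := by
  by_cases hf : f = 0
  · exact ⟨0, by simp, by simp [hf]⟩
  have hnum : f.num ≠ 0 := RatFunc.num_ne_zero hf
  have hden : f.denom ≠ 0 := f.denom_ne_zero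
  have heval : ∀ P, orderAtPoint (fun ζ => f.eval (RingHom.id ℂ) ζ) P =
      ((f.num.orderAt P - f.denom.orderAt P : ℤ) : WithTop ℤ) := by
    intro P
    rw [← Polynomial.orderAtPoint_div_eq hnum hden]
    rfl
  have hdvd : f.denom ∣ Q := by
    have hsplit : f.denom.Splits := IsAlgClosed.splits _
    rw [hsplit.dvd_iff_roots_le_roots hden hQ, Multiset.le_iff_count]
    intro z
    rw [Polynomial.count_roots, Polynomial.count_roots]
    have h1 := hfin z
    rw [heval] at h1
    have h2 : -(Q.rootMultiplicity z : ℤ) ≤ f.num.rootMultiplicity z - f.denom.rootMultiplicity z := by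
      exact WithTop.coe_le_coe.1 h1
    by_cases hz : f.num.rootMultiplicity z = 0
    · omega
    by_cases hz' : f.denom.rootMultiplicity z = 0
    · omega
    exfalso
    have r1 : f.num.eval z = 0 := (Polynomial.rootMultiplicity_pos hnum).1 (Nat.pos_of_ne_zero hz)
    have r2 : f.denom.eval z = 0 :=
      (Polynomial.rootMultiplicity_pos hden).1 (Nat.pos_of_ne_zero hz')
    obtain ⟨a, b, hab⟩ := f.isCoprime_num_denom
    have := congrArg (Polynomial.eval z) hab
    simp [r1, r2] at this
  obtain ⟨R, hR⟩ := hdvd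
  have hR0 : R ≠ 0 := by rintro rfl; exact hQ (by simpa using hR)
  refine ⟨f.num * R, ?_, ?_⟩
  · rw [heval] at hinf
    have h1 : (0 : ℤ) ≤ f.num.orderAt ∞ - f.denom.orderAt ∞ := by exact_mod_cast hinf
    rw [Polynomial.orderAt_infty, Polynomial.orderAt_infty] at h1
    rw [hR, Polynomial.natDegree_mul hnum hR0, Polynomial.natDegree_mul hden hR0]
    omega
  · conv_lhs => rw [← RatFunc.num_div_denom f]
    rw [hR, map_mul, map_mul, mul_div_mul_right]
    exact (map_ne_zero_iff _ (RatFunc.algebraMap_injective ℂ)).2 hR0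

/-! ### The dressed wave function as a quotient of polynomials -/

namespace LeTableau

variable {k n : ℕ}

/-- `A` has the same Darboux operator as the matrix of the tableau, and the Wronskian of the latter
vanishes nowhere. -/
structure Regular (T : LeTableau k n) (κ : Fin n → ℝ) (A : Matrix (Fin k) (Fin n) ℝ) : Prop where
  strictMono : StrictMono κ
  sato : satoPoly κ A = satoPoly κ T.matrix
  wronskian_ne : ∀ t, (wronskian κ T.matrix t).det ≠ 0

/-- The pivot columns of `T.matrix` form the identity, so the corresponding minor of A is det G. The
Wronskian of A is therefore positive, and it is det G times that of `T.matrix`. -/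
theorem Represents.regular {T : LeTableau k n} {κ : Fin n → ℝ} (hκ : StrictMono κ)
    {A : Matrix (Fin k) (Fin n) ℝ} (hA : IsTotallyNonneg A) (hT : T.Represents A) :
    T.Regular κ A := by
  obtain ⟨G, hG, rfl⟩ := hT
  refine ⟨hκ, satoPoly_eq_of_eq_mul hG.ne' rfl, fun t => ?_⟩
  have h1 : 0 < (wronskian κ (G * T.matrix) t).det := by
    refine wronskian_det_pos hκ hA.2 (OrderEmbedding.ofStrictMono _ T.pivot_strictMono) ?_ t
    have h2 : (G * T.matrix).submatrix id T.pivot = G := by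
      ext i s
      simp [Matrix.mul_apply, matrix_pivot]
    change ((G * T.matrix).submatrix id T.pivot).det ≠ 0
    rw [h2]
    exact hG.ne'
  rw [wronskian, Matrix.mul_assoc, Matrix.det_mul] at h1
  exact right_ne_zero_of_mul h1.ne'

theorem Regular.reduced {T : LeTableau k n} {κ : Fin n → ℝ} {A : Matrix (Fin k) (Fin n) ℝ}
    (h : T.Regular κ A) : T.reducedSatoPoly κ A = T.reducedSatoPoly κ T.matrix := by
  funext t
  rw [reducedSatoPoly, reducedSatoPoly, h.sato]

section Dressed

variable (T : LeTableau k n) (κ : Fin n → ℝ) (A : Matrix (Fin k) (Fin n) ℝ)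

/-- The dressed edge wave functions. -/
noncomputable def Psi1 (v : T.White) (t : KPTime) : ℝ := dressedSum κ (satoPoly κ A) (T.vec1 v) t

noncomputable def Psi2 (v : T.White) (t : KPTime) : ℝ := dressedSum κ (satoPoly κ A) (T.vec2 v) t

noncomputable def Psi3 (v : T.White) (t : KPTime) : ℝ := dressedSum κ (satoPoly κ A) (T.vec3 v) t

theorem Phi3_eq_add (v : T.White) (t : KPTime) : T.Phi3 κ v t = T.Phi1 κ v t + T.Phi2 κ v t :=
  expSum_add _ _ _ _

theorem Psi3_eq_add (v : T.White) (t : KPTime) :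
    T.Psi3 κ A v t = T.Psi1 κ A v t + T.Psi2 κ A v t := dressedSum_add _ _ _ _ _

open Classical in
/-- The numerator of the dressed wave function on a component. -/
noncomputable def numer (t : KPTime) : T.Component → Polynomial ℝ
  | .base => T.reducedSatoPoly κ A t
  | .white (.inl r) =>
      if T.RowNonempty r then
        Polynomial.C (T.Psi3 κ A (.inl r) t) * Polynomial.X - Polynomial.C (T.Psi1 κ A (.inl r) t)
      else Polynomial.C (dressedSum κ (T.reducedSatoPoly κ A) (T.vec3 (.inl r)) t)
  | .white (.inr b) =>
      if T.HasLeft (.inr b) then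
        Polynomial.C (T.Psi3 κ A (.inr b) t) * Polynomial.X - Polynomial.C (T.Psi1 κ A (.inr b) t)
      else Polynomial.C (T.Psi3 κ A (.inr b) t)
  | .black b => Polynomial.C (T.Psi3 κ A (.inr b) t)

open Classical in
/-- The denominator of the vacuum wave function on a component. -/
noncomputable def denom (t₀ : KPTime) : T.Component → Polynomial ℝ
  | .base => 1
  | .white v =>
      if T.HasLeft v then
        Polynomial.C (T.Phi3 κ v t₀) * Polynomial.X - Polynomial.C (T.Phi1 κ v t₀)
      else Polynomial.C (T.Phi3 κ v t₀)
  | .black b => Polynomial.C (T.Phi3 κ (.inr b) t₀)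

/-- The exponential factor of the wave functions on a component. -/
noncomputable def expFactor (s : KPTime) : T.Component → ℂ → ℂ
  | .base, ζ => Complex.exp (kpTheta ζ s)
  | _, _ => 1

variable {T κ A}

theorem dress_sum_cexp (S : KPTime → Polynomial ℝ) (F : KPTime → ℂ) (t : KPTime) (c : Fin n → ℂ)
    (hF : ∀ x : ℝ, F (shiftX t x) =
      ∑ j, c j * ((Real.exp (kpThetaReal (κ j) (shiftX t x)) : ℝ) : ℂ)) :
    dress S F t = ∑ j, c j * ((Real.exp (kpThetaReal (κ j) t) * (S t).eval (κ j) : ℝ) : ℂ) := by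
  rw [dress_eq_sum S F t (fun j => c j * ((Real.exp (kpThetaReal (κ j) t) : ℝ) : ℂ))
    (fun j => (κ j : ℂ))]
  · refine Finset.sum_congr rfl fun j _ => ?_
    rw [Complex.ofReal_mul, mul_assoc]
    congr 2
    exact (Polynomial.eval_map_algebraMap _ _).trans (Polynomial.aeval_algebraMap_apply ℂ (κ j) (S t))
  · intro x
    rw [hF]
    refine Finset.sum_congr rfl fun j _ => ?_
    rw [kpThetaReal_shiftX, Real.exp_add]
    push_cast
    ring

/-- For fixed ζ the function is an exponential sum with coefficient vector (vec1 (ζ − 1) + vec2 ζ) /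
d, that is (vec3 ζ − vec1) / d. Dressing acts only on the exponentials. -/
theorem dress_left (S : KPTime → Polynomial ℝ) (v : T.White) (d ζ : ℂ) (t : KPTime) :
    dress S (fun t => ((T.Phi1 κ v t : ℂ) * (ζ - 1) + (T.Phi2 κ v t : ℂ) * ζ) / d) t =
      ((dressedSum κ S (T.vec3 v) t : ℂ) * ζ - (dressedSum κ S (T.vec1 v) t : ℂ)) / d := by
  rw [dress_sum_cexp (κ := κ) S _ t
    (fun j => ((T.vec1 v j : ℂ) * (ζ - 1) + (T.vec2 v j : ℂ) * ζ) / d)]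
  · simp only [dressedSum, Complex.ofReal_sum, Finset.sum_mul, ← Finset.sum_sub_distrib,
      Finset.sum_div]
    refine Finset.sum_congr rfl fun j _ => ?_
    simp only [vec3, Pi.add_apply]
    push_cast
    ring
  · intro x
    simp only [Phi1, Phi2, expSum, Complex.ofReal_sum, Finset.sum_mul, ← Finset.sum_add_distrib,
      Finset.sum_div]
    refine Finset.sum_congr rfl fun j _ => ?_
    push_cast
    ring

theorem dress_const (S : KPTime → Polynomial ℝ) (v : T.White) (d : ℂ) (t : KPTime) :
    dress S (fun t => (T.Phi3 κ v t : ℂ) / d) t = (dressedSum κ S (T.vec3 v) t : ℂ) / d := by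
  rw [dress_sum_cexp (κ := κ) S _ t (fun j => (T.vec3 v j : ℂ) / d)]
  · simp only [dressedSum, Complex.ofReal_sum, Finset.sum_div]
    refine Finset.sum_congr rfl fun j _ => ?_
    push_cast
    ring
  · intro x
    simp only [Phi3, expSum, Complex.ofReal_sum, Finset.sum_div]
    refine Finset.sum_congr rfl fun j _ => ?_
    push_cast
    ring

theorem dress_exp (S : KPTime → Polynomial ℝ) (ζ : ℂ) (s t : KPTime) :
    dress S (fun t => Complex.exp (kpTheta ζ (t - s))) t =
      Complex.exp (kpTheta ζ (t - s)) * ((S t).map (algebraMap ℝ ℂ)).eval ζ := by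
  rw [dress_eq_sum (ι := Unit) S _ t (fun _ => Complex.exp (kpTheta ζ (t - s))) (fun _ => ζ)]
  · simp
  · intro x
    simp only [Finset.univ_unique, Finset.sum_singleton, ← Complex.exp_add]
    rw [kpTheta_sub, kpTheta_sub, kpTheta_shiftX]
    ring_nf

/-- The dressed wave function as a quotient of polynomials, up to the exponential factor on `Γ₀`. -/
theorem dressedWave_eq {t₀ : KPTime} (hΦ : ∀ v, T.Phi3 κ v t₀ ≠ 0) (c : T.Component) (ζ : ℂ)
    (t : KPTime) : T.dressedWave κ A t₀ c ζ t = T.expFactor (t - t₀) c ζ *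
      (((T.numer κ A t c).map (algebraMap ℝ ℂ)).eval ζ /
        ((T.denom κ t₀ c).map (algebraMap ℝ ℂ)).eval ζ) := by
  have hden : ∀ v, ((T.Phi3 κ v t₀ : ℂ) * (ζ - (T.vacPole κ t₀ v : ℂ))) =
      (T.Phi3 κ v t₀ : ℂ) * ζ - (T.Phi1 κ v t₀ : ℂ) := by
    intro v
    have : (T.Phi3 κ v t₀ : ℂ) ≠ 0 := by exact_mod_cast hΦ v
    rw [vacPole]; push_cast; field_simp
  rcases c with _ | (r | b) | b
  · simp only [dressedWave, numer, denom, expFactor]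
    have : T.vacuumWave κ t₀ .base ζ = fun t => Complex.exp (kpTheta ζ (t - t₀)) := by
      funext t; rfl
    rw [this, dress_exp]
    simp
  · by_cases hr : T.RowNonempty r
    · have : T.vacuumWave κ t₀ (.white (.inl r)) ζ = fun t =>
          ((T.Phi1 κ (.inl r) t : ℂ) * (ζ - 1) + (T.Phi2 κ (.inl r) t : ℂ) * ζ) /
          ((T.Phi3 κ (.inl r) t₀ : ℂ) * (ζ - (T.vacPole κ t₀ (.inl r) : ℂ))) := by
        funext t
        rw [vacuumWave, if_pos (show T.HasLeft (.inl r) from hr)]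
      simp only [dressedWave, numer, denom, expFactor, if_pos hr, HasLeft]
      rw [this, dress_left, hden]
      simp [Psi1, Psi3, hr]
    · have : T.vacuumWave κ t₀ (.white (.inl r)) ζ = fun t =>
          (T.Phi3 κ (.inl r) t : ℂ) / (T.Phi3 κ (.inl r) t₀ : ℂ) := by
        funext t
        rw [vacuumWave, if_neg (show ¬ T.HasLeft (.inl r) from hr)]
      simp only [dressedWave, numer, denom, expFactor, if_neg hr, HasLeft]
      rw [this, dress_const]
      simp [hr]
  · by_cases hr : T.HasLeft (.inr b)
    · have : T.vacuumWave κ t₀ (.white (.inr b)) ζ = fun t =>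
          ((T.Phi1 κ (.inr b) t : ℂ) * (ζ - 1) + (T.Phi2 κ (.inr b) t : ℂ) * ζ) /
          ((T.Phi3 κ (.inr b) t₀ : ℂ) * (ζ - (T.vacPole κ t₀ (.inr b) : ℂ))) := by
        funext t
        rw [vacuumWave, if_pos hr]
      simp only [dressedWave, numer, denom, expFactor, if_pos hr]
      rw [this, dress_left, hden]
      simp [Psi1, Psi3]
    · have : T.vacuumWave κ t₀ (.white (.inr b)) ζ = fun t =>
          (T.Phi3 κ (.inr b) t : ℂ) / (T.Phi3 κ (.inr b) t₀ : ℂ) := by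
        funext t
        rw [vacuumWave, if_neg hr]
      simp only [dressedWave, numer, denom, expFactor, if_neg hr]
      rw [this, dress_const]
      simp [Psi3]
  · have : T.vacuumWave κ t₀ (.black b) ζ = fun t =>
          (T.Phi3 κ (.inr b) t : ℂ) / (T.Phi3 κ (.inr b) t₀ : ℂ) := by
        funext t
        rw [vacuumWave]
    simp only [dressedWave, numer, denom, expFactor]
    rw [this, dress_const]
    simp [Psi3]

/-! ### Relations between the dressed edge wave functions -/

/-- The edge vector is a row of the matrix, and 𝔇 kills the corresponding f. Consequently the
numerator on the component of a non-isolated source has no zero, and Ψ1 = −Ψ2 there. -/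
theorem Regular.Psi3_source (h : T.Regular κ A) (r : Fin k) (t : KPTime) :
    T.Psi3 κ A (.inl r) t = 0 := by
  rw [Psi3, ← matrix_row, h.sato]
  exact dressedSum_satoPoly_row (h.wronskian_ne t) r

theorem Regular.Psi1_source (h : T.Regular κ A) (r : Fin k) (t : KPTime) :
    T.Psi1 κ A (.inl r) t = -T.Psi2 κ A (.inl r) t := by
  have h1 := T.Psi3_eq_add κ A (.inl r) t
  rw [h.Psi3_source] at h1
  linarith

theorem Psi1_first {r : Fin k} {b : T.Box} (hb : T.First r b) (t : KPTime) :
    T.Psi1 κ A (.inl r) t = T.weight b.1.1 b.1.2 * T.Psi3 κ A (.inr b) t := by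
  rw [Psi1, vec1_first hb, dressedSum_smul, Psi3, vec3_box]

theorem Psi1_next {b b' : T.Box} (hb : T.Next b b') (t : KPTime) :
    T.Psi1 κ A (.inr b) t = T.weight b'.1.1 b'.1.2 * T.Psi3 κ A (.inr b') t := by
  rw [Psi1, vec1_next hb, dressedSum_smul, Psi3, vec3_box]

theorem Phi1_of_not_hasLeft {v : T.White} (h : ¬ T.HasLeft v) (t : KPTime) :
    T.Phi1 κ v t = 0 := by
  rw [Phi1, vec1_of_not_hasLeft h]; simp [expSum]

theorem Psi1_of_not_hasLeft {v : T.White} (h : ¬ T.HasLeft v) (t : KPTime) :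
    T.Psi1 κ A v t = 0 := by
  rw [Psi1, vec1_of_not_hasLeft h, dressedSum_zero]

theorem Psi2_below {b c : T.Box} (h : T.Below b c) (t : KPTime) :
    T.Psi2 κ A (.inr b) t =
      ((-1 : ℝ) ^ (b.1.1 : ℕ) * (-1) ^ (c.1.1 : ℕ)) * T.Psi3 κ A (.inr c) t := by
  rw [Psi2, vec2_below_eq_smul h, dressedSum_smul, Psi3, vec3_box]

theorem Psi2_bottom {b : T.Box} (h : T.Bottom b) (t : KPTime) :
    T.Psi2 κ A (.inr b) t = T.rowSign b.1.1 b.1.2 *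
      (Real.exp (kpThetaReal (κ b.1.2) t) * (satoPoly κ A t).eval (κ b.1.2)) := by
  rw [Psi2, vec2_bottom h, dressedSum_smul, dressedSum_single]

theorem Phi2_source (r : Fin k) (t : KPTime) :
    T.Phi2 κ (.inl r) t = Real.exp (kpThetaReal (κ (T.pivot r)) t) := by
  rw [Phi2, vec2, expSum_single]

theorem Psi2_source (r : Fin k) (t : KPTime) :
    T.Psi2 κ A (.inl r) t =
      Real.exp (kpThetaReal (κ (T.pivot r)) t) * (satoPoly κ A t).eval (κ (T.pivot r)) := by
  rw [Psi2, vec2, dressedSum_single]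

theorem Phi3_isolated {r : Fin k} (h : ¬ T.RowNonempty r) (t : KPTime) :
    T.Phi3 κ (.inl r) t = Real.exp (kpThetaReal (κ (T.pivot r)) t) := by
  rw [Phi3_eq_add, Phi1_of_not_hasLeft (v := .inl r) h, zero_add, Phi2_source]

theorem dressedSum_vec3_isolated (S : KPTime → Polynomial ℝ) {r : Fin k} (h : ¬ T.RowNonempty r)
    (t : KPTime) : dressedSum κ S (T.vec3 (.inl r)) t =
      Real.exp (kpThetaReal (κ (T.pivot r)) t) * (S t).eval (κ (T.pivot r)) := by
  rw [← matrix_row, matrix_row_isolated _ h, dressedSum_single]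

theorem Regular.sato_eval (h : T.Regular κ A) (t : KPTime) (z : ℝ) : (satoPoly κ A t).eval z =
    (T.isolatedFactor κ).eval z * (T.reducedSatoPoly κ A t).eval z := by
  rw [h.reduced, h.sato, T.satoPoly_eq_mul h.strictMono (h.wronskian_ne t), Polynomial.eval_mul]

theorem Regular.isolatedFactor_box_ne (h : T.Regular κ A) (b : T.Box) :
    (T.isolatedFactor κ).eval (κ b.1.2) ≠ 0 := by
  intro h0
  obtain ⟨r, -, hr⟩ := (T.isolatedFactor_eval_eq_zero_iff κ _).1 h0
  exact T.not_pivot b r (h.strictMono.injective hr).symm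

theorem Regular.isolatedFactor_pivot_ne (h : T.Regular κ A) {r : Fin k} (hr : T.RowNonempty r) :
    (T.isolatedFactor κ).eval (κ (T.pivot r)) ≠ 0 := by
  intro h0
  obtain ⟨s, hs, hrs⟩ := (T.isolatedFactor_eval_eq_zero_iff κ _).1 h0
  rw [T.pivot_strictMono.injective (h.strictMono.injective hrs)] at hr
  exact hs hr

theorem exists_bottom (b : T.Box) : ∃ c : T.Box, c.1.2 = b.1.2 ∧ T.Bottom c := by
  classical
  obtain ⟨m, hm, hmax⟩ := Finset.exists_max_image
    (Finset.univ.filter fun c : T.Box => c.1.2 = b.1.2) (fun c => c.1.1) ⟨b, by simp⟩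
  simp only [Finset.mem_filter, Finset.mem_univ, true_and] at hm hmax
  exact ⟨m, hm, fun c hc => hmax c (hc.trans hm)⟩

end Dressed

end LeTableau

/-! ### Values at the glued points and admissibility -/

namespace LeTableau

variable {k n : ℕ} {T : LeTableau k n} {κ : Fin n → ℝ} {A : Matrix (Fin k) (Fin n) ℝ}

/-- The vacuum edge wave functions do not vanish at `t₀`. -/
def VacuumNonvanishing (T : LeTableau k n) (κ : Fin n → ℝ) (t₀ : KPTime) : Prop :=
  ∀ v : T.White, (T.HasLeft v → T.Phi1 κ v t₀ ≠ 0) ∧ T.Phi2 κ v t₀ ≠ 0 ∧ T.Phi3 κ v t₀ ≠ 0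

/-- The white vertices whose dressed edge wave functions do not vanish identically: those at boxes and
at the sources that are not isolated. -/
def Joined (T : LeTableau k n) : T.White → Prop
  | .inl r => T.RowNonempty r
  | .inr _ => True

theorem Joined.of_hasLeft {v : T.White} (h : T.HasLeft v) : T.Joined v := by
  rcases v with r | b
  · exact h
  · trivial

theorem numer_of_hasLeft {v : T.White} (h : T.HasLeft v) (t : KPTime) :
    T.numer κ A t (.white v) =
      Polynomial.C (T.Psi3 κ A v t) * Polynomial.X - Polynomial.C (T.Psi1 κ A v t) := by
  rcases v with r | b
  · simp only [numer]; exact if_pos h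
  · simp only [numer]; exact if_pos h

theorem denom_of_hasLeft {v : T.White} (h : T.HasLeft v) (t : KPTime) :
    T.denom κ t (.white v) =
      Polynomial.C (T.Phi3 κ v t) * Polynomial.X - Polynomial.C (T.Phi1 κ v t) := by
  simp only [denom]; exact if_pos h

theorem denom_of_not_hasLeft {v : T.White} (h : ¬ T.HasLeft v) (t : KPTime) :
    T.denom κ t (.white v) = Polynomial.C (T.Phi3 κ v t) := by
  simp only [denom]; exact if_neg h

theorem numer_box_of_not_hasLeft {b : T.Box} (h : ¬ T.HasLeft (.inr b)) (t : KPTime) :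
    T.numer κ A t (.white (.inr b)) = Polynomial.C (T.Psi3 κ A (.inr b) t) := by
  simp only [numer]; exact if_neg h

theorem numer_isolated {r : Fin k} (h : ¬ T.RowNonempty r) (t : KPTime) :
    T.numer κ A t (.white (.inl r)) = Polynomial.C (Real.exp (kpThetaReal (κ (T.pivot r)) t) *
      (T.reducedSatoPoly κ A t).eval (κ (T.pivot r))) := by
  simp only [numer]; rw [if_neg h, dressedSum_vec3_isolated _ h]

theorem Regular.numer_source (h : T.Regular κ A) {r : Fin k} (hr : T.RowNonempty r) (t : KPTime) :
    T.numer κ A t (.white (.inl r)) = Polynomial.C (T.Psi2 κ A (.inl r) t) := by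
  rw [numer_of_hasLeft (v := .inl r) hr, h.Psi3_source, h.Psi1_source]; simp

section Nodes

variable {t₀ : KPTime} (hΦ : T.VacuumNonvanishing κ t₀) (t : KPTime)
include hΦ

/-- The coordinates 0, 1, ∞ of the glued points are chosen such that (Ψ3 ζ − Ψ1) / (Φ3 ζ − Φ1) takes
there the values Ψ1/Φ1, Ψ2/Φ2, Ψ3/Φ3 of the three edges. -/
theorem hasValueAt_white_zero {v : T.White} (hv : T.HasLeft v) :
    HasValueAt (fun ζ => T.dressedWave κ A t₀ (.white v) ζ t)
      (((0 : ℝ) : ℂ) : OnePoint ℂ) (T.Psi1 κ A v t / T.Phi1 κ v t₀) := by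
  have h1 : (T.Phi1 κ v t₀ : ℂ) ≠ 0 := by exact_mod_cast (hΦ v).1 hv
  have h := Polynomial.hasValueAt_div_coe ((T.numer κ A t (.white v)).map (algebraMap ℝ ℂ))
    ((T.denom κ t₀ (.white v)).map (algebraMap ℝ ℂ)) (z := ((0 : ℝ) : ℂ))
    (by rw [denom_of_hasLeft hv]; simpa using h1)
  rw [numer_of_hasLeft hv, denom_of_hasLeft hv] at h
  simp_rw [dressedWave_eq (fun v => (hΦ v).2.2), expFactor, one_mul, numer_of_hasLeft hv,
    denom_of_hasLeft hv]
  convert h using 1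
  simp

/-- Without an edge to the left Ψ1 = Φ1 = 0, and the constant Ψ3/Φ3 is again Ψ2/Φ2. Isolated sources
are excluded, since they are dressed with the reduced operator. -/
theorem hasValueAt_white_one {v : T.White} (hv : T.Joined v) :
    HasValueAt (fun ζ => T.dressedWave κ A t₀ (.white v) ζ t)
      (((1 : ℝ) : ℂ) : OnePoint ℂ) (T.Psi2 κ A v t / T.Phi2 κ v t₀) := by
  by_cases hl : T.HasLeft v
  · have h1 : (T.Phi3 κ v t₀ : ℂ) - T.Phi1 κ v t₀ ≠ 0 := by
      rw [Phi3_eq_add]; push_cast; rw [add_sub_cancel_left]; exact_mod_cast (hΦ v).2.1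
    have h := Polynomial.hasValueAt_div_coe ((T.numer κ A t (.white v)).map (algebraMap ℝ ℂ))
      ((T.denom κ t₀ (.white v)).map (algebraMap ℝ ℂ)) (z := ((1 : ℝ) : ℂ))
      (by rw [denom_of_hasLeft hl]; simpa using h1)
    rw [numer_of_hasLeft hl, denom_of_hasLeft hl] at h
    simp_rw [dressedWave_eq (fun v => (hΦ v).2.2), expFactor, one_mul, numer_of_hasLeft hl,
      denom_of_hasLeft hl]
    convert h using 1
    simp [Phi3_eq_add, Psi3_eq_add]
  · rcases v with r | b
    · exact absurd hv hl
    simp_rw [dressedWave_eq (fun v => (hΦ v).2.2), expFactor, one_mul, numer_box_of_not_hasLeft hl,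
      denom_of_not_hasLeft hl, Phi3_eq_add, Psi3_eq_add, Phi1_of_not_hasLeft hl,
      Psi1_of_not_hasLeft hl]
    simpa using hasValueAt_const _ _

theorem hasValueAt_isolated {r : Fin k} (hr : ¬ T.RowNonempty r) (p : OnePoint ℂ) :
    HasValueAt (fun ζ => T.dressedWave κ A t₀ (.white (.inl r)) ζ t) p
      (((Real.exp (kpThetaReal (κ (T.pivot r)) t) *
      (T.reducedSatoPoly κ A t).eval (κ (T.pivot r)) : ℝ) : ℂ) /
        ((Real.exp (kpThetaReal (κ (T.pivot r)) t₀) : ℝ) : ℂ)) := by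
  have hl : ¬ T.HasLeft (.inl r) := hr
  simp_rw [dressedWave_eq (fun v => (hΦ v).2.2), expFactor, one_mul, numer_isolated hr,
    denom_of_not_hasLeft hl, Phi3_isolated hr]
  simpa using hasValueAt_const _ _

theorem hasValueAt_box_infty (b : T.Box) :
    HasValueAt (fun ζ => T.dressedWave κ A t₀ (.white (.inr b)) ζ t)
      ∞ (T.Psi3 κ A (.inr b) t / T.Phi3 κ (.inr b) t₀) := by
  have h1 : (T.Phi3 κ (.inr b) t₀ : ℂ) ≠ 0 := by exact_mod_cast (hΦ (.inr b)).2.2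
  by_cases hl : T.HasLeft (.inr b)
  · have h := Polynomial.hasValueAt_div_infty (N := 1)
      (p := (T.numer κ A t (.white (.inr b))).map (algebraMap ℝ ℂ))
      (q := (T.denom κ t₀ (.white (.inr b))).map (algebraMap ℝ ℂ))
      (by rw [numer_of_hasLeft hl]
          exact Polynomial.natDegree_map_le.trans (by compute_degree))
      (by rw [denom_of_hasLeft hl]
          exact Polynomial.natDegree_map_le.trans (by compute_degree))
      (by rw [denom_of_hasLeft hl]; simpa [Polynomial.coeff_C] using h1)
    rw [numer_of_hasLeft hl, denom_of_hasLeft hl] at h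
    simp_rw [dressedWave_eq (fun v => (hΦ v).2.2), expFactor, one_mul, numer_of_hasLeft hl,
      denom_of_hasLeft hl]
    convert h using 1
    simp [Polynomial.coeff_C]
  · simp_rw [dressedWave_eq (fun v => (hΦ v).2.2), expFactor, one_mul, numer_box_of_not_hasLeft hl,
      denom_of_not_hasLeft hl]
    simpa using hasValueAt_const _ _

theorem hasValueAt_black (b : T.Box) (p : OnePoint ℂ) :
    HasValueAt (fun ζ => T.dressedWave κ A t₀ (.black b) ζ t)
      p (T.Psi3 κ A (.inr b) t / T.Phi3 κ (.inr b) t₀) := by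
  simp_rw [dressedWave_eq (fun v => (hΦ v).2.2), expFactor, one_mul, numer, denom]
  simpa using hasValueAt_const _ _

theorem hasValueAt_base (z : ℝ) :
    HasValueAt (fun ζ => T.dressedWave κ A t₀ .base ζ t) ((z : ℂ) : OnePoint ℂ)
      (((Real.exp (kpThetaReal z t) * (T.reducedSatoPoly κ A t).eval z : ℝ) : ℂ) /
        ((Real.exp (kpThetaReal z t₀) : ℝ) : ℂ)) := by
  simp_rw [dressedWave_eq (fun v => (hΦ v).2.2), expFactor, numer, denom]
  have h := hasValueAt_of_continuousAt (z := (z : ℂ)) (f := fun ζ => Complex.exp (kpTheta ζ (t - t₀)) *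
    (((T.reducedSatoPoly κ A t).map (algebraMap ℝ ℂ)).eval ζ /
      ((1 : Polynomial ℝ).map (algebraMap ℝ ℂ)).eval ζ)) (by
    simp only [Polynomial.map_one, Polynomial.eval_one, div_one]
    exact ((differentiable_kpTheta _).continuous.cexp.mul (Polynomial.continuous _)).continuousAt)
  convert h using 1
  rw [kpTheta_sub, Complex.exp_sub, ← kpThetaReal_cast, ← kpThetaReal_cast]
  have h2 : (((T.reducedSatoPoly κ A t).eval z : ℝ) : ℂ) =
      ((T.reducedSatoPoly κ A t).map (algebraMap ℝ ℂ)).eval (z : ℂ) :=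
    ((Polynomial.eval_map_algebraMap _ _).trans (Polynomial.aeval_algebraMap_apply ℂ z _)).symm
  rw [Complex.ofReal_mul, h2]
  simp
  ring

end Nodes

/-- The dressed edge wave functions do not vanish at `t₀` on the edges of the network. -/
structure DressedNonvanishing (T : LeTableau k n) (κ : Fin n → ℝ) (A : Matrix (Fin k) (Fin n) ℝ)
    (t₀ : KPTime) : Prop where
  psi1 : ∀ v, T.HasLeft v → T.Psi1 κ A v t₀ ≠ 0
  psi2 : ∀ v, T.Joined v → T.Psi2 κ A v t₀ ≠ 0
  psi3 : ∀ b : T.Box, T.Psi3 κ A (.inr b) t₀ ≠ 0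
  pivot : ∀ r, (T.reducedSatoPoly κ A t₀).eval (κ (T.pivot r)) ≠ 0
  column : ∀ b : T.Box, (T.reducedSatoPoly κ A t₀).eval (κ b.1.2) ≠ 0

theorem Admissible.vacuumNonvanishing {t₀ : KPTime} (h : T.Admissible κ A t₀) :
    T.VacuumNonvanishing κ t₀ := h.1

theorem isNode_white_one (v : T.White) : T.IsNode κ (.white v, ((1 : ℝ) : WithTop ℝ)) := by
  rcases v with r | b
  · exact ⟨_, .inl (.source r)⟩
  · rcases T.bottom_or_below b with h | ⟨c, h⟩
    · exact ⟨_, .inl (.sink b h)⟩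
    · exact ⟨_, .inl (.down b c h)⟩

theorem isNode_white_zero {v : T.White} (hv : T.HasLeft v) :
    T.IsNode κ (.white v, ((0 : ℝ) : WithTop ℝ)) := by
  rcases v with r | b
  · obtain ⟨b, hb⟩ := T.exists_first hv
    exact ⟨_, .inl (.first r b hb)⟩
  · obtain ⟨b', hb⟩ := hv
    exact ⟨_, .inl (.next b b' hb)⟩

theorem isNode_base_pivot (r : Fin k) : T.IsNode κ (.base, ((κ (T.pivot r) : ℝ) : WithTop ℝ)) :=
  ⟨_, .inr (.source r)⟩

theorem isNode_base_column (b : T.Box) : T.IsNode κ (.base, ((κ b.1.2 : ℝ) : WithTop ℝ)) := by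
  obtain ⟨c, hc, hb⟩ := exists_bottom b
  rw [← hc]
  exact ⟨_, .inr (.sink c hb)⟩

theorem ne_zero_of_hasValueAt {f : ℂ → ℂ} {p : OnePoint ℂ} {x y : ℝ}
    (h : HasValueAt f p ((x : ℂ) / y)) (h' : ∃ a : ℂ, a ≠ 0 ∧ HasValueAt f p a) : x ≠ 0 := by
  obtain ⟨a, ha, ha'⟩ := h'
  rintro rfl
  rw [Complex.ofReal_zero, zero_div] at h
  exact ha (ha'.unique h)

theorem toPoint_coe (c : T.Component) (x : ℝ) :
    RealPoint.toPoint ((c, (x : WithTop ℝ)) : T.RealPoint) = (c, ((x : ℂ) : OnePoint ℂ)) := rfl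

theorem toPoint_top (c : T.Component) : RealPoint.toPoint ((c, ⊤) : T.RealPoint) = (c, ∞) := rfl

theorem Admissible.at_node {t₀ : KPTime} (h : T.Admissible κ A t₀) {c : T.Component} {x : ℝ}
    (hx : T.IsNode κ (c, (x : WithTop ℝ))) : ∃ a : ℂ, a ≠ 0 ∧
      HasValueAt (fun ζ => T.dressedWave κ A t₀ c ζ t₀) ((x : ℂ) : OnePoint ℂ) a := by
  have := h.2 _ hx
  rwa [toPoint_coe] at this

theorem Admissible.dressedNonvanishing {t₀ : KPTime} (h : T.Admissible κ A t₀) :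
    T.DressedNonvanishing κ A t₀ := by
  have hΦ := h.vacuumNonvanishing
  refine ⟨fun v hv => ?_, fun v hv => ?_, fun b => ?_, fun r => ?_, fun b => ?_⟩
  · exact ne_zero_of_hasValueAt (hasValueAt_white_zero hΦ t₀ hv)
      (h.at_node (isNode_white_zero hv))
  · exact ne_zero_of_hasValueAt (hasValueAt_white_one hΦ t₀ hv) (h.at_node (isNode_white_one v))
  · exact ne_zero_of_hasValueAt (hasValueAt_box_infty hΦ t₀ b) (h.2 (.white (.inr b), ⊤)
      ⟨_, .inl (.box b)⟩)
  · exact right_ne_zero_of_mul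
      (ne_zero_of_hasValueAt (hasValueAt_base hΦ t₀ _) (h.at_node (isNode_base_pivot r)))
  · exact right_ne_zero_of_mul
      (ne_zero_of_hasValueAt (hasValueAt_base hΦ t₀ _) (h.at_node (isNode_base_column b)))

theorem exists_hasValueAt_of_ne_zero {f : ℂ → ℂ} {p : OnePoint ℂ} {x y : ℝ}
    (h : HasValueAt f p ((x : ℂ) / y)) (hx : x ≠ 0) (hy : y ≠ 0) :
    ∃ a : ℂ, a ≠ 0 ∧ HasValueAt f p a :=
  ⟨_, div_ne_zero (by exact_mod_cast hx) (by exact_mod_cast hy), h⟩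

theorem admissible_of_nonvanishing {t₀ : KPTime} (hΦ : T.VacuumNonvanishing κ t₀)
    (hΨ : T.DressedNonvanishing κ A t₀) : T.Admissible κ A t₀ := by
  refine ⟨hΦ, ?_⟩
  have hbase : ∀ z : ℝ, (T.reducedSatoPoly κ A t₀).eval z ≠ 0 → ∃ a : ℂ, a ≠ 0 ∧
      HasValueAt (fun ζ => T.dressedWave κ A t₀ .base ζ t₀) ((z : ℂ) : OnePoint ℂ) a := fun z hz =>
    exists_hasValueAt_of_ne_zero (hasValueAt_base hΦ t₀ z)
      (mul_ne_zero (Real.exp_pos _).ne' hz) (Real.exp_pos _).ne'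
  have hblack : ∀ (b : T.Box) (p : OnePoint ℂ), ∃ a : ℂ, a ≠ 0 ∧
      HasValueAt (fun ζ => T.dressedWave κ A t₀ (.black b) ζ t₀) p a := fun b p =>
    exists_hasValueAt_of_ne_zero (hasValueAt_black hΦ t₀ b p) (hΨ.psi3 b) (hΦ _).2.2
  have hzero : ∀ v, T.HasLeft v → ∃ a : ℂ, a ≠ 0 ∧
      HasValueAt (fun ζ => T.dressedWave κ A t₀ (.white v) ζ t₀)
        (((0 : ℝ) : ℂ) : OnePoint ℂ) a := fun v hv =>
    exists_hasValueAt_of_ne_zero (hasValueAt_white_zero hΦ t₀ hv) (hΨ.psi1 v hv) ((hΦ v).1 hv)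
  have hone : ∀ v, ∃ a : ℂ, a ≠ 0 ∧
      HasValueAt (fun ζ => T.dressedWave κ A t₀ (.white v) ζ t₀)
        (((1 : ℝ) : ℂ) : OnePoint ℂ) a := by
    intro v
    by_cases hv : T.Joined v
    · exact exists_hasValueAt_of_ne_zero (hasValueAt_white_one hΦ t₀ hv) (hΨ.psi2 v hv) (hΦ v).2.1
    · rcases v with r | b
      · exact exists_hasValueAt_of_ne_zero (hasValueAt_isolated hΦ t₀ hv _)
          (mul_ne_zero (Real.exp_pos _).ne' (hΨ.pivot r)) (Real.exp_pos _).ne'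
      · exact absurd trivial hv
  rintro x ⟨y, h | h⟩
  · cases h with
    | source r => exact hone _
    | first r b h => exact hzero _ h.rowNonempty
    | next b b' h => exact hzero _ ⟨b', h⟩
    | box b =>
      exact exists_hasValueAt_of_ne_zero (hasValueAt_box_infty hΦ t₀ b) (hΨ.psi3 b) (hΦ _).2.2
    | down b b' h => exact hone _
    | sink b h => exact hone _
  · cases h with
    | source r => exact hbase _ (hΨ.pivot r)
    | first r b h => exact hblack _ _
    | next b b' h => exact hblack _ _
    | box b => exact hblack _ _
    | down b b' h => exact hblack _ _
    | sink b h => exact hbase _ (hΨ.column b)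

end LeTableau

/-! ### Degree and effectivity of the divisor -/

theorem Polynomial.linear_eq_mul {F : Type*} [Field F] {a : F} (ha : a ≠ 0) (b : F) :
    (C a * X - C b : Polynomial F) = C a * (X - C (b / a)) := by
  rw [mul_sub, ← C_mul, mul_div_cancel₀ _ ha]

theorem Polynomial.natDegree_linear_sub {F : Type*} [Field F] {a : F} (ha : a ≠ 0) (b : F) :
    (C a * X - C b : Polynomial F).natDegree = 1 := by
  rw [linear_eq_mul ha, natDegree_C_mul ha, natDegree_X_sub_C]

theorem Polynomial.linear_ne_zero {F : Type*} [Field F] {a : F} (ha : a ≠ 0) (b : F) :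
    (C a * X - C b : Polynomial F) ≠ 0 := fun h => by
  have := natDegree_linear_sub ha b
  rw [h] at this; simp at this

theorem Polynomial.roots_linear_sub {F : Type*} [Field F] {a : F} (ha : a ≠ 0) (b : F) :
    (C a * X - C b : Polynomial F).roots = {b / a} := by
  rw [linear_eq_mul ha, roots_C_mul _ ha, roots_X_sub_C]

namespace LeTableau

variable {k n : ℕ} {T : LeTableau k n} {κ : Fin n → ℝ} {A : Matrix (Fin k) (Fin n) ℝ}

/-- The components are indexed by `Γ₀`, the white and the black vertices. -/
def componentEquiv (T : LeTableau k n) : T.Component ≃ Unit ⊕ T.White ⊕ T.Box where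
  toFun
    | .base => .inl ()
    | .white v => .inr (.inl v)
    | .black b => .inr (.inr b)
  invFun
    | .inl _ => .base
    | .inr (.inl v) => .white v
    | .inr (.inr b) => .black b
  left_inv c := by cases c <;> rfl
  right_inv c := by rcases c with _ | _ | _ <;> rfl

noncomputable instance (T : LeTableau k n) : Fintype T.Component :=
  Fintype.ofEquiv _ T.componentEquiv.symm

theorem sum_component {M : Type*} [AddCommMonoid M] (f : T.Component → M) :
    ∑ c, f c = f .base + ((∑ r, f (.white (.inl r)) + ∑ b, f (.white (.inr b))) +
      ∑ b, f (.black b)) := by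
  rw [← Equiv.sum_comp T.componentEquiv.symm, Fintype.sum_sum_type, Fintype.sum_sum_type,
    Fintype.sum_sum_type]
  simp [componentEquiv]

open Classical in
theorem sum_next {M : Type*} [AddCommMonoid M] (f : T.Box → M) {c c' : T.Box} (h : T.Next c c') :
    (∑ b, if T.Next c b then f b else 0) = f c' := by
  rw [Finset.sum_eq_single c']
  · simp [h]
  · intro b _ hb; rw [if_neg fun h' => hb (next_unique h' h)]
  · simp

open Classical in
theorem sum_next_of_not_hasLeft {M : Type*} [AddCommMonoid M] (f : T.Box → M) {c : T.Box}
    (h : ¬ T.HasLeft (.inr c)) : (∑ b, if T.Next c b then f b else 0) = 0 :=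
  Finset.sum_eq_zero fun b _ => if_neg fun h' => h ⟨b, h'⟩

open Classical in
theorem sum_first {M : Type*} [AddCommMonoid M] (f : T.Box → M) {r : Fin k} {b : T.Box}
    (h : T.First r b) : (∑ b, if T.First r b then f b else 0) = f b := by
  rw [Finset.sum_eq_single b]
  · simp [h]
  · intro c _ hc; rw [if_neg fun h' => hc (first_unique h' h)]
  · simp

open Classical in
theorem sum_first_of_isolated {M : Type*} [AddCommMonoid M] (f : T.Box → M) {r : Fin k}
    (h : ¬ T.RowNonempty r) : (∑ b, if T.First r b then f b else 0) = 0 :=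
  Finset.sum_eq_zero fun _ _ => if_neg fun h' => h h'.rowNonempty

open Classical in
/-- Every box is entered from the right from exactly one box or source. -/
theorem sum_box_eq {M : Type*} [AddCommMonoid M] (f : T.Box → M) :
    ∑ b, f b = (∑ c, ∑ b, if T.Next c b then f b else 0) +
      ∑ r, ∑ b, if T.First r b then f b else 0 := by
  rw [Finset.sum_comm (s := (Finset.univ : Finset T.Box)), Finset.sum_comm (s := (Finset.univ : Finset (Fin k))),
    ← Finset.sum_add_distrib]
  refine Finset.sum_congr rfl fun b _ => ?_
  rcases T.first_or_next b with h | ⟨c, h⟩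
  · rw [Finset.sum_eq_zero, Finset.sum_eq_single b.1.1, if_pos h, zero_add]
    · intro r _ hr
      rw [if_neg fun h' => hr h'.1.symm]
    · simp
    · intro c _
      rw [if_neg fun h' => not_first_of_next h' _ h]
  · rw [Finset.sum_eq_single c, if_pos h, Finset.sum_eq_zero, add_zero]
    · intro r _
      rw [if_neg (not_first_of_next h r)]
    · intro c' _ hc
      rw [if_neg fun h' => hc (next_unique_left h' h)]
    · simp

open Classical in
-- Counting boxes by the edge that enters them from the right: the first boxes correspond to the
-- non-isolated rows, the others to the boxes that have a left neighbour.
theorem dim_eq : T.dim = T.reducedOrder + ∑ b, if T.HasLeft (.inr b) then 1 else 0 := by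
  have hdim : T.dim = ∑ _b : T.Box, 1 := by simp [dim]
  rw [hdim, sum_box_eq (T := T), reducedOrder, Nat.card_eq_fintype_card, Fintype.card_subtype,
    Finset.card_filter, add_comm]
  congr 1
  · refine Finset.sum_congr rfl fun r _ => ?_
    by_cases hr : T.RowNonempty r
    · obtain ⟨b, hb⟩ := T.exists_first hr
      rw [sum_first _ hb, if_pos hr]
    · rw [sum_first_of_isolated _ hr, if_neg hr]
  · refine Finset.sum_congr rfl fun c _ => ?_
    by_cases hc : T.HasLeft (.inr c)
    · rw [if_pos hc]; obtain ⟨b, hb⟩ := hc; rw [sum_next _ hb]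
    · rw [sum_next_of_not_hasLeft _ hc, if_neg hc]

section Divisor

variable {t₀ : KPTime} (h : T.Regular κ A) (hΦ : T.VacuumNonvanishing κ t₀)
  (hΨ : T.DressedNonvanishing κ A t₀)

include h in
theorem Regular.numer_base_monic (t : KPTime) : (T.numer κ A t .base).Monic := by
  simp only [numer]
  rw [h.reduced]; exact T.reducedSatoPoly_monic h.strictMono (h.wronskian_ne t)

include h in
theorem Regular.numer_base_natDegree (t : KPTime) :
    (T.numer κ A t .base).natDegree = T.reducedOrder := by
  simp only [numer]
  rw [h.reduced]; exact T.reducedSatoPoly_natDegree κ t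

include h hΨ

theorem numer_ne_zero (c : T.Component) : T.numer κ A t₀ c ≠ 0 := by
  rcases c with _ | (r | b) | b
  · exact (h.numer_base_monic t₀).ne_zero
  · by_cases hr : T.RowNonempty r
    · rw [h.numer_source hr, Polynomial.C_ne_zero]; exact hΨ.psi2 _ hr
    · rw [numer_isolated hr, Polynomial.C_ne_zero]
      exact mul_ne_zero (Real.exp_pos _).ne' (hΨ.pivot r)
  · by_cases hl : T.HasLeft (.inr b)
    · rw [numer_of_hasLeft hl]; exact Polynomial.linear_ne_zero (hΨ.psi3 b) _
    · rw [numer_box_of_not_hasLeft hl, Polynomial.C_ne_zero]; exact hΨ.psi3 b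
  · simp only [numer]; rw [Polynomial.C_ne_zero]; exact hΨ.psi3 b

/-- At t₀ the degrees are as large as possible, because Ψ3 does not vanish at the boxes and S' is
monic. This excludes poles of the normalized wave function at infinity away from P₀. -/
theorem natDegree_numer_le (t : KPTime) (c : T.Component) :
    (T.numer κ A t c).natDegree ≤ (T.numer κ A t₀ c).natDegree := by
  rcases c with _ | (r | b) | b
  · rw [h.numer_base_natDegree, h.numer_base_natDegree]
  · by_cases hr : T.RowNonempty r
    · rw [h.numer_source hr, Polynomial.natDegree_C]; exact Nat.zero_le _
    · rw [numer_isolated hr, Polynomial.natDegree_C]; exact Nat.zero_le _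
  · by_cases hl : T.HasLeft (.inr b)
    · rw [numer_of_hasLeft hl, numer_of_hasLeft hl, Polynomial.natDegree_linear_sub (hΨ.psi3 b)]
      compute_degree
    · rw [numer_box_of_not_hasLeft hl, Polynomial.natDegree_C]; exact Nat.zero_le _
  · simp only [numer]; rw [Polynomial.natDegree_C]; exact Nat.zero_le _

open Classical in
theorem sum_natDegree_numer : ∑ c, (T.numer κ A t₀ c).natDegree = T.dim := by
  rw [sum_component, dim_eq, h.numer_base_natDegree,
    Finset.sum_eq_zero (f := fun r => (T.numer κ A t₀ (.white (.inl r))).natDegree),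
    Finset.sum_eq_zero (f := fun b => (T.numer κ A t₀ (.black b)).natDegree), zero_add, add_zero]
  · congr 1
    refine Finset.sum_congr rfl fun b _ => ?_
    by_cases hl : T.HasLeft (.inr b)
    · rw [numer_of_hasLeft hl, Polynomial.natDegree_linear_sub (hΨ.psi3 b), if_pos hl]
    · rw [numer_box_of_not_hasLeft hl, Polynomial.natDegree_C, if_neg hl]
  · intro b _; simp [numer]
  · intro r _
    by_cases hr : T.RowNonempty r
    · rw [h.numer_source hr, Polynomial.natDegree_C]
    · rw [numer_isolated hr, Polynomial.natDegree_C]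

omit h hΨ in
theorem map_ne_zero_of_ne_zero {p : Polynomial ℝ} (hp : p ≠ 0) : p.map (algebraMap ℝ ℂ) ≠ 0 :=
  (Polynomial.map_ne_zero_iff (algebraMap ℝ ℂ).injective).2 hp

omit h hΨ in
include hΦ in
theorem denom_ne_zero (c : T.Component) : T.denom κ t₀ c ≠ 0 := by
  rcases c with _ | v | b
  · simp [denom]
  · by_cases hl : T.HasLeft v
    · rw [denom_of_hasLeft hl]; exact Polynomial.linear_ne_zero (hΦ v).2.2 _
    · rw [denom_of_not_hasLeft hl, Polynomial.C_ne_zero]; exact (hΦ v).2.2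
  · simp only [denom]; rw [Polynomial.C_ne_zero]; exact (hΦ _).2.2

omit h hΨ in
theorem expFactor_zero (c : T.Component) (ζ : ℂ) : T.expFactor 0 c ζ = 1 := by
  rcases c with _ | _ | _ <;> simp [expFactor, kpTheta_zero]

omit h hΨ in
include hΦ in
theorem dressedWave_self (c : T.Component) : (fun ζ => T.dressedWave κ A t₀ c ζ t₀) = fun ζ =>
    ((T.numer κ A t₀ c).map (algebraMap ℝ ℂ)).eval ζ /
      ((T.denom κ t₀ c).map (algebraMap ℝ ℂ)).eval ζ := by
  funext ζ
  rw [dressedWave_eq (fun v => (hΦ v).2.2), sub_self, expFactor_zero, one_mul]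

include hΦ

omit h hΨ in
theorem meromorphicAtPoint_dressedWave (P : T.Point) :
    MeromorphicAtPoint (fun ζ => T.dressedWave κ A t₀ P.1 ζ t₀) P.2 := by
  rw [dressedWave_self hΦ]
  exact (Polynomial.meromorphicAtPoint _ _).div (Polynomial.meromorphicAtPoint _ _)

theorem orderAtPoint_dressedWave (P : T.Point) :
    orderAtPoint (fun ζ => T.dressedWave κ A t₀ P.1 ζ t₀) P.2 =
      ((((T.numer κ A t₀ P.1).map (algebraMap ℝ ℂ)).orderAt P.2 -
        ((T.denom κ t₀ P.1).map (algebraMap ℝ ℂ)).orderAt P.2 : ℤ) : WithTop ℤ) := by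
  rw [dressedWave_self hΦ, Polynomial.orderAtPoint_div_eq
    (map_ne_zero_of_ne_zero (numer_ne_zero h hΨ _)) (map_ne_zero_of_ne_zero (denom_ne_zero hΦ _))]

omit h hΨ in
theorem orderAt_denom_coe (c : T.Component) (z : ℂ) :
    ((T.denom κ t₀ c).map (algebraMap ℝ ℂ)).orderAt (z : OnePoint ℂ) =
      T.vacuumDivisor κ t₀ (c, (z : OnePoint ℂ)) := by
  classical
  rw [Polynomial.orderAt_coe]
  rcases c with _ | v | b
  · simp only [denom, vacuumDivisor, Polynomial.map_one]
    rw [Polynomial.rootMultiplicity_eq_zero (by simp), Nat.cast_zero]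
  · by_cases hl : T.HasLeft v
    · have h1 : (T.Phi3 κ v t₀ : ℂ) ≠ 0 := by exact_mod_cast (hΦ v).2.2
      rw [denom_of_hasLeft hl, ← Polynomial.count_roots]
      simp only [vacuumDivisor, vacPole]
      rw [Polynomial.map_sub, Polynomial.map_mul, Polynomial.map_X, Polynomial.map_C,
        Polynomial.map_C, Polynomial.roots_linear_sub (a := algebraMap ℝ ℂ (T.Phi3 κ v t₀)) h1,
        Multiset.count_singleton]
      simp [hl]
    · rw [denom_of_not_hasLeft hl]
      simp [vacuumDivisor, hl, Polynomial.rootMultiplicity_C]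
  · simp [denom, vacuumDivisor, Polynomial.rootMultiplicity_C]

/-- The vacuum divisor is the divisor of zeros of the denominators and cancels their contribution to
the order of ψ. -/
theorem kpDivisor_coe (c : T.Component) (z : ℂ) :
    T.kpDivisor κ A t₀ (c, (z : OnePoint ℂ)) =
      ((T.numer κ A t₀ c).map (algebraMap ℝ ℂ)).rootMultiplicity z := by
  rw [kpDivisor, orderAtPoint_dressedWave h hΦ hΨ]
  have h1 : T.dressedDivisor κ t₀ (c, (z : OnePoint ℂ)) = T.vacuumDivisor κ t₀ (c, (z : OnePoint ℂ)) := by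
    simp [dressedDivisor, Prod.ext_iff]
  rw [h1, WithTop.untop₀_coe, orderAt_denom_coe hΦ, Polynomial.orderAt_coe]
  ring

/-- On Γ₀ the pole of order k' is compensated by k' P₀. At a Darboux point the numerator is constant
and the denominator linear, so ψ has a simple zero, compensated by −P_r. Elsewhere numerator and
denominator have the same degree. -/
theorem kpDivisor_infty (c : T.Component) : T.kpDivisor κ A t₀ (c, ∞) = 0 := by
  have hdeg : ∀ p : Polynomial ℝ, (p.map (algebraMap ℝ ℂ)).natDegree = p.natDegree := fun p =>
    Polynomial.natDegree_map _
  have hvac : T.vacuumDivisor κ t₀ (c, ∞) = 0 := by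
    rcases c with _ | v | b <;> simp [vacuumDivisor]
  rw [kpDivisor, orderAtPoint_dressedWave h hΦ hΨ, WithTop.untop₀_coe, Polynomial.orderAt_infty,
    Polynomial.orderAt_infty, hdeg, hdeg, dressedDivisor, hvac]
  rcases c with _ | (r | b) | b
  · rw [h.numer_base_natDegree]
    simp [denom]
  · by_cases hr : T.RowNonempty r
    · rw [h.numer_source hr, denom_of_hasLeft (v := .inl r) hr,
        Polynomial.natDegree_linear_sub (hΦ _).2.2]
      simp [hr]
    · rw [numer_isolated hr, denom_of_not_hasLeft (v := .inl r) hr]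
      have : ∀ s, T.RowNonempty s → r ≠ s := by rintro s hs rfl; exact hr hs
      simp only [Prod.mk.injEq, reduceCtorEq, Polynomial.natDegree_C]
      rw [if_neg (by simp), if_neg]
      · simp
      · rintro ⟨s, hs, h'⟩
        exact this s hs (by simpa using h')
  · by_cases hl : T.HasLeft (.inr b)
    · rw [numer_of_hasLeft hl, denom_of_hasLeft hl, Polynomial.natDegree_linear_sub (hΦ _).2.2,
        Polynomial.natDegree_linear_sub (hΨ.psi3 b)]
      simp
    · rw [numer_box_of_not_hasLeft hl, denom_of_not_hasLeft hl]
      simp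
  · simp [numer, denom]

/-- The divisor as a multiset of points. -/
noncomputable def divisorPoints (T : LeTableau k n) (κ : Fin n → ℝ) (A : Matrix (Fin k) (Fin n) ℝ)
    (t₀ : KPTime) : Multiset T.Point :=
  ∑ c, ((T.numer κ A t₀ c).map (algebraMap ℝ ℂ)).roots.map fun z : ℂ => (c, (z : OnePoint ℂ))

open Classical in
theorem kpDivisor_eq_count (P : T.Point) :
    T.kpDivisor κ A t₀ P = (T.divisorPoints κ A t₀).count P := by
  obtain ⟨c, p⟩ := P
  rw [divisorPoints, Multiset.count_sum', Finset.sum_eq_single c]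
  · induction p using OnePoint.rec with
    | infty =>
      rw [kpDivisor_infty h hΦ hΨ, Multiset.count_eq_zero_of_notMem]
      · rfl
      · simp
    | coe z =>
      rw [kpDivisor_coe h hΦ hΨ, Multiset.count_map_eq_count'
        (fun z : ℂ => ((c, (z : OnePoint ℂ)) : T.Point)) _ (fun z w hzw => by simpa using hzw),
        Polynomial.count_roots]
  · intro c' _ hc
    refine Multiset.count_eq_zero_of_notMem ?_
    simp only [Multiset.mem_map, not_exists, not_and, Prod.mk.injEq]
    exact fun z _ h' _ => hc h'
  · simp

omit hΦ in
theorem card_divisorPoints : (T.divisorPoints κ A t₀).card = T.dim := by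
  rw [divisorPoints, Multiset.card_sum, ← sum_natDegree_numer h hΨ]
  refine Finset.sum_congr rfl fun c _ => ?_
  rw [Multiset.card_map, ← Polynomial.natDegree_map (algebraMap ℝ ℂ)]
  exact (Polynomial.splits_iff_card_roots.1 (IsAlgClosed.splits _))

omit h hΦ in
theorem numer_eval_node_ne_zero {c : T.Component} {x : ℝ} (hx : T.IsNode κ (c, (x : WithTop ℝ))) :
    (T.numer κ A t₀ c).eval x ≠ 0 := by
  have hwhite0 : ∀ v, T.HasLeft v → (T.numer κ A t₀ (.white v)).eval 0 ≠ 0 := by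
    intro v hv
    rw [numer_of_hasLeft hv]
    simpa using hΨ.psi1 v hv
  have hwhite1 : ∀ v, (T.numer κ A t₀ (.white v)).eval 1 ≠ 0 := by
    intro v
    by_cases hv : T.HasLeft v
    · rw [numer_of_hasLeft hv]
      simpa [Psi3_eq_add] using hΨ.psi2 v (Joined.of_hasLeft hv)
    · rcases v with r | b
      · rw [numer_isolated hv, Polynomial.eval_C]
        exact mul_ne_zero (Real.exp_pos _).ne' (hΨ.pivot r)
      · rw [numer_box_of_not_hasLeft hv, Polynomial.eval_C]; exact hΨ.psi3 b
  have hblack : ∀ b y, (T.numer κ A t₀ (.black b)).eval y ≠ 0 := by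
    intro b y
    simp only [numer]; rw [Polynomial.eval_C]; exact hΨ.psi3 b
  obtain ⟨y, hy | hy⟩ := hx
  · generalize hX : ((c, (x : WithTop ℝ)) : T.RealPoint) = X at hy
    cases hy with
    | source r =>
      obtain ⟨rfl, h2⟩ := Prod.ext_iff.1 hX
      rw [WithTop.coe_inj.1 h2]; exact hwhite1 _
    | first r b hb =>
      obtain ⟨rfl, h2⟩ := Prod.ext_iff.1 hX
      rw [WithTop.coe_inj.1 h2]; exact hwhite0 _ hb.rowNonempty
    | next b b' hb =>
      obtain ⟨rfl, h2⟩ := Prod.ext_iff.1 hX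
      rw [WithTop.coe_inj.1 h2]; exact hwhite0 _ ⟨b', hb⟩
    | box b => exact absurd (Prod.ext_iff.1 hX).2 (WithTop.coe_ne_top)
    | down b b' hb =>
      obtain ⟨rfl, h2⟩ := Prod.ext_iff.1 hX
      rw [WithTop.coe_inj.1 h2]; exact hwhite1 _
    | sink b hb =>
      obtain ⟨rfl, h2⟩ := Prod.ext_iff.1 hX
      rw [WithTop.coe_inj.1 h2]; exact hwhite1 _
  · generalize hX : ((c, (x : WithTop ℝ)) : T.RealPoint) = X at hy
    cases hy with
    | source r =>
      obtain ⟨rfl, h2⟩ := Prod.ext_iff.1 hX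
      rw [WithTop.coe_inj.1 h2]; exact hΨ.pivot r
    | first r b hb => obtain ⟨rfl, h2⟩ := Prod.ext_iff.1 hX; exact hblack _ _
    | next b b' hb => obtain ⟨rfl, h2⟩ := Prod.ext_iff.1 hX; exact hblack _ _
    | box b => obtain ⟨rfl, h2⟩ := Prod.ext_iff.1 hX; exact hblack _ _
    | down b b' hb => obtain ⟨rfl, h2⟩ := Prod.ext_iff.1 hX; exact hblack _ _
    | sink b hb =>
      obtain ⟨rfl, h2⟩ := Prod.ext_iff.1 hX
      rw [WithTop.coe_inj.1 h2]; exact hΨ.column b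

omit h hΦ hΨ in
theorem eval_map_ofReal (p : Polynomial ℝ) (x : ℝ) :
    (p.map (algebraMap ℝ ℂ)).eval (x : ℂ) = (p.eval x : ℝ) :=
  (Polynomial.eval_map_algebraMap _ _).trans (Polynomial.aeval_algebraMap_apply ℂ x p)

theorem kpDivisor_node {x : T.RealPoint} (hx : T.IsNode κ x) :
    T.kpDivisor κ A t₀ x.toPoint = 0 := by
  obtain ⟨c, x⟩ := x
  induction x using WithTop.recTopCoe with
  | top => exact kpDivisor_infty h hΦ hΨ c
  | coe x =>
    rw [toPoint_coe, kpDivisor_coe h hΦ hΨ, Polynomial.rootMultiplicity_eq_zero]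
    · rfl
    · rw [Polynomial.IsRoot, eval_map_ofReal]
      exact_mod_cast numer_eval_node_ne_zero hΨ hx

theorem isEffectiveOfDegree_kpDivisor :
    T.IsEffectiveOfDegree κ (T.kpDivisor κ A t₀) T.dim := by
  classical
  have hc : T.kpDivisor κ A t₀ = fun P => ((T.divisorPoints κ A t₀).count P : ℤ) :=
    funext fun P => kpDivisor_eq_count h hΦ hΨ P
  have hsub : (Function.support (T.kpDivisor κ A t₀)) ⊆
      ((T.divisorPoints κ A t₀).toFinset : Set T.Point) := by
    intro P hP
    rw [hc] at hP
    by_contra h'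
    apply hP
    simpa using h'
  refine ⟨fun P => ?_, (Finset.finite_toSet _).subset hsub, ?_, kpDivisor_infty h hΦ hΨ _,
    fun x hx => kpDivisor_node h hΦ hΨ hx⟩
  · rw [hc]; exact Int.natCast_nonneg _
  · rw [finsum_eq_sum_of_support_subset _ hsub, hc, ← card_divisorPoints h hΨ,
      ← Multiset.toFinset_sum_count_eq]
    push_cast
    rfl

theorem restrictsToSato_kpDivisor : T.RestrictsToSato κ A t₀ (T.kpDivisor κ A t₀) :=
  fun z => kpDivisor_coe h hΦ hΨ _ z

end Divisor

end LeTableau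

/-! ### The normalized wave function -/

namespace LeTableau

variable {k n : ℕ} {T : LeTableau k n} {κ : Fin n → ℝ} {A : Matrix (Fin k) (Fin n) ℝ}

theorem expFactor_analyticAt (s : KPTime) (z : ℂ) :
    AnalyticAt ℂ (T.expFactor s .base) z := by
  have h : Differentiable ℂ (T.expFactor s .base) := by
    have h1 := differentiable_kpTheta s
    change Differentiable ℂ fun ζ => Complex.exp (kpTheta ζ s)
    exact h1.cexp
  exact h.analyticAt z

theorem meromorphicAtPoint_expFactor_mul (s : KPTime) {P : T.Point} (hP : P ≠ (.base, ∞))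
    {f : ℂ → ℂ} (hf : MeromorphicAtPoint f P.2) :
    MeromorphicAtPoint (fun ζ => T.expFactor s P.1 ζ * f ζ) P.2 := by
  obtain ⟨c, p⟩ := P
  rcases c with _ | v | b
  · induction p using OnePoint.rec with
    | infty => exact absurd rfl hP
    | coe z => exact ((expFactor_analyticAt s z).meromorphicAt).fun_mul hf
  · simpa [expFactor] using hf
  · simpa [expFactor] using hf

theorem orderAtPoint_expFactor_mul (s : KPTime) {P : T.Point} (hP : P ≠ (.base, ∞))
    {f : ℂ → ℂ} (hf : MeromorphicAtPoint f P.2) :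
    orderAtPoint (fun ζ => T.expFactor s P.1 ζ * f ζ) P.2 = orderAtPoint f P.2 := by
  obtain ⟨c, p⟩ := P
  rcases c with _ | v | b
  · induction p using OnePoint.rec with
    | infty => exact absurd rfl hP
    | coe z =>
      have h1 : meromorphicOrderAt (T.expFactor s .base) z = (0 : ℤ) :=
        (meromorphicOrderAt_eq_int_iff (expFactor_analyticAt s z).meromorphicAt).2
          ⟨_, expFactor_analyticAt (T := T) s z, Complex.exp_ne_zero _, by simp⟩
      have h2 := fun_meromorphicOrderAt_mul (expFactor_analyticAt (T := T) s z).meromorphicAt hf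
      rw [h1] at h2
      refine h2.trans ?_
      simp; rfl
  · simp [expFactor]
  · simp [expFactor]

section Wave

variable {t₀ : KPTime} (h : T.Regular κ A) (hΦ : T.VacuumNonvanishing κ t₀)
  (hΨ : T.DressedNonvanishing κ A t₀)

include hΦ in
theorem kpWave_eq (c : T.Component) {ζ : ℂ}
    (hζ : ((T.denom κ t₀ c).map (algebraMap ℝ ℂ)).eval ζ ≠ 0) (t : KPTime) :
    T.kpWave κ A t₀ c ζ t = T.expFactor (t - t₀) c ζ *
      (((T.numer κ A t c).map (algebraMap ℝ ℂ)).eval ζ /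
        ((T.numer κ A t₀ c).map (algebraMap ℝ ℂ)).eval ζ) := by
  have h2 : T.dressedWave κ A t₀ c ζ t₀ = _ := congrFun (dressedWave_self (A := A) hΦ c) ζ
  rw [kpWave, h2, dressedWave_eq (fun v => (hΦ v).2.2), mul_div_assoc, div_div_div_cancel_right₀ hζ]

include hΦ in
theorem kpWave_base (ζ : ℂ) (t : KPTime) :
    T.kpWave κ A t₀ .base ζ t = Complex.exp (kpTheta ζ (t - t₀)) *
      (((T.reducedSatoPoly κ A t).map (algebraMap ℝ ℂ)).eval ζ /
        ((T.reducedSatoPoly κ A t₀).map (algebraMap ℝ ℂ)).eval ζ) :=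
  kpWave_eq hΦ _ (by simp [denom]) t

include hΦ in
-- The vacuum denominators depend on t₀ only and cancel in the normalization; the finitely many
-- exceptions are their zeros.
theorem kpWave_eventuallyEq (c : T.Component) (t : KPTime) :
    (fun ζ => T.kpWave κ A t₀ c ζ t) =ᶠ[cofinite] fun ζ => T.expFactor (t - t₀) c ζ *
      (((T.numer κ A t c).map (algebraMap ℝ ℂ)).eval ζ /
        ((T.numer κ A t₀ c).map (algebraMap ℝ ℂ)).eval ζ) := by
  filter_upwards [Polynomial.eventually_cofinite_eval_ne_zero
    (map_ne_zero_of_ne_zero (denom_ne_zero hΦ c))] with ζ hζ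
  exact kpWave_eq hΦ c hζ t

include hΦ in
theorem meromorphicAtPoint_kpWave (t : KPTime) {P : T.Point} (hP : P ≠ (.base, ∞)) :
    MeromorphicAtPoint (fun ζ => T.kpWave κ A t₀ P.1 ζ t) P.2 :=
  meromorphicAtPoint_congr (kpWave_eventuallyEq hΦ P.1 t).symm
    (meromorphicAtPoint_expFactor_mul _ hP
      ((Polynomial.meromorphicAtPoint _ _).div (Polynomial.meromorphicAtPoint _ _)))

include h hΦ hΨ

theorem orderAtPoint_kpWave (t : KPTime) {P : T.Point} (hP : P ≠ (.base, ∞))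
    (ht : T.numer κ A t P.1 ≠ 0) :
    orderAtPoint (fun ζ => T.kpWave κ A t₀ P.1 ζ t) P.2 =
      ((((T.numer κ A t P.1).map (algebraMap ℝ ℂ)).orderAt P.2 -
        ((T.numer κ A t₀ P.1).map (algebraMap ℝ ℂ)).orderAt P.2 : ℤ) : WithTop ℤ) := by
  rw [orderAtPoint_congr (kpWave_eventuallyEq hΦ P.1 t), orderAtPoint_expFactor_mul _ hP
    ((Polynomial.meromorphicAtPoint _ _).div (Polynomial.meromorphicAtPoint _ _)),
    Polynomial.orderAtPoint_div_eq (map_ne_zero_of_ne_zero ht)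
      (map_ne_zero_of_ne_zero (numer_ne_zero h hΨ _))]

omit h hΨ in
theorem orderAtPoint_kpWave_eq_top (t : KPTime) {P : T.Point} (ht : T.numer κ A t P.1 = 0) :
    orderAtPoint (fun ζ => T.kpWave κ A t₀ P.1 ζ t) P.2 = ⊤ := by
  rw [orderAtPoint_congr (kpWave_eventuallyEq hΦ P.1 t), ht]
  simpa using Polynomial.orderAtPoint_zero P.2

theorem neg_kpDivisor_le_orderAtPoint_kpWave (t : KPTime) {P : T.Point} (hP : P ≠ (.base, ∞)) :
    ((-T.kpDivisor κ A t₀ P : ℤ) : WithTop ℤ) ≤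
      orderAtPoint (fun ζ => T.kpWave κ A t₀ P.1 ζ t) P.2 := by
  by_cases ht : T.numer κ A t P.1 = 0
  · rw [orderAtPoint_kpWave_eq_top hΦ t ht]; exact le_top
  rw [orderAtPoint_kpWave h hΦ hΨ t hP ht, WithTop.coe_le_coe]
  obtain ⟨c, p⟩ := P
  induction p using OnePoint.rec with
  | infty =>
    rw [kpDivisor_infty h hΦ hΨ, Polynomial.orderAt_infty, Polynomial.orderAt_infty,
      Polynomial.natDegree_map, Polynomial.natDegree_map]
    have := natDegree_numer_le h hΨ t c
    simp only
    omega
  | coe z =>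
    rw [kpDivisor_coe h hΦ hΨ, Polynomial.orderAt_coe, Polynomial.orderAt_coe]
    simp only
    omega

theorem normalized_kpWave (P : T.Point) :
    HasValueAt (fun ζ => T.kpWave κ A t₀ P.1 ζ t₀) P.2 1 := by
  refine (hasValueAt_const 1 P.2).congr ?_
  filter_upwards [kpWave_eventuallyEq (A := A) hΦ P.1 t₀, Polynomial.eventually_cofinite_eval_ne_zero
    (map_ne_zero_of_ne_zero (numer_ne_zero h hΨ P.1))] with ζ h1 h2
  rw [h1, sub_self, expFactor_zero, div_self h2, one_mul]

omit hΨ in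
-- The reduced Sato polynomials at t and t₀ are monic of the same degree, so in the parameter 1/ζ
-- both become polynomials with value 1 at 0.
theorem asymptotic_kpWave (t : KPTime) : ∃ g : ℂ → ℂ, AnalyticAt ℂ g 0 ∧ g 0 = 1 ∧
    ∀ᶠ ζ in cocompact ℂ, T.kpWave κ A t₀ .base ζ t =
      Complex.exp (kpTheta ζ (t - t₀)) * g ζ⁻¹ := by
  have hdeg : ∀ s, ((T.reducedSatoPoly κ A s).map (algebraMap ℝ ℂ)).natDegree = T.reducedOrder :=
    fun s => (Polynomial.natDegree_map _).trans (h.numer_base_natDegree s)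
  have hcoeff : ∀ s, ((T.reducedSatoPoly κ A s).map (algebraMap ℝ ℂ)).coeff T.reducedOrder = 1 := by
    intro s
    have := (h.numer_base_monic s).map (algebraMap ℝ ℂ)
    rw [← hdeg s]; exact this
  let R : KPTime → Polynomial ℂ := fun s =>
    ((T.reducedSatoPoly κ A s).map (algebraMap ℝ ℂ)).reflect T.reducedOrder
  have hR : ∀ s, (R s).eval 0 = 1 := fun s => by rw [Polynomial.eval_reflect_zero, hcoeff]
  refine ⟨fun u => (R t).eval u / (R t₀).eval u, ?_, ?_, ?_⟩
  · refine AnalyticAt.div ((R t).differentiable.analyticAt 0) ((R t₀).differentiable.analyticAt 0) ?_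
    simp [hR]
  · simp [hR]
  · have h3 : ∀ᶠ ζ : ℂ in cocompact ℂ, ζ ≠ 0 :=
      cocompact_le_cofinite (Set.finite_singleton (0 : ℂ)).compl_mem_cofinite
    filter_upwards [h3] with ζ hζ
    rw [kpWave_base hΦ, Polynomial.eval_eq_pow_mul_eval_reflect _ (hdeg t).le hζ,
      Polynomial.eval_eq_pow_mul_eval_reflect _ (hdeg t₀).le hζ,
      mul_div_mul_right _ _ (pow_ne_zero _ hζ)]

omit hΨ in
theorem sato_kpWave (t : KPTime) (ζ : ℂ)
    (hζ : ((T.isolatedFactor κ).map (algebraMap ℝ ℂ)).eval ζ ≠ 0) :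
    T.kpWave κ A t₀ .base ζ t = dress (satoPoly κ A) (fun s => Complex.exp (kpTheta ζ s)) t /
      dress (satoPoly κ A) (fun s => Complex.exp (kpTheta ζ s)) t₀ := by
  have h1 := dress_exp (satoPoly κ A) ζ 0
  simp only [sub_zero] at h1
  have h2 : ∀ s, satoPoly κ A s = T.isolatedFactor κ * T.reducedSatoPoly κ A s := by
    intro s
    rw [h.reduced, h.sato]; exact T.satoPoly_eq_mul h.strictMono (h.wronskian_ne s)
  rw [h1, h1, h2, h2, kpWave_base hΦ, Polynomial.map_mul, Polynomial.map_mul, Polynomial.eval_mul,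
    Polynomial.eval_mul, kpTheta_sub, Complex.exp_sub, div_mul_div_comm,
    mul_left_comm (Complex.exp _) (Polynomial.eval ζ _), mul_left_comm (Complex.exp _) (Polynomial.eval ζ _),
    mul_div_mul_left _ _ hζ]

omit h hΦ hΨ in
theorem hasValueAt_kpWave_of_dressedWave {c : T.Component} {t : KPTime} {p : OnePoint ℂ}
    {x x₀ y : ℝ} (h1 : HasValueAt (fun ζ => T.dressedWave κ A t₀ c ζ t) p ((x : ℂ) / y))
    (h2 : HasValueAt (fun ζ => T.dressedWave κ A t₀ c ζ t₀) p ((x₀ : ℂ) / y))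
    (hx : x₀ ≠ 0) (hy : y ≠ 0) :
    HasValueAt (fun ζ => T.kpWave κ A t₀ c ζ t) p ((x / x₀ : ℝ) : ℂ) := by
  have hy' : (y : ℂ) ≠ 0 := by exact_mod_cast hy
  have hx' : (x₀ : ℂ) ≠ 0 := by exact_mod_cast hx
  have := h1.div h2 (div_ne_zero hx' hy')
  rw [div_div_div_cancel_right₀ hy'] at this
  push_cast
  exact this

omit h in
theorem hasValueAt_kpWave_zero {v : T.White} (hv : T.HasLeft v) (t : KPTime) :
    HasValueAt (fun ζ => T.kpWave κ A t₀ (.white v) ζ t) (((0 : ℝ) : ℂ) : OnePoint ℂ)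
      ((T.Psi1 κ A v t / T.Psi1 κ A v t₀ : ℝ) : ℂ) :=
  hasValueAt_kpWave_of_dressedWave (hasValueAt_white_zero hΦ t hv) (hasValueAt_white_zero hΦ t₀ hv)
    (hΨ.psi1 v hv) ((hΦ v).1 hv)

omit h in
theorem hasValueAt_kpWave_one {v : T.White} (hv : T.Joined v) (t : KPTime) :
    HasValueAt (fun ζ => T.kpWave κ A t₀ (.white v) ζ t) (((1 : ℝ) : ℂ) : OnePoint ℂ)
      ((T.Psi2 κ A v t / T.Psi2 κ A v t₀ : ℝ) : ℂ) :=
  hasValueAt_kpWave_of_dressedWave (hasValueAt_white_one hΦ t hv) (hasValueAt_white_one hΦ t₀ hv)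
    (hΨ.psi2 v hv) (hΦ v).2.1

omit h in
theorem hasValueAt_kpWave_infty (b : T.Box) (t : KPTime) :
    HasValueAt (fun ζ => T.kpWave κ A t₀ (.white (.inr b)) ζ t) ∞
      ((T.Psi3 κ A (.inr b) t / T.Psi3 κ A (.inr b) t₀ : ℝ) : ℂ) :=
  hasValueAt_kpWave_of_dressedWave (hasValueAt_box_infty hΦ t b) (hasValueAt_box_infty hΦ t₀ b)
    (hΨ.psi3 b) (hΦ _).2.2

omit h in
theorem hasValueAt_kpWave_black (b : T.Box) (p : OnePoint ℂ) (t : KPTime) :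
    HasValueAt (fun ζ => T.kpWave κ A t₀ (.black b) ζ t) p
      ((T.Psi3 κ A (.inr b) t / T.Psi3 κ A (.inr b) t₀ : ℝ) : ℂ) :=
  hasValueAt_kpWave_of_dressedWave (hasValueAt_black hΦ t b p) (hasValueAt_black hΦ t₀ b p)
    (hΨ.psi3 b) (hΦ _).2.2

omit h hΨ in
theorem hasValueAt_kpWave_base {z : ℝ} (hz : (T.reducedSatoPoly κ A t₀).eval z ≠ 0) (t : KPTime) :
    HasValueAt (fun ζ => T.kpWave κ A t₀ .base ζ t) ((z : ℂ) : OnePoint ℂ)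
      (((Real.exp (kpThetaReal z t) * (T.reducedSatoPoly κ A t).eval z) /
        (Real.exp (kpThetaReal z t₀) * (T.reducedSatoPoly κ A t₀).eval z) : ℝ) : ℂ) :=
  hasValueAt_kpWave_of_dressedWave (hasValueAt_base hΦ t z) (hasValueAt_base hΦ t₀ z)
    (mul_ne_zero (Real.exp_pos _).ne' hz) (Real.exp_pos _).ne'

/-- The edge functions at the two glued points differ by a factor independent of t: a weight, a
sign, or the value of the isolated factor at κ_j. It is not zero and drops out after division by the
value at t₀. -/
theorem glued_kpWave (t : KPTime) {x y : T.RealPoint} (hxy : T.Glued κ x y) : ∃ a : ℂ,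
    HasValueAt (fun ζ => T.kpWave κ A t₀ x.1 ζ t) x.toPoint.2 a ∧
      HasValueAt (fun ζ => T.kpWave κ A t₀ y.1 ζ t) y.toPoint.2 a := by
  cases hxy with
  | source r =>
    refine ⟨_, ?_, hasValueAt_kpWave_base hΦ (hΨ.pivot r) t⟩
    by_cases hr : T.RowNonempty r
    · convert! hasValueAt_kpWave_one hΦ hΨ (v := .inl r) hr t using 2
      rw [Psi2_source, Psi2_source, h.sato_eval, h.sato_eval, mul_left_comm,
        mul_left_comm (Real.exp (kpThetaReal (κ (T.pivot r)) t₀)),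
        mul_div_mul_left _ _ (h.isolatedFactor_pivot_ne hr)]
    · exact hasValueAt_kpWave_of_dressedWave (hasValueAt_isolated hΦ t hr _)
        (hasValueAt_isolated hΦ t₀ hr _) (mul_ne_zero (Real.exp_pos _).ne' (hΨ.pivot r))
        (Real.exp_pos _).ne'
  | first r b hb =>
    refine ⟨_, ?_, hasValueAt_kpWave_black hΦ hΨ b _ t⟩
    convert! hasValueAt_kpWave_zero hΦ hΨ (v := .inl r) hb.rowNonempty t using 2
    rw [Psi1_first hb, Psi1_first hb, mul_div_mul_left _ _ b.2]
  | next b b' hb =>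
    refine ⟨_, ?_, hasValueAt_kpWave_black hΦ hΨ b' _ t⟩
    convert! hasValueAt_kpWave_zero hΦ hΨ (v := .inr b) ⟨b', hb⟩ t using 2
    rw [Psi1_next hb, Psi1_next hb, mul_div_mul_left _ _ b'.2]
  | box b => exact ⟨_, hasValueAt_kpWave_infty hΦ hΨ b t, hasValueAt_kpWave_black hΦ hΨ b _ t⟩
  | down b b' hb =>
    refine ⟨_, ?_, hasValueAt_kpWave_black hΦ hΨ b' _ t⟩
    convert! hasValueAt_kpWave_one hΦ hΨ (v := .inr b) trivial t using 2
    rw [Psi2_below hb, Psi2_below hb, mul_div_mul_left]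
    exact mul_ne_zero (pow_ne_zero _ (by norm_num)) (pow_ne_zero _ (by norm_num))
  | sink b hb =>
    refine ⟨_, ?_, hasValueAt_kpWave_base hΦ (hΨ.column b) t⟩
    convert! hasValueAt_kpWave_one hΦ hΨ (v := .inr b) trivial t using 2
    rw [Psi2_bottom hb, Psi2_bottom hb, mul_div_mul_left _ _ (T.rowSign_ne_zero _ _), h.sato_eval,
      h.sato_eval, mul_left_comm, mul_left_comm (Real.exp (kpThetaReal (κ b.1.2) t₀)),
        mul_div_mul_left _ _ (h.isolatedFactor_box_ne b)]

omit hΦ in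
/-- The zeros at `t₀` of the numerators are zeros for finitely many `x` only. -/
theorem finite_common_zeros (t : KPTime) {c : T.Component} {z : ℝ}
    (hz : (T.numer κ A t₀ c).eval z = 0) :
    {x | (T.numer κ A (shiftX t x) c).eval z = 0}.Finite := by
  rcases c with _ | (r | b) | b
  · simp only [numer, h.reduced] at hz ⊢
    refine T.finite_zeros_reducedSatoPoly h.strictMono h.wronskian_ne t fun r _ hr => ?_
    apply hΨ.pivot r
    rw [h.reduced, ← hr]; exact hz
  · by_cases hr : T.RowNonempty r
    · rw [h.numer_source hr, Polynomial.eval_C] at hz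
      exact absurd hz (hΨ.psi2 _ hr)
    · rw [numer_isolated hr, Polynomial.eval_C] at hz
      exact absurd hz (mul_ne_zero (Real.exp_pos _).ne' (hΨ.pivot r))
  · by_cases hl : T.HasLeft (.inr b)
    · rw [numer_of_hasLeft hl] at hz
      have hz0 : z ≠ 0 := by
        rintro rfl
        simp at hz
        exact hΨ.psi1 _ hl hz
      -- The value at z is the dressed sum of the vector z·vec3 − vec1. In the column of b itself
      -- vec1 vanishes and vec3 is a sign, so z ≠ 0 makes the vector non-zero; its pivot entries are
      -- zero.
      have h1 : ∀ s, (T.numer κ A s (.white (.inr b))).eval z =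
          dressedSum κ (satoPoly κ T.matrix) (z • T.vec3 (.inr b) + (-1 : ℝ) • T.vec1 (.inr b)) s := by
        intro s
        rw [numer_of_hasLeft hl, dressedSum_add, dressedSum_smul, dressedSum_smul, ← h.sato, ← Psi1,
          ← Psi3]
        simp; ring
      simp_rw [h1]
      have hv1 : T.vec1 (.inr b) b.1.2 = 0 := by
        obtain ⟨b', hb'⟩ := hl
        rw [vec1_next hb', Pi.smul_apply, boxVec_eq_zero _ _ (.inl hb'.2.1), smul_zero]
      refine T.finite_zeros_dressedSum_of_ne_zero h.strictMono h.wronskian_ne ?_ ?_ t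
      · refine Function.ne_iff.2 ⟨b.1.2, ?_⟩
        simp only [Pi.add_apply, Pi.smul_apply, smul_eq_mul, hv1, mul_zero, add_zero, vec3_box,
          Pi.zero_apply]
        exact mul_ne_zero hz0 (T.boxVec_self_ne b)
      · intro r
        simp [vec3_box, boxVec_eq_zero _ _ (.inr ⟨r, rfl⟩), vec1_eq_zero_of_pivot _ _ ⟨r, rfl⟩]
    · rw [numer_box_of_not_hasLeft hl, Polynomial.eval_C] at hz
      exact absurd hz (hΨ.psi3 b)
  · simp only [numer] at hz; rw [Polynomial.eval_C] at hz
    exact absurd hz (hΨ.psi3 b)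

/-- Outside the divisor regularity is already known. At each of its finitely many points the
numerator at the shifted time is non-zero for all but finitely many x, and then the pole has the
full multiplicity. The argument for the zeros needs real points, hence `hreal`. -/
theorem generic_kpWave (hreal : ∀ c (z : ℂ),
      ((T.numer κ A t₀ c).map (algebraMap ℝ ℂ)).eval z = 0 → ∃ x : ℝ, (x : ℂ) = z)
    (t : KPTime) : ∀ᶠ x : ℝ in cofinite, ∀ P : T.Point, P ≠ (.base, ∞) →
    T.kpDivisor κ A t₀ P =
      max 0 (-(orderAtPoint (fun ζ => T.kpWave κ A t₀ P.1 ζ (shiftX t x)) P.2).untop₀) := by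
  classical
  have h1 : ∀ c, ∀ z ∈ (T.numer κ A t₀ c).roots.toFinset,
      ∀ᶠ x : ℝ in cofinite, (T.numer κ A (shiftX t x) c).eval z ≠ 0 := by
    intro c z hz
    rw [Multiset.mem_toFinset, Polynomial.mem_roots (numer_ne_zero h hΨ c)] at hz
    rw [eventually_cofinite]
    simpa using finite_common_zeros h hΨ t hz
  have h2 : ∀ᶠ x : ℝ in cofinite, ∀ c, ∀ z ∈ (T.numer κ A t₀ c).roots.toFinset,
      (T.numer κ A (shiftX t x) c).eval z ≠ 0 := by
    rw [eventually_all]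
    intro c
    rw [Filter.eventually_all_finset]
    exact h1 c
  filter_upwards [h2] with x hx P hP
  by_cases hD : T.kpDivisor κ A t₀ P = 0
  · have h3 := neg_kpDivisor_le_orderAtPoint_kpWave h hΦ hΨ (shiftX t x) hP
    rw [hD] at h3 ⊢
    refine (max_eq_left ?_).symm
    rw [neg_nonpos]
    generalize orderAtPoint (fun ζ => T.kpWave κ A t₀ P.1 ζ (shiftX t x)) P.2 = o at h3
    induction o using WithTop.recTopCoe with
    | top => simp
    | coe o => simpa using WithTop.coe_le_coe.1 h3
  · obtain ⟨c, p⟩ := P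
    induction p using OnePoint.rec with
    | infty => exact absurd (kpDivisor_infty h hΦ hΨ c) hD
    | coe z =>
      rw [kpDivisor_coe h hΦ hΨ] at hD ⊢
      have hz : ((T.numer κ A t₀ c).map (algebraMap ℝ ℂ)).eval z = 0 := by
        by_contra h0
        exact hD (by rw [Polynomial.rootMultiplicity_eq_zero h0]; rfl)
      obtain ⟨y, rfl⟩ := hreal c z hz
      have hy : (T.numer κ A (shiftX t x) c).eval y ≠ 0 := by
        refine hx c y ?_
        rw [Multiset.mem_toFinset, Polynomial.mem_roots (numer_ne_zero h hΨ c), Polynomial.IsRoot]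
        rw [eval_map_ofReal] at hz
        exact_mod_cast hz
      have hne : T.numer κ A (shiftX t x) c ≠ 0 := by
        rintro h0; rw [h0] at hy; simp at hy
      rw [orderAtPoint_kpWave h hΦ hΨ _ hP hne, WithTop.untop₀_coe, Polynomial.orderAt_coe,
        Polynomial.orderAt_coe, Polynomial.rootMultiplicity_eq_zero
        (p := (T.numer κ A (shiftX t x) c).map (algebraMap ℝ ℂ))]
      · simp
      · rw [Polynomial.IsRoot, eval_map_ofReal]
        exact_mod_cast hy

theorem isKPWaveFunction_kpWave (hreal : ∀ c (z : ℂ),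
      ((T.numer κ A t₀ c).map (algebraMap ℝ ℂ)).eval z = 0 → ∃ x : ℝ, (x : ℂ) = z) :
    T.IsKPWaveFunction κ A t₀ (T.kpDivisor κ A t₀) (T.kpWave κ A t₀) where
  normalized := normalized_kpWave h hΦ hΨ
  meromorphic t _ hP := meromorphicAtPoint_kpWave hΦ t hP
  divisor t _ hP := neg_kpDivisor_le_orderAtPoint_kpWave h hΦ hΨ t hP
  glued t _ _ hxy := glued_kpWave h hΦ hΨ t hxy
  asymptotic t := asymptotic_kpWave h hΦ t
  sato t ζ hζ := sato_kpWave h hΦ t ζ hζ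
  generic t := generic_kpWave h hΦ hΨ hreal t

end Wave

end LeTableau

/-! ### Non-speciality of the divisor -/

theorem RatFunc.eval_eventuallyEq_div {f : RatFunc ℂ} {p q : Polynomial ℂ} (hq : q ≠ 0)
    (hf : f = algebraMap _ _ p / algebraMap _ _ q) :
    (fun ζ => f.eval (RingHom.id ℂ) ζ) =ᶠ[cofinite] fun ζ => p.eval ζ / q.eval ζ := by
  have h1 : f.num * q = p * f.denom := by
    have hq' : algebraMap (Polynomial ℂ) (RatFunc ℂ) q ≠ 0 := by simpa using hq
    have hd : algebraMap (Polynomial ℂ) (RatFunc ℂ) f.denom ≠ 0 := by simpa using f.denom_ne_zero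
    have h2 := hf
    rw [← f.num_div_denom, div_eq_div_iff hd hq'] at h2
    apply FaithfulSMul.algebraMap_injective (Polynomial ℂ) (RatFunc ℂ)
    simpa only [map_mul] using h2
  filter_upwards [Polynomial.eventually_cofinite_eval_ne_zero hq,
    Polynomial.eventually_cofinite_eval_ne_zero f.denom_ne_zero] with ζ h2 h3
  have h4 := congrArg (Polynomial.eval ζ) h1
  rw [Polynomial.eval_mul, Polynomial.eval_mul] at h4
  simp only [RatFunc.eval, Polynomial.eval₂_id]
  rwa [div_eq_div_iff h3 h2]

namespace LeTableau

variable {k n : ℕ} {T : LeTableau k n} {κ : Fin n → ℝ} {A : Matrix (Fin k) (Fin n) ℝ}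

/-- The sum `∑ⱼ vⱼ e^{θⱼ} P(κⱼ)` with a complex polynomial `P`. -/
noncomputable def polySum (κ : Fin n → ℝ) (P : Polynomial ℂ) (t : KPTime) (v : Fin n → ℝ) : ℂ :=
  ∑ j, (v j : ℂ) * Real.exp (kpThetaReal (κ j) t) * P.eval (κ j : ℂ)

theorem polySum_add (P : Polynomial ℂ) (t : KPTime) (v w : Fin n → ℝ) :
    polySum κ P t (v + w) = polySum κ P t v + polySum κ P t w := by
  simp only [polySum, ← Finset.sum_add_distrib, Pi.add_apply]
  exact Finset.sum_congr rfl fun j _ => by push_cast; ring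

theorem polySum_smul (P : Polynomial ℂ) (t : KPTime) (a : ℝ) (v : Fin n → ℝ) :
    polySum κ P t (a • v) = a * polySum κ P t v := by
  simp only [polySum, Finset.mul_sum, Pi.smul_apply, smul_eq_mul]
  exact Finset.sum_congr rfl fun j _ => by push_cast; ring

theorem polySum_single (P : Polynomial ℂ) (t : KPTime) (i : Fin n) :
    polySum κ P t (Pi.single i 1) =
      Real.exp (kpThetaReal (κ i) t) * P.eval (κ i : ℂ) := by
  rw [polySum, Finset.sum_eq_single i]
  · simp
  · intro j _ hj; simp [hj]
  · simp

section Nonspecial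

variable {t₀ : KPTime} (h : T.Regular κ A) (hΦ : T.VacuumNonvanishing κ t₀)
  (hΨ : T.DressedNonvanishing κ A t₀)

/-- Numerators of a function on the curve over the numerators of the wave function, matching at the
nodes. -/
structure Matching (T : LeTableau k n) (κ : Fin n → ℝ) (A : Matrix (Fin k) (Fin n) ℝ) (t₀ : KPTime)
    (p : T.Component → Polynomial ℂ) : Prop where
  natDegree_le : ∀ c, (p c).natDegree ≤ (T.numer κ A t₀ c).natDegree
  glued : ∀ c d (x y : ℝ), T.Glued κ (c, (x : WithTop ℝ)) (d, (y : WithTop ℝ)) →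
    (p c).eval (x : ℂ) * (((T.numer κ A t₀ d).eval y : ℝ) : ℂ) =
      (p d).eval (y : ℂ) * (((T.numer κ A t₀ c).eval x : ℝ) : ℂ)
  -- The remaining conditions are those at nodes with coordinate ∞. On a black component the
  -- numerator is constant, so its value at 0 also serves at ∞; on a white component with an edge to
  -- the left the value at ∞ is read off from the coefficient of ζ.
  down : ∀ b b', T.Below b b' → (p (.white (.inr b))).eval 1 * (T.Psi3 κ A (.inr b') t₀ : ℂ) =
    (p (.black b')).eval 0 * (T.Psi2 κ A (.inr b) t₀ : ℂ)
  box : ∀ b, T.HasLeft (.inr b) →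
    (p (.white (.inr b))).coeff 1 = (p (.black b)).eval 0
  box' : ∀ b, ¬ T.HasLeft (.inr b) →
    (p (.white (.inr b))).eval 1 = (p (.black b)).eval 0

theorem eval_one_white_box (b : T.Box) :
    (T.numer κ A t₀ (.white (.inr b))).eval 1 = T.Psi2 κ A (.inr b) t₀ := by
  by_cases hb : T.HasLeft (.inr b)
  · rw [numer_of_hasLeft hb]; simp [Psi3_eq_add]
  · rw [numer_box_of_not_hasLeft hb, Polynomial.eval_C, Psi3_eq_add, Psi1_of_not_hasLeft hb, zero_add]

include h hΦ hΨ in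
theorem exists_matching {f : T.Component → RatFunc ℂ}
    (hf : T.InLinearSystem κ (T.kpDivisor κ A t₀) f) : ∃ p : T.Component → Polynomial ℂ,
    T.Matching κ A t₀ p ∧
    ∀ c, f c = algebraMap _ _ (p c) / algebraMap _ _ ((T.numer κ A t₀ c).map (algebraMap ℝ ℂ)) := by
  have hN : ∀ c, (T.numer κ A t₀ c).map (algebraMap ℝ ℂ) ≠ 0 := fun c =>
    map_ne_zero_of_ne_zero (numer_ne_zero h hΨ c)
  have h1 : ∀ c, ∃ p : Polynomial ℂ, p.natDegree ≤ (T.numer κ A t₀ c).natDegree ∧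
      f c = algebraMap _ _ p / algebraMap _ _ ((T.numer κ A t₀ c).map (algebraMap ℝ ℂ)) := by
    intro c
    rw [← Polynomial.natDegree_map (algebraMap ℝ ℂ)]
    refine RatFunc.exists_polynomial_of_order_ge _ (hN c) (fun z => ?_) ?_
    · have h2 := hf.1 (c, (z : OnePoint ℂ))
      rwa [kpDivisor_coe h hΦ hΨ] at h2
    · have h2 := hf.1 (c, ∞)
      rw [kpDivisor_infty h hΦ hΨ] at h2
      simpa using h2
  choose p hp hfp using h1
  have hev : ∀ c, (fun ζ => (f c).eval (RingHom.id ℂ) ζ) =ᶠ[cofinite] fun ζ => (p c).eval ζ /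
      ((T.numer κ A t₀ c).map (algebraMap ℝ ℂ)).eval ζ := fun c =>
    RatFunc.eval_eventuallyEq_div (hN c) (hfp c)
  have hval : ∀ c (x : ℝ), (T.numer κ A t₀ c).eval x ≠ 0 →
      HasValueAt (fun ζ => (f c).eval (RingHom.id ℂ) ζ) (((x : ℂ)) : OnePoint ℂ)
        ((p c).eval (x : ℂ) / (((T.numer κ A t₀ c).eval x : ℝ) : ℂ)) := by
    intro c x hx
    rw [← eval_map_ofReal]
    refine (Polynomial.hasValueAt_div_coe _ _ ?_).congr (hev c).symm
    rw [eval_map_ofReal]; exact_mod_cast hx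
  have hblack : ∀ b P, HasValueAt (fun ζ => (f (.black b)).eval (RingHom.id ℂ) ζ) P
      ((p (.black b)).eval 0 / (T.Psi3 κ A (.inr b) t₀ : ℂ)) := by
    intro b P
    refine (hasValueAt_const _ P).congr (Filter.EventuallyEq.trans ?_ (hev _).symm)
    refine Filter.Eventually.of_forall fun ζ => ?_
    have h2 := hp (.black b)
    simp only [numer, Polynomial.natDegree_C, Nat.le_zero] at h2
    rw [Polynomial.eq_C_of_natDegree_eq_zero h2]
    simp [numer]
  refine ⟨p, ⟨hp, fun c d x y hxy => ?_, fun b b' hb => ?_, fun b hb => ?_, fun b hb => ?_⟩, hfp⟩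
  · have h2 := numer_eval_node_ne_zero hΨ ⟨_, Or.inl hxy⟩
    have h3 := numer_eval_node_ne_zero hΨ ⟨_, Or.inr hxy⟩
    obtain ⟨a, ha, ha'⟩ := hf.2 _ _ hxy
    have h4 := (hval c x h2).unique ha
    have h5 := (hval d y h3).unique ha'
    rw [← h5, div_eq_div_iff] at h4
    · exact h4
    · exact_mod_cast h2
    · exact_mod_cast h3
  · have h2 := numer_eval_node_ne_zero hΨ ⟨_, Or.inl (Glued.down (κ := κ) b b' hb)⟩
    obtain ⟨a, ha, ha'⟩ := hf.2 _ _ (Glued.down b b' hb)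
    have h4 := (hval _ 1 h2).unique ha
    have h5 := (hblack b' _).unique ha'
    rw [← h5, div_eq_div_iff] at h4
    · rw [eval_one_white_box] at h4
      simpa using h4
    · exact_mod_cast h2
    · exact_mod_cast hΨ.psi3 b'
  · obtain ⟨a, ha, ha'⟩ := hf.2 _ _ (Glued.box b)
    have h5 := (hblack b _).unique ha'
    have hdeg : (T.numer κ A t₀ (.white (.inr b))).natDegree = 1 := by
      rw [numer_of_hasLeft hb, Polynomial.natDegree_linear_sub (hΨ.psi3 b)]
    have hco : ((T.numer κ A t₀ (.white (.inr b))).map (algebraMap ℝ ℂ)).coeff 1 =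
        (T.Psi3 κ A (.inr b) t₀ : ℂ) := by
      rw [numer_of_hasLeft hb]; simp [Polynomial.coeff_C]
    have h3 : (T.Psi3 κ A (.inr b) t₀ : ℂ) ≠ 0 := by exact_mod_cast hΨ.psi3 b
    have h6 := ((Polynomial.hasValueAt_div_infty (N := 1) (hdeg ▸ hp (.white (.inr b)))
      (by rw [Polynomial.natDegree_map, hdeg]) (by rw [hco]; exact h3)).congr
        (hev (.white (.inr b))).symm).unique ha
    rw [hco, ← h5] at h6
    exact (div_left_inj' h3).1 h6
  · obtain ⟨a, ha, ha'⟩ := hf.2 _ _ (Glued.box b)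
    have h5 := (hblack b _).unique ha'
    have h3 : (T.Psi3 κ A (.inr b) t₀ : ℂ) ≠ 0 := by exact_mod_cast hΨ.psi3 b
    have hconst : ∀ ζ, (p (.white (.inr b))).eval ζ = (p (.white (.inr b))).eval 1 := by
      intro ζ
      have h2 := hp (.white (.inr b))
      rw [numer_box_of_not_hasLeft hb, Polynomial.natDegree_C, Nat.le_zero] at h2
      rw [Polynomial.eq_C_of_natDegree_eq_zero h2]; simp
    have h6 : HasValueAt (fun ζ => (f (.white (.inr b))).eval (RingHom.id ℂ) ζ) ∞
        ((p (.white (.inr b))).eval 1 / (T.Psi3 κ A (.inr b) t₀ : ℂ)) := by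
      refine (hasValueAt_const _ _).congr (Filter.EventuallyEq.trans ?_ (hev _).symm)
      refine Filter.Eventually.of_forall fun ζ => ?_
      simp only [hconst ζ, numer_box_of_not_hasLeft hb, Polynomial.map_C, Polynomial.eval_C]
      rfl
    have h7 := h6.unique ha
    rw [← h5] at h7
    exact (div_left_inj' h3).1 h7

section

variable {p : T.Component → Polynomial ℂ} (hp : T.Matching κ A t₀ p)
include h hΨ hp

omit h in
theorem Matching.next {b b' : T.Box} (hb : T.Next b b') :
    (p (.white (.inr b))).eval 0 = -(T.weight b'.1.1 b'.1.2 * (p (.black b')).eval 0) := by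
  have h1 := hp.glued _ _ _ _ (.next b b' hb)
  have h2 : (p (.black b')).natDegree = 0 := by
    have := hp.natDegree_le (.black b')
    simpa [numer] using this
  rw [numer_of_hasLeft (v := .inr b) ⟨b', hb⟩, Polynomial.eq_C_of_natDegree_eq_zero h2] at h1
  simp only [numer, Polynomial.eval_C, Polynomial.eval_sub, Polynomial.eval_mul, Polynomial.eval_X,
    mul_zero, zero_sub, Psi1_next hb, Complex.ofReal_zero] at h1
  rw [Polynomial.eq_C_of_natDegree_eq_zero h2, Polynomial.eval_C]
  have h3 : (T.Psi3 κ A (.inr b') t₀ : ℂ) ≠ 0 := by exact_mod_cast hΨ.psi3 b'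
  apply mul_right_cancel₀ h3
  rw [h1]; push_cast; ring

omit hΨ in
theorem Matching.first {r : Fin k} {b : T.Box} (hb : T.First r b) :
    (p (.white (.inl r))).eval 1 * (T.Psi3 κ A (.inr b) t₀ : ℂ) =
      (p (.black b)).eval 0 * (T.Psi2 κ A (.inl r) t₀ : ℂ) := by
  have h1 := hp.glued _ _ _ _ (.first r b hb)
  have h2 : (p (.black b)).natDegree = 0 := by
    have := hp.natDegree_le (.black b)
    simpa [numer] using this
  have h3 : (p (.white (.inl r))).natDegree = 0 := by
    have := hp.natDegree_le (.white (.inl r))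
    rw [h.numer_source hb.rowNonempty] at this
    simpa using this
  rw [h.numer_source hb.rowNonempty] at h1
  rw [Polynomial.eq_C_of_natDegree_eq_zero h2, Polynomial.eq_C_of_natDegree_eq_zero h3] at h1 ⊢
  simpa [numer] using h1

theorem Matching.eval_one_box (b : T.Box)
    (ih : ∀ c, T.Below b c → (p (.black c)).eval 0 = polySum κ
      (p .base * (T.isolatedFactor κ).map (algebraMap ℝ ℂ)) t₀ (T.boxVec c)) :
    (p (.white (.inr b))).eval 1 = polySum κ
      (p .base * (T.isolatedFactor κ).map (algebraMap ℝ ℂ)) t₀ (T.vec2 (.inr b)) := by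
  rcases T.bottom_or_below b with hb | ⟨c, hc⟩
  · have h1 := hp.glued _ _ _ _ (.sink b hb)
    rw [eval_one_white_box, Psi2_bottom hb, h.sato_eval, Complex.ofReal_one] at h1
    rw [vec2_bottom hb, polySum_smul, polySum_single, Polynomial.eval_mul, eval_map_ofReal]
    have h3 : (((T.reducedSatoPoly κ A t₀).eval (κ b.1.2) : ℝ) : ℂ) ≠ 0 := by exact_mod_cast hΨ.column b
    apply mul_right_cancel₀ h3
    simp only [numer] at h1
    rw [h1]; push_cast; ring
  · have h1 := hp.down b c hc
    have h3 : (T.Psi3 κ A (.inr c) t₀ : ℂ) ≠ 0 := by exact_mod_cast hΨ.psi3 c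
    apply mul_right_cancel₀ h3
    rw [h1, ih c hc, Psi2_below hc, vec2_below_eq_smul hc, polySum_smul]
    push_cast; ring

/-- The numerators satisfy the same recursion as the edge vectors, with initial values at the sinks
given by the polynomial on Γ₀. The factor q appears because Ψ2 at a sink contains S = q S', whereas
S' is the numerator on Γ₀. The induction runs from the lower and left boxes, which are nearer to the
sinks. -/
theorem Matching.black_eq (b : T.Box) : (p (.black b)).eval 0 = polySum κ
    (p .base * (T.isolatedFactor κ).map (algebraMap ℝ ℂ)) t₀ (T.boxVec b) := by
  induction hm : (k - b.1.1 : ℕ) + (n - b.1.2 : ℕ) using Nat.strong_induction_on generalizing b with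
  | _ m ih =>
    have hb1 := b.1.1.isLt
    have hb2 := b.1.2.isLt
    have h1 := hp.eval_one_box h hΨ b fun c hc => ih _ (by
      have h2 : (c.1.2 : ℕ) = b.1.2 := congrArg Fin.val hc.1
      have h3 : (b.1.1 : ℕ) < c.1.1 := hc.2.1
      omega) c rfl
    by_cases hl : T.HasLeft (.inr b)
    · obtain ⟨c, hc⟩ := hl
      have h2 := ih _ (by
        have h2 : (c.1.1 : ℕ) = b.1.1 := congrArg Fin.val hc.1
        have h3 : (b.1.2 : ℕ) < c.1.2 := hc.2.1
        omega) c rfl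
      have h3 : (p (.white (.inr b))).natDegree ≤ 1 := by
        refine (hp.natDegree_le _).trans ?_
        rw [numer_of_hasLeft (v := .inr b) ⟨c, hc⟩, Polynomial.natDegree_linear_sub (hΨ.psi3 b)]
      have h4 := hp.next hΨ hc
      rw [Polynomial.eq_X_add_C_of_natDegree_le_one h3] at h1 h4
      simp only [Polynomial.eval_add, Polynomial.eval_mul, Polynomial.eval_C, Polynomial.eval_X,
        mul_one, mul_zero, zero_add] at h1 h4
      rw [← hp.box b ⟨c, hc⟩, ← vec3_box, vec3, polySum_add, vec1_next hc, polySum_smul, ← h1, ← h2, h4]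
      ring
    · rw [← hp.box' b hl, h1, ← vec3_box, vec3, vec1_of_not_hasLeft hl, zero_add]

/-- Both nodes of the source component involve the same constant numerator. Eliminating it relates
the value at the first box to that of the base polynomial at the pivot, which closes the recursion
to a condition on the whole row. For an isolated row the condition holds because q vanishes at its
pivot. -/
theorem Matching.polySum_matrix (r : Fin k) : polySum κ
    (p .base * (T.isolatedFactor κ).map (algebraMap ℝ ℂ)) t₀ (T.matrix r) = 0 := by
  by_cases hr : T.RowNonempty r
  · obtain ⟨b, hb⟩ := T.exists_first hr
    have h1 := hp.first h hb
    have h2 := hp.glued _ _ _ _ (.source r)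
    rw [matrix_row, vec3, polySum_add, vec1_first hb, vec2, polySum_smul, polySum_single,
      ← hp.black_eq h hΨ, Polynomial.eval_mul, eval_map_ofReal]
    have h3 : (((T.reducedSatoPoly κ A t₀).eval (κ (T.pivot r)) : ℝ) : ℂ) ≠ 0 := by
      exact_mod_cast hΨ.pivot r
    have h5 := h.Psi1_source r t₀
    rw [Psi1_first hb] at h5
    have h6 : (T.Psi2 κ A (.inl r) t₀ : ℂ) ≠ 0 := by exact_mod_cast hΨ.psi2 (.inl r) hr
    have h7 : (T.Psi3 κ A (.inr b) t₀ : ℂ) ≠ 0 := by exact_mod_cast hΨ.psi3 b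
    rw [h.numer_source hr] at h2
    simp only [numer, Polynomial.eval_C, Complex.ofReal_one] at h2
    have h8 : (p .base).eval (κ (T.pivot r) : ℂ) * (T.Psi3 κ A (.inr b) t₀ : ℂ) =
        (p (.black b)).eval 0 * (((T.reducedSatoPoly κ A t₀).eval (κ (T.pivot r)) : ℝ) : ℂ) := by
      apply mul_right_cancel₀ h6
      rw [mul_right_comm, ← h2, mul_right_comm, h1]; ring
    have h9 : ((T.weight b.1.1 b.1.2 : ℝ) : ℂ) * (T.Psi3 κ A (.inr b) t₀ : ℂ) =
        -(T.Psi2 κ A (.inl r) t₀ : ℂ) := by exact_mod_cast h5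
    have h10 : (T.Psi2 κ A (.inl r) t₀ : ℂ) = Real.exp (kpThetaReal (κ (T.pivot r)) t₀) *
        ((T.isolatedFactor κ).eval (κ (T.pivot r)) *
          (T.reducedSatoPoly κ A t₀).eval (κ (T.pivot r))) := by
      rw [Psi2_source, h.sato_eval]; push_cast; rfl
    apply mul_right_cancel₀ h7
    rw [zero_mul, add_mul, mul_right_comm, h9, h10]
    linear_combination (Real.exp (kpThetaReal (κ (T.pivot r)) t₀) : ℂ) *
      (((T.isolatedFactor κ).eval (κ (T.pivot r)) : ℝ) : ℂ) * h8
  · rw [matrix_row_isolated _ hr, polySum_single, Polynomial.eval_mul, eval_map_ofReal,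
      (T.isolatedFactor_eval_eq_zero_iff κ _).2 ⟨r, hr, rfl⟩]
    simp

/-- The product of q with the base polynomial and S at t₀ satisfy the same k linear conditions. With
a chosen to remove the coefficient in degree k', the difference has degree less than k after
multiplication by q, so the Wronskian forces it to vanish. -/
theorem Matching.base_eq : ∃ a : ℂ,
    p .base = Polynomial.C a * (T.numer κ A t₀ .base).map (algebraMap ℝ ℂ) := by
  set S := (T.numer κ A t₀ .base).map (algebraMap ℝ ℂ) with hS
  have hSm : S.Monic := (h.numer_base_monic t₀).map _
  set q := (T.isolatedFactor κ).map (algebraMap ℝ ℂ) with hq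
  have hqm : q.Monic := (T.isolatedFactor_monic κ).map _
  have hprod : S * q = (satoPoly κ A t₀).map (algebraMap ℝ ℂ) := by
    rw [hS, hq, ← Polynomial.map_mul, h.sato, T.satoPoly_eq_mul h.strictMono (h.wronskian_ne t₀),
      mul_comm, ← h.reduced]
    rfl
  have hdeg : S.natDegree + q.natDegree = k := by
    rw [← hSm.natDegree_mul hqm, hprod, Polynomial.natDegree_map, satoPoly_natDegree]
  have hp0 : (p .base).natDegree ≤ S.natDegree := by
    rw [hS, Polynomial.natDegree_map]; exact hp.natDegree_le _
  set a := (p .base).coeff S.natDegree with ha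
  refine ⟨a, ?_⟩
  have hlt : (p .base - Polynomial.C a * S).degree < S.natDegree := by
    rw [Polynomial.degree_lt_iff_coeff_zero]
    intro m hm
    rcases hm.eq_or_lt with rfl | hm
    · rw [Polynomial.coeff_sub, Polynomial.coeff_C_mul, hSm.coeff_natDegree, mul_one, sub_self]
    · rw [Polynomial.coeff_sub, Polynomial.coeff_C_mul,
        Polynomial.coeff_eq_zero_of_natDegree_lt (hp0.trans_lt hm),
        Polynomial.coeff_eq_zero_of_natDegree_lt hm, mul_zero, sub_zero]
  have h0 : (p .base - Polynomial.C a * S) * q = 0 := by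
    refine eq_zero_of_annihilates_rows (h.wronskian_ne t₀) _ ?_ fun i => ?_
    · by_cases hz : p .base - Polynomial.C a * S = 0
      · rw [hz, zero_mul, Polynomial.degree_zero]; exact WithBot.bot_lt_coe _
      · rw [Polynomial.degree_eq_natDegree hz] at hlt
        rw [Polynomial.degree_mul, Polynomial.degree_eq_natDegree hz,
          Polynomial.degree_eq_natDegree hqm.ne_zero]
        norm_cast at hlt ⊢
        omega
    · have h1 := hp.polySum_matrix h hΨ i
      have h2 := dressedSum_satoPoly_row (h.wronskian_ne t₀) i
      rw [← h.sato, dressedSum] at h2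
      have h3 : ∑ j, (T.matrix i j : ℂ) * Real.exp (kpThetaReal (κ j) t₀) * (S * q).eval (κ j : ℂ)
          = 0 := by
        rw [hprod]
        simp_rw [eval_map_ofReal]
        exact_mod_cast h2
      rw [polySum] at h1
      calc _ = ∑ j, ((T.matrix i j : ℂ) * Real.exp (kpThetaReal (κ j) t₀) *
            (p .base * q).eval (κ j : ℂ) - a * ((T.matrix i j : ℂ) *
              Real.exp (kpThetaReal (κ j) t₀) * (S * q).eval (κ j : ℂ))) := by
            refine Finset.sum_congr rfl fun j _ => ?_
            simp only [Polynomial.eval_mul, Polynomial.eval_sub, Polynomial.eval_C]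
            ring
        _ = 0 := by rw [Finset.sum_sub_distrib, ← Finset.mul_sum, h1, h3]; simp
  rcases mul_eq_zero.1 h0 with h1 | h1
  · exact sub_eq_zero.1 h1
  · exact absurd h1 hqm.ne_zero

end

include h hΨ in
-- Propagation from Γ₀ leaves no freedom: a constant is fixed by one node, and a linear numerator at
-- a box by its values at 1 and at infinity.
theorem Matching.unique {p p' : T.Component → Polynomial ℂ} (hp : T.Matching κ A t₀ p)
    (hp' : T.Matching κ A t₀ p') (hbase : p .base = p' .base) : p = p' := by
  have hblack : ∀ b, (p (.black b)).eval 0 = (p' (.black b)).eval 0 := fun b => by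
    rw [hp.black_eq h hΨ, hp'.black_eq h hΨ, hbase]
  have hone : ∀ b, (p (.white (.inr b))).eval 1 = (p' (.white (.inr b))).eval 1 := fun b => by
    rw [hp.eval_one_box h hΨ b fun c _ => hp.black_eq h hΨ c,
      hp'.eval_one_box h hΨ b fun c _ => hp'.black_eq h hΨ c, hbase]
  have hconst : ∀ {u v : Polynomial ℂ} (x : ℂ), u.natDegree = 0 → v.natDegree = 0 →
      u.eval x = v.eval x → u = v := by
    intro u v x hu hv huv
    rw [Polynomial.eq_C_of_natDegree_eq_zero hu, Polynomial.eq_C_of_natDegree_eq_zero hv] at huv ⊢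
    simpa using huv
  funext c
  rcases c with _ | (r | b) | b
  · exact hbase
  · have hd : (T.numer κ A t₀ (.white (.inl r))).natDegree = 0 := by
      by_cases hr : T.RowNonempty r
      · rw [h.numer_source hr, Polynomial.natDegree_C]
      · rw [numer_isolated hr, Polynomial.natDegree_C]
    have h1 := hp.glued _ _ _ _ (.source r)
    have h2 := hp'.glued _ _ _ _ (.source r)
    refine hconst 1 (Nat.le_zero.1 (hd ▸ hp.natDegree_le _)) (Nat.le_zero.1 (hd ▸ hp'.natDegree_le _)) ?_
    have h3 : (((T.numer κ A t₀ .base).eval (κ (T.pivot r)) : ℝ) : ℂ) ≠ 0 := by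
      exact_mod_cast hΨ.pivot r
    apply mul_right_cancel₀ h3
    rw [← hbase] at h2
    rw [Complex.ofReal_one] at h1 h2
    rw [h1, h2]
  · by_cases hl : T.HasLeft (.inr b)
    · have hd : (T.numer κ A t₀ (.white (.inr b))).natDegree = 1 := by
        rw [numer_of_hasLeft hl, Polynomial.natDegree_linear_sub (hΨ.psi3 b)]
      have h1 := hp.box b hl
      have h2 := hp'.box b hl
      have h3 := hone b
      rw [hblack b, ← h2] at h1
      have h4 := hp.natDegree_le (.white (.inr b))
      have h5 := hp'.natDegree_le (.white (.inr b))
      rw [hd] at h4 h5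
      rw [Polynomial.eq_X_add_C_of_natDegree_le_one h4,
        Polynomial.eq_X_add_C_of_natDegree_le_one h5] at h3 ⊢
      simp only [Polynomial.eval_add, Polynomial.eval_mul, Polynomial.eval_C, Polynomial.eval_X,
        h1, add_right_inj] at h3
      rw [h1, h3]
    · have hd : (T.numer κ A t₀ (.white (.inr b))).natDegree = 0 := by
        rw [numer_box_of_not_hasLeft hl, Polynomial.natDegree_C]
      exact hconst 1 (Nat.le_zero.1 (hd ▸ hp.natDegree_le _))
        (Nat.le_zero.1 (hd ▸ hp'.natDegree_le _)) (hone b)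
  · have hd : (T.numer κ A t₀ (.black b)).natDegree = 0 := by simp [numer]
    exact hconst 0 (Nat.le_zero.1 (hd ▸ hp.natDegree_le _))
        (Nat.le_zero.1 (hd ▸ hp'.natDegree_le _)) (hblack b)

theorem matching_const (a : ℂ) :
    T.Matching κ A t₀ fun c => Polynomial.C a * (T.numer κ A t₀ c).map (algebraMap ℝ ℂ) where
  natDegree_le c := (Polynomial.natDegree_C_mul_le _ _).trans (Polynomial.natDegree_map_le)
  glued c d x y _ := by
    simp only [Polynomial.eval_mul, eval_map_ofReal, Polynomial.eval_C]; ring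
  down b b' _ := by
    have h1 := eval_map_ofReal (T.numer κ A t₀ (.white (.inr b))) 1
    rw [eval_one_white_box, Complex.ofReal_one] at h1
    rw [Polynomial.eval_mul, Polynomial.eval_mul, h1]
    simp [numer]; ring
  box b hb := by
    rw [numer_of_hasLeft hb]; simp [numer, Polynomial.coeff_C]
  box' b hb := by
    rw [numer_box_of_not_hasLeft hb]; simp [numer]

include h hΦ hΨ in
theorem isNonspecial_kpDivisor : T.IsNonspecial κ (T.kpDivisor κ A t₀) := by
  intro f hf
  obtain ⟨p, hp, hfp⟩ := exists_matching h hΦ hΨ hf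
  obtain ⟨a, ha⟩ := hp.base_eq h hΨ
  have h1 := hp.unique h hΨ (matching_const a) ha
  refine ⟨a, fun c => ?_⟩
  have hN : algebraMap (Polynomial ℂ) (RatFunc ℂ) ((T.numer κ A t₀ c).map (algebraMap ℝ ℂ)) ≠ 0 := by
    simpa using numer_ne_zero h hΨ c
  rw [hfp, h1, map_mul, mul_div_assoc, div_self hN, mul_one, RatFunc.algebraMap_C]

end Nonspecial

end LeTableau

namespace LeTableau

variable {k n : ℕ} {T : LeTableau k n} {κ : Fin n → ℝ}

/-! ### Nodes and arcs -/

theorem isNode_base_iff {p : WithTop ℝ} : T.IsNode κ (.base, p) ↔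
    (∃ r, p = (κ (T.pivot r) : ℝ)) ∨ ∃ b, T.Bottom b ∧ p = (κ b.1.2 : ℝ) := by
  constructor
  · rintro ⟨y, hy | hy⟩
    · cases hy
    · generalize hX : ((Component.base, p) : T.RealPoint) = X at hy
      cases hy with
      | source r => exact .inl ⟨r, (Prod.ext_iff.1 hX).2⟩
      | sink b hb => exact .inr ⟨b, hb, (Prod.ext_iff.1 hX).2⟩
      | _ => exact absurd (Prod.ext_iff.1 hX).1 (by simp)
  · rintro (⟨r, rfl⟩ | ⟨b, hb, rfl⟩)
    · exact ⟨_, .inr (.source r)⟩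
    · exact ⟨_, .inr (.sink b hb)⟩

theorem isNode_source_iff {r : Fin k} {p : WithTop ℝ} : T.IsNode κ (.white (.inl r), p) ↔
    p = (1 : ℝ) ∨ T.RowNonempty r ∧ p = (0 : ℝ) := by
  constructor
  · rintro ⟨y, hy | hy⟩
    · generalize hX : ((Component.white (.inl r), p) : T.RealPoint) = X at hy
      cases hy with
      | source s => exact .inl (Prod.ext_iff.1 hX).2
      | first s b hb =>
        obtain ⟨h1, h2⟩ := Prod.ext_iff.1 hX
        simp only [Component.white.injEq, Sum.inl.injEq] at h1
        subst h1
        exact .inr ⟨hb.rowNonempty, h2⟩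
      | _ => exact absurd (Prod.ext_iff.1 hX).1 (by simp)
    · generalize hX : ((Component.white (.inl r), p) : T.RealPoint) = X at hy
      cases hy <;> exact absurd (Prod.ext_iff.1 hX).1 (by simp)
  · rintro (rfl | ⟨hr, rfl⟩)
    · exact isNode_white_one _
    · exact isNode_white_zero (v := .inl r) hr

theorem isNode_whiteBox_iff {b : T.Box} {p : WithTop ℝ} : T.IsNode κ (.white (.inr b), p) ↔
    p = ⊤ ∨ p = (1 : ℝ) ∨ T.HasLeft (.inr b) ∧ p = (0 : ℝ) := by
  constructor
  · rintro ⟨y, hy | hy⟩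
    · generalize hX : ((Component.white (.inr b), p) : T.RealPoint) = X at hy
      cases hy with
      | box c => exact .inl (Prod.ext_iff.1 hX).2
      | sink c hc => exact .inr (.inl (Prod.ext_iff.1 hX).2)
      | down c c' hc => exact .inr (.inl (Prod.ext_iff.1 hX).2)
      | next c c' hc =>
        obtain ⟨h1, h2⟩ := Prod.ext_iff.1 hX
        simp only [Component.white.injEq, Sum.inr.injEq] at h1
        subst h1
        exact .inr (.inr ⟨⟨c', hc⟩, h2⟩)
      | _ => exact absurd (Prod.ext_iff.1 hX).1 (by simp)
    · generalize hX : ((Component.white (.inr b), p) : T.RealPoint) = X at hy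
      cases hy <;> exact absurd (Prod.ext_iff.1 hX).1 (by simp)
  · rintro (rfl | rfl | ⟨hr, rfl⟩)
    · exact ⟨_, .inl (.box b)⟩
    · exact isNode_white_one _
    · exact isNode_white_zero (v := .inr b) hr

theorem isNode_black_iff {b : T.Box} {p : WithTop ℝ} : T.IsNode κ (.black b, p) ↔
    (p = (0 : ℝ) ∨ p = (1 : ℝ)) ∨ (∃ a, T.Below a b) ∧ p = ⊤ := by
  constructor
  · rintro ⟨y, hy | hy⟩
    · generalize hX : ((Component.black b, p) : T.RealPoint) = X at hy
      cases hy <;> exact absurd (Prod.ext_iff.1 hX).1 (by simp)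
    · generalize hX : ((Component.black b, p) : T.RealPoint) = X at hy
      cases hy with
      | box c => exact .inl (.inl (Prod.ext_iff.1 hX).2)
      | first r c hc => exact .inl (.inr (Prod.ext_iff.1 hX).2)
      | next c c' hc => exact .inl (.inr (Prod.ext_iff.1 hX).2)
      | down c c' hc =>
        obtain ⟨h1, h2⟩ := Prod.ext_iff.1 hX
        simp only [Component.black.injEq] at h1
        subst h1
        exact .inr ⟨⟨c, hc⟩, h2⟩
      | _ => exact absurd (Prod.ext_iff.1 hX).1 (by simp)
  · rintro ((rfl | rfl) | ⟨⟨a, ha⟩, rfl⟩)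
    · exact ⟨_, .inr (.box b)⟩
    · rcases T.first_or_next b with hb | ⟨c, hc⟩
      · exact ⟨_, .inr (.first _ b hb)⟩
      · exact ⟨_, .inr (.next c b hc)⟩
    · exact ⟨_, .inr (.down a b ha)⟩

/-- On an arc the set of the nodes already passed is constant, except when the arc runs through
infinity: then all nodes lie before x and none before y. These are the two alternatives. -/
theorem FreeArc.lt_iff {c : T.Component} {x y : WithTop ℝ} (h : T.FreeArc κ c x y)
    (hx : ¬ T.IsNode κ (c, x)) :
    (∀ p, T.IsNode κ (c, p) → (p < x ↔ p < y)) ∨ ∀ p, T.IsNode κ (c, p) → p < x ∧ ¬ p < y := by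
  rcases le_or_gt x y with hxy | hxy
  · refine .inl fun p hp => ⟨fun h1 => h1.trans_le hxy, fun h1 => ?_⟩
    by_contra h2
    rcases (not_lt.1 h2).eq_or_lt with rfl | h3
    · exact hx hp
    · exact h p hp (.inl ⟨h3, h1⟩)
  · refine .inr fun p hp => ⟨?_, fun h1 => h p hp (.inr (.inl ⟨h1, hxy⟩))⟩
    by_contra h2
    rcases (not_lt.1 h2).eq_or_lt with rfl | h3
    · exact hx hp
    · exact h p hp (.inr (.inr ⟨hxy, h3⟩))

/-- The variant for an arc that begins at a node x, which counts as passed. -/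
theorem FreeArc.le_iff {c : T.Component} {x y : WithTop ℝ} (h : T.FreeArc κ c x y)
    (hy : ¬ T.IsNode κ (c, y)) :
    (∀ p, T.IsNode κ (c, p) → (p ≤ x ↔ p < y)) ∨ ∀ p, T.IsNode κ (c, p) → p ≤ x ∧ ¬ p < y := by
  rcases le_or_gt x y with hxy | hxy
  · refine .inl fun p hp => ⟨fun h1 => (h1.trans hxy).lt_of_ne ?_, fun h1 => ?_⟩
    · rintro rfl; exact hy hp
    · by_contra h2
      exact h p hp (.inl ⟨not_le.1 h2, h1⟩)
  · refine .inr fun p hp => ⟨?_, fun h1 => h p hp (.inr (.inl ⟨h1, hxy⟩))⟩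
    by_contra h2
    exact h p hp (.inr (.inr ⟨hxy, not_le.1 h2⟩))

theorem freeArc_of_lt_iff {c : T.Component} {x y : WithTop ℝ} (hxy : x ≤ y)
    (h : ∀ p, T.IsNode κ (c, p) → p < y → p ≤ x) : T.FreeArc κ c x y := by
  rintro p hp (⟨h1, h2⟩ | ⟨h1, h2⟩ | ⟨h1, h2⟩)
  · exact (h p hp h2).not_gt h1
  · exact hxy.not_gt h2
  · exact hxy.not_gt h1

theorem freeArc_of_wrap {c : T.Component} {x y : WithTop ℝ}
    (h : ∀ p, T.IsNode κ (c, p) → p ≤ x ∧ y ≤ p) : T.FreeArc κ c x y := by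
  rintro p hp (⟨h1, h2⟩ | ⟨h1, h2⟩ | ⟨h1, h2⟩)
  · exact (h p hp).1.not_gt h1
  · exact (h p hp).2.not_gt h1
  · exact (h p hp).1.not_gt h2

/-! ### Boxes above and to the left of an oval -/

open Classical in
/-- The set of the boxes above and to the left of the arc of a component determined by the set `P` of
the nodes that have been passed. -/
def region (T : LeTableau k n) (κ : Fin n → ℝ) (P : WithTop ℝ → Prop) : T.Component → Set T.Box
  | .base => {c | P (κ (T.pivot c.1.1) : ℝ) ∧ ¬ P (κ c.1.2 : ℝ)}
  | .white (.inl r) =>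
      if ¬ P (1 : ℝ) ∧ P (0 : ℝ) then {c | c.1.1 ≤ r ∧ T.pivot r < c.1.2}
      else {c | c.1.1 < r ∧ T.pivot r < c.1.2}
  -- The nodes 0, 1, ∞ of a white vertex are the edges to the left, downwards and to the right, so
  -- its arcs border the upper left, lower left and lower right faces in turn. At a black vertex
  -- they point left, right and up. Once ∞ has been passed the arc is again the one before 0.
  | .white (.inr b) =>
      if P ⊤ then {c | c.1.1 < b.1.1 ∧ b.1.2 < c.1.2}
      else if P (1 : ℝ) then {c | c.1.1 ≤ b.1.1 ∧ b.1.2 ≤ c.1.2}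
      else if P (0 : ℝ) then {c | c.1.1 ≤ b.1.1 ∧ b.1.2 < c.1.2}
      else {c | c.1.1 < b.1.1 ∧ b.1.2 < c.1.2}
  | .black b =>
      if P ⊤ then {c | c.1.1 < b.1.1 ∧ b.1.2 < c.1.2}
      else if P (1 : ℝ) then {c | c.1.1 < b.1.1 ∧ b.1.2 ≤ c.1.2}
      else if P (0 : ℝ) then {c | c.1.1 ≤ b.1.1 ∧ b.1.2 ≤ c.1.2}
      else {c | c.1.1 < b.1.1 ∧ b.1.2 < c.1.2}

/-- Where an edge is missing, the faces on its two sides merge, and their regions must agree: here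
no box of the row lies further left. -/
theorem region_row_of_not_hasLeft {b : T.Box} (hb : ¬ T.HasLeft (.inr b)) :
    {c : T.Box | c.1.1 ≤ b.1.1 ∧ b.1.2 < c.1.2} = {c | c.1.1 < b.1.1 ∧ b.1.2 < c.1.2} := by
  ext c
  refine ⟨fun hc => ⟨hc.1.lt_of_ne fun h => hb (T.exists_next h hc.2), hc.2⟩,
    fun hc => ⟨hc.1.le, hc.2⟩⟩

theorem exists_above {b c : T.Box} (hc : c.1.2 = b.1.2) (hcb : c.1.1 < b.1.1) :
    ∃ a, T.Below a b := by
  classical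
  obtain ⟨m, hm, hmax⟩ := Finset.exists_max_image
    (Finset.univ.filter fun c : T.Box => c.1.2 = b.1.2 ∧ c.1.1 < b.1.1) (fun c => c.1.1)
    ⟨c, by simp [hc, hcb]⟩
  simp only [Finset.mem_filter, Finset.mem_univ, true_and] at hm hmax
  refine ⟨m, hm.1.symm, hm.2, fun d hd hmd => ?_⟩
  by_contra h
  exact (hmax d ⟨hd.trans hm.1, not_le.1 h⟩).not_gt hmd

theorem region_column_of_not_above {b : T.Box} (hb : ¬ ∃ a, T.Below a b) :
    {c : T.Box | c.1.1 < b.1.1 ∧ b.1.2 ≤ c.1.2} = {c | c.1.1 < b.1.1 ∧ b.1.2 < c.1.2} := by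
  ext c
  refine ⟨fun hc => ⟨hc.1, hc.2.lt_of_ne fun h => hb (exists_above h.symm hc.1)⟩,
    fun hc => ⟨hc.1, hc.2.le⟩⟩

theorem region_row_of_isolated {r : Fin k} (hr : ¬ T.RowNonempty r) :
    {c : T.Box | c.1.1 ≤ r ∧ T.pivot r < c.1.2} = {c | c.1.1 < r ∧ T.pivot r < c.1.2} := by
  ext c
  refine ⟨fun hc => ⟨hc.1.lt_of_ne fun h => hr (h ▸ ⟨_, c.2⟩), hc.2⟩, fun hc => ⟨hc.1.le, hc.2⟩⟩

/-- The side conditions on ⊤ matter on a black component without an edge from above, where ∞ is not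
a node. -/
theorem region_congr {c : T.Component} {P Q : WithTop ℝ → Prop}
    (h : ∀ p, T.IsNode κ (c, p) → (P p ↔ Q p)) (hP : P ⊤ → P (1 : ℝ)) (hQ : Q ⊤ → Q (1 : ℝ)) :
    T.region κ P c = T.region κ Q c := by
  classical
  rcases c with _ | (r | b) | b
  · ext c
    simp only [region, Set.mem_ofPred_eq, h _ (isNode_base_pivot _), h _ (isNode_base_column c)]
  · have h1 : P (1 : ℝ) ↔ Q (1 : ℝ) := h _ (isNode_source_iff.2 (.inl rfl))
    by_cases hr : T.RowNonempty r
    · have h0 : P (0 : ℝ) ↔ Q (0 : ℝ) := h _ (isNode_source_iff.2 (.inr ⟨hr, rfl⟩))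
      simp only [region]
      exact if_congr (and_congr (not_congr h1) h0) rfl rfl
    · simp only [region, region_row_of_isolated hr, ite_self]
  · have ht : P ⊤ ↔ Q ⊤ := h _ (isNode_whiteBox_iff.2 (.inl rfl))
    have h1 : P (1 : ℝ) ↔ Q (1 : ℝ) := h _ (isNode_whiteBox_iff.2 (.inr (.inl rfl)))
    by_cases hr : T.HasLeft (.inr b)
    · have h0 : P (0 : ℝ) ↔ Q (0 : ℝ) := h _ (isNode_whiteBox_iff.2 (.inr (.inr ⟨hr, rfl⟩)))
      simp only [region]
      exact if_congr ht rfl (if_congr h1 rfl (if_congr h0 rfl rfl))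
    · simp only [region, region_row_of_not_hasLeft hr, ite_self]
      exact if_congr ht rfl (if_congr h1 rfl rfl)
  · have h0 : P (0 : ℝ) ↔ Q (0 : ℝ) := h _ (isNode_black_iff.2 (.inl (.inl rfl)))
    have h1 : P (1 : ℝ) ↔ Q (1 : ℝ) := h _ (isNode_black_iff.2 (.inl (.inr rfl)))
    by_cases hr : ∃ a, T.Below a b
    · have ht : P ⊤ ↔ Q ⊤ := h _ (isNode_black_iff.2 (.inr ⟨hr, rfl⟩))
      simp only [region]
      exact if_congr ht rfl (if_congr h1 rfl (if_congr h0 rfl rfl))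
    · simp only [region, region_column_of_not_above hr, h0, h1]
      by_cases h2 : P (1 : ℝ)
      · simp only [h1.1 h2, if_true, ite_self]
      · simp only [mt hP h2, mt h1.2 h2, mt hQ (mt h1.2 h2), if_false]

theorem region_wrap {c : T.Component} {P Q : WithTop ℝ → Prop}
    (h : ∀ p, T.IsNode κ (c, p) → P p ∧ ¬ Q p) (hQ : Q ⊤ → Q (1 : ℝ)) :
    T.region κ P c = T.region κ Q c := by
  rcases c with _ | (r | b) | b
  · ext c
    simp only [region, Set.mem_ofPred_eq, h _ (isNode_base_pivot _), h _ (isNode_base_column c)]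
    simp
  · have h1 : P (1 : ℝ) ∧ ¬ Q (1 : ℝ) := h _ (isNode_source_iff.2 (.inl rfl))
    by_cases hr : T.RowNonempty r
    · have h0 : P (0 : ℝ) ∧ ¬ Q (0 : ℝ) := h _ (isNode_source_iff.2 (.inr ⟨hr, rfl⟩))
      simp only [region, h1, h0, not_true_eq_false, false_and, and_false, if_false]
    · simp only [region, region_row_of_isolated hr, ite_self]
  · have ht : P ⊤ ∧ ¬ Q ⊤ := h _ (isNode_whiteBox_iff.2 (.inl rfl))
    have h1 : P (1 : ℝ) ∧ ¬ Q (1 : ℝ) := h _ (isNode_whiteBox_iff.2 (.inr (.inl rfl)))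
    by_cases hr : T.HasLeft (.inr b)
    · have h0 : P (0 : ℝ) ∧ ¬ Q (0 : ℝ) := h _ (isNode_whiteBox_iff.2 (.inr (.inr ⟨hr, rfl⟩)))
      simp only [region, h1, h0, ht, if_true, if_false]
    · simp only [region, region_row_of_not_hasLeft hr, ite_self, h1, ht, if_true, if_false]
  · have h0 : P (0 : ℝ) ∧ ¬ Q (0 : ℝ) := h _ (isNode_black_iff.2 (.inl (.inl rfl)))
    have h1 : P (1 : ℝ) ∧ ¬ Q (1 : ℝ) := h _ (isNode_black_iff.2 (.inl (.inr rfl)))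
    have h2 : ¬ Q ⊤ := fun h3 => h1.2 (hQ h3)
    by_cases hr : ∃ a, T.Below a b
    · have ht : P ⊤ ∧ ¬ Q ⊤ := h _ (isNode_black_iff.2 (.inr ⟨hr, rfl⟩))
      simp only [region, h1, h0, ht, if_true, if_false]
    · simp only [region, region_column_of_not_above hr, h0, h1, h2, if_true, if_false, ite_self]

/-- The set of the boxes above and to the left of the oval through a smooth real point. -/
def regionAt (T : LeTableau k n) (κ : Fin n → ℝ) (x : T.RealPoint) : Set T.Box :=
  T.region κ (· < x.2) x.1

theorem FreeArc.regionAt_eq {c : T.Component} {x y : WithTop ℝ} (h : T.FreeArc κ c x y)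
    (hx : ¬ T.IsNode κ (c, x)) : T.regionAt κ (c, x) = T.regionAt κ (c, y) := by
  rcases h.lt_iff hx with h1 | h1
  · exact region_congr h1 (fun h => absurd h not_top_lt) (fun h => absurd h not_top_lt)
  · exact region_wrap h1 (fun h => absurd h not_top_lt)

theorem FreeArc.regionAt_eq_of_le {c : T.Component} {x y : WithTop ℝ} (h : T.FreeArc κ c x y)
    (hy : ¬ T.IsNode κ (c, y)) : T.region κ (· ≤ x) c = T.regionAt κ (c, y) := by
  rcases h.le_iff hy with h1 | h1
  · exact region_congr h1 (fun h => le_top.trans h) (fun h => absurd h not_top_lt)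
  · exact region_wrap h1 (fun h => absurd h not_top_lt)

/-- Here the Le-rule is used. A box lying in one of the two regions only would, together with a box
at the end of the edge, force a filled box strictly between two neighbours of a row or column, or
beyond the first or last one. Each edge borders two faces, whence the two equalities. -/
theorem region_glued (hκ : StrictMono κ) {x y : T.RealPoint} (h : T.Glued κ x y) :
    T.regionAt κ x = T.region κ (· ≤ y.2) y.1 ∧ T.regionAt κ y = T.region κ (· ≤ x.2) x.1 := by
  have h10 : ¬ ((1 : ℝ) : WithTop ℝ) ≤ ((0 : ℝ) : WithTop ℝ) := by
    rw [WithTop.coe_le_coe]; norm_num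
  have h01 : ((0 : ℝ) : WithTop ℝ) ≤ ((1 : ℝ) : WithTop ℝ) := by
    rw [WithTop.coe_le_coe]; norm_num
  have h01' : ((0 : ℝ) : WithTop ℝ) < ((1 : ℝ) : WithTop ℝ) := by
    rw [WithTop.coe_lt_coe]; norm_num
  have h10' : ¬ ((1 : ℝ) : WithTop ℝ) < ((0 : ℝ) : WithTop ℝ) := h01.not_gt
  have ht : ∀ a : ℝ, ¬ (⊤ : WithTop ℝ) ≤ (a : WithTop ℝ) := fun a => by simp
  have ht' : ∀ a : ℝ, (a : WithTop ℝ) < ⊤ := fun a => WithTop.coe_lt_top a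
  cases h with
  | source r =>
    constructor
    · ext c
      simp only [regionAt, region, lt_irrefl, not_false_eq_true, h01', and_self, if_true,
        Set.mem_ofPred_eq, WithTop.coe_le_coe, hκ.le_iff_le, T.pivot_strictMono.le_iff_le, not_le]
    · ext c
      simp only [regionAt, region, le_refl, not_true_eq_false, false_and, if_false,
        Set.mem_ofPred_eq, WithTop.coe_lt_coe, hκ.lt_iff_lt, T.pivot_strictMono.lt_iff_lt, not_lt]
      exact and_congr_right fun _ => ⟨fun h => h.lt_of_ne (T.not_pivot c r), le_of_lt⟩
  | first r b hb =>
    obtain ⟨rfl, hb2⟩ := hb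
    have key : ∀ c : T.Box, c.1.1 ≤ b.1.1 → (T.pivot b.1.1 < c.1.2 ↔ b.1.2 ≤ c.1.2) := by
      intro c hc
      refine ⟨fun h => ?_, fun h => (T.pivot_lt b).trans_le h⟩
      rcases hc.eq_or_lt with h1 | h1
      · exact hb2 c h1
      · by_contra h2
        exact h2 (hb2 ⟨(b.1.1, c.1.2), T.le_rule _ _ _ _ h1 (not_le.1 h2) h c.2 b.2⟩ rfl)
    constructor
    · ext c
      simp only [regionAt, region, lt_irrefl, and_false, if_false, ht, le_refl, if_true,
        Set.mem_ofPred_eq]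
      exact and_congr_right fun h => key c h.le
    · ext c
      simp only [regionAt, region, not_top_lt, lt_irrefl, if_false, h01', h10, le_refl,
        not_false_eq_true, and_self, if_true, Set.mem_ofPred_eq]
      exact and_congr_right fun h => (key c h).symm
  | next b b' hb =>
    obtain ⟨hb0, hb1, hb2⟩ := hb
    have key : ∀ c : T.Box, c.1.1 ≤ b.1.1 → (b.1.2 < c.1.2 ↔ b'.1.2 ≤ c.1.2) := by
      intro c hc
      refine ⟨fun h => ?_, fun h => hb1.trans_le h⟩
      rcases hc.eq_or_lt with h1 | h1
      · exact hb2 c h1 h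
      · by_contra h2
        refine h2 (hb2 ⟨(b.1.1, c.1.2), T.le_rule _ _ _ _ h1 (not_le.1 h2)
          ((T.pivot_lt b).trans h) c.2 ?_⟩ rfl h)
        rw [← hb0]; exact b'.2
    constructor
    · ext c
      simp only [regionAt, region, not_top_lt, lt_irrefl, if_false, ht, le_refl, if_true,
        Set.mem_ofPred_eq, h10', hb0]
      exact and_congr_right fun h => key c h.le
    · ext c
      simp only [regionAt, region, not_top_lt, lt_irrefl, if_false, h01', h10, le_refl, ht,
        if_true, Set.mem_ofPred_eq, hb0]
      exact and_congr_right fun h => (key c h).symm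
  | box b =>
    constructor
    · ext c
      simp only [regionAt, region, not_top_lt, if_false, ht, ht', le_refl, if_true, h10]
    · ext c
      simp only [regionAt, region, not_top_lt, if_false, le_refl, if_true, h10', lt_irrefl]
  | down b b' hb =>
    obtain ⟨hb0, hb1, hb2⟩ := hb
    have key : ∀ c : T.Box, b.1.2 ≤ c.1.2 → (c.1.1 ≤ b.1.1 ↔ c.1.1 < b'.1.1) := by
      intro c hc
      refine ⟨fun h => h.trans_lt hb1, fun h => ?_⟩
      by_contra h1
      rcases hc.eq_or_lt with h2 | h2
      · exact (hb2 c h2.symm (not_le.1 h1)).not_gt h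
      · refine (hb2 ⟨(c.1.1, b.1.2), T.le_rule _ _ _ _ (not_le.1 h1) h2 ?_ b.2 c.2⟩ rfl
          (not_le.1 h1)).not_gt h
        rw [← hb0]
        exact (T.pivot_strictMono h).trans (T.pivot_lt b')
    constructor
    · ext c
      simp only [regionAt, region, not_top_lt, lt_irrefl, if_false, h01', le_refl, if_true,
        Set.mem_ofPred_eq, hb0]
      exact and_congr_left fun h => key c h.le
    · ext c
      simp only [regionAt, region, not_top_lt, if_false, ht, ht', le_refl,
        if_true, Set.mem_ofPred_eq, hb0]
      exact and_congr_left fun h => (key c h).symm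
  | sink b hb =>
    have key : ∀ c : T.Box, b.1.2 ≤ c.1.2 → (c.1.1 ≤ b.1.1 ↔ T.pivot c.1.1 < b.1.2) := by
      intro c hc
      refine ⟨fun h => (T.pivot_strictMono.monotone h).trans_lt (T.pivot_lt b), fun h => ?_⟩
      by_contra h1
      rcases hc.eq_or_lt with h2 | h2
      · exact h1 (hb c h2.symm)
      · exact h1 (hb ⟨(c.1.1, b.1.2), T.le_rule _ _ _ _ (not_le.1 h1) h2 h b.2 c.2⟩ rfl)
    constructor
    · ext c
      simp only [regionAt, region, not_top_lt, lt_irrefl, if_false, h01', if_true,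
        Set.mem_ofPred_eq, WithTop.coe_le_coe, hκ.le_iff_le, not_le]
      refine and_congr_left fun h => (key c h.le).trans ⟨le_of_lt, fun h => h.lt_of_ne ?_⟩
      exact T.not_pivot b _
    · ext c
      simp only [regionAt, region, if_false, ht, le_refl, not_lt,
        if_true, Set.mem_ofPred_eq, WithTop.coe_lt_coe, hκ.lt_iff_lt]
      exact and_congr_left fun h => (key c h).symm

theorem OvalStep.regionAt_eq (hκ : StrictMono κ) {x y : T.RealPoint} (h : T.OvalStep κ x y) :
    T.regionAt κ x = T.regionAt κ y := by
  cases h with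
  | arc c x y hx hy h => exact h.regionAt_eq hx
  | cross c c' x p q y hx hy hg hxp hqy =>
    rw [hxp.regionAt_eq hx, ← hqy.regionAt_eq_of_le hy]
    rcases hg with hg | hg
    · exact (region_glued hκ hg).1
    · exact (region_glued hκ hg).2

theorem SameOval.regionAt_eq (hκ : StrictMono κ) {x y : T.RealPoint} (h : T.SameOval κ x y) :
    T.regionAt κ x = T.regionAt κ y := by
  induction h with
  | rel x y h => exact h.regionAt_eq hκ
  | refl x => rfl
  | symm x y _ ih => exact ih.symm
  | trans x y z _ _ ih1 ih2 => exact ih1.trans ih2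

end LeTableau

namespace LeTableau

variable {k n : ℕ} {T : LeTableau k n} {κ : Fin n → ℝ}

/-! ### Every oval passes through the lower right corner of a box, or through `P₀` -/

/-- A real point on the oval whose lower right corner is at the box `b`. -/
def cornerPoint (b : T.Box) : T.RealPoint := (.white (.inr b), ((2 : ℝ) : WithTop ℝ))

/-- The real point lies on the infinite oval, or on the oval with its corner at a box. -/
def Cornered (T : LeTableau k n) (κ : Fin n → ℝ) (x : T.RealPoint) : Prop :=
  T.SameOval κ x (.base, ⊤) ∨ ∃ b, T.SameOval κ x (cornerPoint b)

theorem SameOval.cornered {x y : T.RealPoint} (h : T.SameOval κ x y) (hy : T.Cornered κ y) :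
    T.Cornered κ x := by
  rcases hy with hy | ⟨b, hy⟩
  · exact .inl (.trans _ _ _ h hy)
  · exact .inr ⟨b, .trans _ _ _ h hy⟩

theorem sameOval_of_lt_iff {c : T.Component} {x y : WithTop ℝ} (hx : ¬ T.IsNode κ (c, x))
    (hy : ¬ T.IsNode κ (c, y)) (h : ∀ p, T.IsNode κ (c, p) → (p < x ↔ p < y)) :
    T.SameOval κ (c, x) (c, y) := by
  rcases le_total x y with hxy | hxy
  · exact .rel _ _ (.arc c x y hx hy (freeArc_of_lt_iff hxy fun p hp hpy => ((h p hp).2 hpy).le))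
  · exact .symm _ _
      (.rel _ _ (.arc c y x hy hx (freeArc_of_lt_iff hxy fun p hp hpy => ((h p hp).1 hpy).le)))

theorem sameOval_of_wrap {c : T.Component} {x y : WithTop ℝ} (hx : ¬ T.IsNode κ (c, x))
    (hy : ¬ T.IsNode κ (c, y)) (h : ∀ p, T.IsNode κ (c, p) → p ≤ x ∧ y ≤ p) :
    T.SameOval κ (c, x) (c, y) :=
  .rel _ _ (.arc c x y hx hy (freeArc_of_wrap h))

theorem sameOval_of_glued {c c' : T.Component} {x p q y : WithTop ℝ}
    (hx : ¬ T.IsNode κ (c, x)) (hy : ¬ T.IsNode κ (c', y))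
    (hg : T.Glued κ (c, p) (c', q) ∨ T.Glued κ (c', q) (c, p))
    (hxp : T.FreeArc κ c x p) (hqy : T.FreeArc κ c' q y) : T.SameOval κ (c, x) (c', y) :=
  .rel _ _ (.cross c c' x p q y hx hy hg hxp hqy)

theorem one_lt_two_withTop : ((1 : ℝ) : WithTop ℝ) < ((2 : ℝ) : WithTop ℝ) := by
  rw [WithTop.coe_lt_coe]; norm_num

theorem zero_lt_one_withTop : ((0 : ℝ) : WithTop ℝ) < ((1 : ℝ) : WithTop ℝ) := by
  rw [WithTop.coe_lt_coe]; norm_num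

theorem not_isNode_white_two (v : T.White) : ¬ T.IsNode κ (.white v, ((2 : ℝ) : WithTop ℝ)) := by
  rcases v with r | b
  · rw [isNode_source_iff, WithTop.coe_inj, WithTop.coe_inj]; norm_num
  · rw [isNode_whiteBox_iff, WithTop.coe_inj, WithTop.coe_inj]; norm_num

theorem not_isNode_black_two (b : T.Box) : ¬ T.IsNode κ (.black b, ((2 : ℝ) : WithTop ℝ)) := by
  rw [isNode_black_iff, WithTop.coe_inj, WithTop.coe_inj]; norm_num

theorem not_isNode_black_half (b : T.Box) : ¬ T.IsNode κ (.black b, ((2⁻¹ : ℝ) : WithTop ℝ)) := by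
  rw [isNode_black_iff, WithTop.coe_inj, WithTop.coe_inj]; norm_num

theorem not_isNode_black_neg (b : T.Box) : ¬ T.IsNode κ (.black b, ((-1 : ℝ) : WithTop ℝ)) := by
  rw [isNode_black_iff, WithTop.coe_inj, WithTop.coe_inj]; norm_num

theorem not_isNode_whiteBox_neg (b : T.Box) :
    ¬ T.IsNode κ (.white (.inr b), ((-1 : ℝ) : WithTop ℝ)) := by
  rw [isNode_whiteBox_iff, WithTop.coe_inj, WithTop.coe_inj]; norm_num

theorem not_isNode_base_top : ¬ T.IsNode κ (.base, ⊤) := by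
  rw [isNode_base_iff]; simp

theorem half_lt_one_withTop : ((2⁻¹ : ℝ) : WithTop ℝ) < ((1 : ℝ) : WithTop ℝ) := by
  rw [WithTop.coe_lt_coe]; norm_num

theorem zero_lt_half_withTop : ((0 : ℝ) : WithTop ℝ) < ((2⁻¹ : ℝ) : WithTop ℝ) := by
  rw [WithTop.coe_lt_coe]; norm_num

theorem neg_lt_zero_withTop : ((-1 : ℝ) : WithTop ℝ) < ((0 : ℝ) : WithTop ℝ) := by
  rw [WithTop.coe_lt_coe]; norm_num

theorem cornered_white_lower {b : T.Box} {x : WithTop ℝ} (hx : ¬ T.IsNode κ (.white (.inr b), x))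
    (h1 : ((1 : ℝ) : WithTop ℝ) < x) : T.Cornered κ (.white (.inr b), x) := by
  refine .inr ⟨b, sameOval_of_lt_iff hx (not_isNode_white_two _) fun p hp => ?_⟩
  rcases isNode_whiteBox_iff.1 hp with rfl | rfl | ⟨-, rfl⟩
  · simp
  · exact iff_of_true h1 one_lt_two_withTop
  · exact iff_of_true (zero_lt_one_withTop.trans h1) (zero_lt_one_withTop.trans one_lt_two_withTop)

theorem cornered_black_lower {b : T.Box} {x : WithTop ℝ} (hx : ¬ T.IsNode κ (.black b, x))
    (h0 : ((0 : ℝ) : WithTop ℝ) < x) (h1 : x < ((1 : ℝ) : WithTop ℝ)) :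
    T.Cornered κ (.black b, x) := by
  refine .inr ⟨b, .symm _ _ (sameOval_of_glued (not_isNode_white_two _) hx (.inl (.box b)) ?_ ?_)⟩
  · refine freeArc_of_lt_iff le_top fun p hp hpt => ?_
    rcases isNode_whiteBox_iff.1 hp with rfl | rfl | ⟨-, rfl⟩
    · exact absurd hpt (lt_irrefl _)
    · exact one_lt_two_withTop.le
    · exact (zero_lt_one_withTop.trans one_lt_two_withTop).le
  · refine freeArc_of_lt_iff h0.le fun p hp hpx => ?_
    rcases isNode_black_iff.1 hp with (rfl | rfl) | ⟨-, rfl⟩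
    · exact le_rfl
    · exact absurd hpx h1.not_gt
    · exact absurd hpx not_top_lt

/-- The arc of a white vertex between `0` and `1`, when there is a filled box to the left. -/
theorem cornered_white_middle {b : T.Box} {x : WithTop ℝ} (hb : T.HasLeft (.inr b))
    (hx : ¬ T.IsNode κ (.white (.inr b), x))
    (h0 : ((0 : ℝ) : WithTop ℝ) < x) (h1 : x < ((1 : ℝ) : WithTop ℝ)) :
    T.Cornered κ (.white (.inr b), x) := by
  obtain ⟨b', hb'⟩ := hb
  refine SameOval.cornered (.symm _ _ (sameOval_of_glued (not_isNode_black_half b') hx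
    (.inr (.next b b' hb')) ?_ ?_)) (cornered_black_lower (not_isNode_black_half b')
    zero_lt_half_withTop half_lt_one_withTop)
  · refine freeArc_of_lt_iff half_lt_one_withTop.le fun p hp hpt => ?_
    rcases isNode_black_iff.1 hp with (rfl | rfl) | ⟨-, rfl⟩
    · exact zero_lt_half_withTop.le
    · exact absurd hpt (lt_irrefl _)
    · exact absurd hpt not_top_lt
  · refine freeArc_of_lt_iff h0.le fun p hp hpx => ?_
    rcases isNode_whiteBox_iff.1 hp with rfl | rfl | ⟨-, rfl⟩
    · exact absurd hpx not_top_lt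
    · exact absurd hpx h1.not_gt
    · exact le_rfl

theorem cornered_source_middle {r : Fin k} {x : WithTop ℝ} (hr : T.RowNonempty r)
    (hx : ¬ T.IsNode κ (.white (.inl r), x))
    (h0 : ((0 : ℝ) : WithTop ℝ) < x) (h1 : x < ((1 : ℝ) : WithTop ℝ)) :
    T.Cornered κ (.white (.inl r), x) := by
  obtain ⟨b', hb'⟩ := T.exists_first hr
  refine SameOval.cornered (.symm _ _ (sameOval_of_glued (not_isNode_black_half b') hx
    (.inr (.first r b' hb')) ?_ ?_)) (cornered_black_lower (not_isNode_black_half b')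
    zero_lt_half_withTop half_lt_one_withTop)
  · refine freeArc_of_lt_iff half_lt_one_withTop.le fun p hp hpt => ?_
    rcases isNode_black_iff.1 hp with (rfl | rfl) | ⟨-, rfl⟩
    · exact zero_lt_half_withTop.le
    · exact absurd hpt (lt_irrefl _)
    · exact absurd hpt not_top_lt
  · refine freeArc_of_lt_iff h0.le fun p hp hpx => ?_
    rcases isNode_source_iff.1 hp with rfl | ⟨-, rfl⟩
    · exact absurd hpx h1.not_gt
    · exact le_rfl

/-- The oval above and to the left of a box is cornered. -/
def UpperCornered (T : LeTableau k n) (κ : Fin n → ℝ) (b : T.Box) : Prop :=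
  T.Cornered κ (.white (.inr b), ((-1 : ℝ) : WithTop ℝ))

theorem UpperCornered.white {b : T.Box} (hb : T.UpperCornered κ b) {x : WithTop ℝ}
    (hx : ¬ T.IsNode κ (.white (.inr b), x)) (h0 : x ≤ ((0 : ℝ) : WithTop ℝ)) :
    T.Cornered κ (.white (.inr b), x) := by
  refine SameOval.cornered (sameOval_of_lt_iff hx (not_isNode_whiteBox_neg _) fun p hp => ?_) hb
  have hp0 : ((0 : ℝ) : WithTop ℝ) ≤ p := by
    rcases isNode_whiteBox_iff.1 hp with rfl | rfl | ⟨-, rfl⟩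
    · exact le_top
    · exact zero_lt_one_withTop.le
    · exact le_rfl
  exact iff_of_false (h0.trans hp0).not_gt (neg_lt_zero_withTop.le.trans hp0).not_gt

theorem UpperCornered.white_of_not_hasLeft {b : T.Box} (hb : T.UpperCornered κ b)
    (hl : ¬ T.HasLeft (.inr b)) {x : WithTop ℝ} (hx : ¬ T.IsNode κ (.white (.inr b), x))
    (h1 : x ≤ ((1 : ℝ) : WithTop ℝ)) : T.Cornered κ (.white (.inr b), x) := by
  refine SameOval.cornered (sameOval_of_lt_iff hx (not_isNode_whiteBox_neg _) fun p hp => ?_) hb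
  have hp0 : ((1 : ℝ) : WithTop ℝ) ≤ p := by
    rcases isNode_whiteBox_iff.1 hp with rfl | rfl | ⟨h, rfl⟩
    · exact le_top
    · exact le_rfl
    · exact absurd h hl
  exact iff_of_false (h1.trans hp0).not_gt
    (neg_lt_zero_withTop.le.trans (zero_lt_one_withTop.le.trans hp0)).not_gt

theorem UpperCornered.black {b : T.Box} (hb : T.UpperCornered κ b) {x : WithTop ℝ}
    (hx : ¬ T.IsNode κ (.black b, x)) (h0 : x ≤ ((0 : ℝ) : WithTop ℝ)) :
    T.Cornered κ (.black b, x) := by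
  refine SameOval.cornered (sameOval_of_glued hx (not_isNode_whiteBox_neg b) (.inr (.box b)) ?_ ?_) hb
  · refine freeArc_of_lt_iff h0 fun p hp hp0 => ?_
    rcases isNode_black_iff.1 hp with (rfl | rfl) | ⟨-, rfl⟩
    · exact absurd hp0 (lt_irrefl _)
    · exact absurd hp0 zero_lt_one_withTop.not_gt
    · exact absurd hp0 not_top_lt
  · refine freeArc_of_wrap fun p hp => ⟨le_top, ?_⟩
    rcases isNode_whiteBox_iff.1 hp with rfl | rfl | ⟨-, rfl⟩
    · exact le_top
    · exact (neg_lt_zero_withTop.trans zero_lt_one_withTop).le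
    · exact neg_lt_zero_withTop.le

/-- If there is a box above, crossing the vertical edge leads to the lower right arc of that box.
Otherwise ∞ is not a node and the arc runs on into the upper left one. -/
theorem UpperCornered.black_upper {b : T.Box} (hb : T.UpperCornered κ b) {x : WithTop ℝ}
    (hx : ¬ T.IsNode κ (.black b, x)) (h1 : ((1 : ℝ) : WithTop ℝ) < x) :
    T.Cornered κ (.black b, x) := by
  by_cases ha : ∃ a, T.Below a b
  · obtain ⟨a, ha⟩ := ha
    refine .inr ⟨a, sameOval_of_glued hx (not_isNode_white_two _) (.inr (.down a b ha)) ?_ ?_⟩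
    · refine freeArc_of_lt_iff le_top fun p hp hpt => ?_
      rcases isNode_black_iff.1 hp with (rfl | rfl) | ⟨-, rfl⟩
      · exact (zero_lt_one_withTop.trans h1).le
      · exact h1.le
      · exact absurd hpt (lt_irrefl _)
    · refine freeArc_of_lt_iff one_lt_two_withTop.le fun p hp hpt => ?_
      rcases isNode_whiteBox_iff.1 hp with rfl | rfl | ⟨-, rfl⟩
      · exact absurd hpt not_top_lt
      · exact le_rfl
      · exact zero_lt_one_withTop.le
  · refine SameOval.cornered (sameOval_of_wrap hx (not_isNode_black_neg b) fun p hp => ?_)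
      (hb.black (not_isNode_black_neg b) neg_lt_zero_withTop.le)
    rcases isNode_black_iff.1 hp with (rfl | rfl) | ⟨h, rfl⟩
    · exact ⟨(zero_lt_one_withTop.trans h1).le, neg_lt_zero_withTop.le⟩
    · exact ⟨h1.le, (neg_lt_zero_withTop.trans zero_lt_one_withTop).le⟩
    · exact absurd h ha

theorem exists_real_after (hκ : StrictMono κ) (j : Fin n) :
    ∃ y : ℝ, κ j < y ∧ ∀ i, κ i ≤ κ j ∨ y < κ i := by
  by_cases hj : (j : ℕ) + 1 < n
  · have h1 : κ j < κ ⟨j + 1, hj⟩ := hκ (Fin.lt_def.2 (Nat.lt_succ_self _))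
    refine ⟨(κ j + κ ⟨j + 1, hj⟩) / 2, by linarith, fun i => ?_⟩
    rcases le_or_gt i j with hi | hi
    · exact .inl (hκ.monotone hi)
    · right
      have : κ ⟨j + 1, hj⟩ ≤ κ i := hκ.monotone (Fin.le_def.2 (Nat.succ_le_of_lt hi))
      linarith
  · refine ⟨κ j + 1, by linarith, fun i => .inl (hκ.monotone (Fin.le_def.2 ?_))⟩
    have := i.isLt
    omega

theorem exists_eq_of_isNode_base {p : WithTop ℝ} (h : T.IsNode κ (.base, p)) :
    ∃ i, p = (κ i : ℝ) := by
  rcases isNode_base_iff.1 h with ⟨r, rfl⟩ | ⟨b, -, rfl⟩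
  · exact ⟨_, rfl⟩
  · exact ⟨_, rfl⟩

/-- There is a smooth real point of `Γ₀` right after each `κ j`. -/
theorem exists_base_after (hκ : StrictMono κ) (j : Fin n) : ∃ y : WithTop ℝ,
    ¬ T.IsNode κ (.base, y) ∧ ((κ j : ℝ) : WithTop ℝ) < y ∧ T.FreeArc κ .base (κ j : ℝ) y := by
  obtain ⟨y, hy, hy'⟩ := exists_real_after hκ j
  refine ⟨y, fun h => ?_, WithTop.coe_lt_coe.2 hy, freeArc_of_lt_iff (WithTop.coe_le_coe.2 hy.le) ?_⟩
  · obtain ⟨i, hi⟩ := exists_eq_of_isNode_base h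
    have := WithTop.coe_inj.1 hi
    rcases hy' i with h1 | h1 <;> linarith
  · intro p hp hpy
    obtain ⟨i, rfl⟩ := exists_eq_of_isNode_base hp
    rw [WithTop.coe_le_coe]
    exact (hy' i).resolve_right (WithTop.coe_lt_coe.1 hpy).not_gt

/-- The walk leaves the source component through the node 0 to the upper arc at the first box. If
the row is isolated, the only node is 1 and the walk returns to Γ₀ just after the pivot. -/
theorem cornered_source_upper (hκ : StrictMono κ) {r : Fin k}
    (hb : ∀ b : T.Box, T.pivot r < b.1.2 → T.UpperCornered κ b)
    (hbase : ∀ y, ¬ T.IsNode κ (.base, y) → ((κ (T.pivot r) : ℝ) : WithTop ℝ) < y →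
      T.Cornered κ (.base, y))
    {x : WithTop ℝ} (hx : ¬ T.IsNode κ (.white (.inl r), x))
    (h : T.RowNonempty r → x ≤ ((0 : ℝ) : WithTop ℝ) ∨ ((1 : ℝ) : WithTop ℝ) < x) :
    T.Cornered κ (.white (.inl r), x) := by
  by_cases hr : T.RowNonempty r
  · obtain ⟨b, hfb⟩ := T.exists_first hr
    have hpb : T.pivot r < b.1.2 := hfb.1 ▸ T.pivot_lt b
    refine SameOval.cornered (sameOval_of_glued hx (not_isNode_black_two b) (.inl (.first r b hfb)) ?_ ?_)
      ((hb b hpb).black_upper (not_isNode_black_two b) one_lt_two_withTop)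
    · rcases h hr with h0 | h1
      · refine freeArc_of_lt_iff h0 fun p hp hp0 => ?_
        rcases isNode_source_iff.1 hp with rfl | ⟨-, rfl⟩
        · exact absurd hp0 zero_lt_one_withTop.not_gt
        · exact absurd hp0 (lt_irrefl _)
      · refine freeArc_of_wrap fun p hp => ?_
        rcases isNode_source_iff.1 hp with rfl | ⟨-, rfl⟩
        · exact ⟨h1.le, zero_lt_one_withTop.le⟩
        · exact ⟨(zero_lt_one_withTop.trans h1).le, le_rfl⟩
    · refine freeArc_of_lt_iff one_lt_two_withTop.le fun p hp hpt => ?_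
      rcases isNode_black_iff.1 hp with (rfl | rfl) | ⟨-, rfl⟩
      · exact zero_lt_one_withTop.le
      · exact le_rfl
      · exact absurd hpt not_top_lt
  · obtain ⟨y, hy, hy1, hy2⟩ := T.exists_base_after hκ (T.pivot r)
    refine SameOval.cornered (sameOval_of_glued hx hy (.inl (.source r)) ?_ hy2) (hbase y hy hy1)
    have hp1 : ∀ p, T.IsNode κ (.white (.inl r), p) → p = ((1 : ℝ) : WithTop ℝ) := fun p hp =>
      (isNode_source_iff.1 hp).resolve_right fun h => hr h.1
    rcases le_or_gt x ((1 : ℝ) : WithTop ℝ) with h1 | h1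
    · exact freeArc_of_lt_iff h1 fun p hp hp1' => absurd hp1' (hp1 p hp).not_lt
    · exact freeArc_of_wrap fun p hp => by rw [hp1 p hp]; exact ⟨h1.le, le_rfl⟩

/-- Walk from x to the next node of Γ₀. At a sink one arrives at the lower right arc of the bottom
box, at a source on the upper side of its row; if there is no further node, the arc contains P₀. -/
theorem cornered_base (hκ : StrictMono κ) {x : WithTop ℝ} (hx : ¬ T.IsNode κ (.base, x))
    (hb : ∀ b : T.Box, x < ((κ b.1.2 : ℝ) : WithTop ℝ) → T.UpperCornered κ b)
    (hbase : ∀ j y, x < ((κ j : ℝ) : WithTop ℝ) → ¬ T.IsNode κ (.base, y) →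
      ((κ j : ℝ) : WithTop ℝ) < y → T.Cornered κ (.base, y)) : T.Cornered κ (.base, x) := by
  classical
  by_cases hne : ∃ j, T.IsNode κ (.base, ((κ j : ℝ) : WithTop ℝ)) ∧ x < ((κ j : ℝ) : WithTop ℝ)
  · obtain ⟨j, hj, hmin⟩ := Finset.exists_min_image (Finset.univ.filter fun j =>
      T.IsNode κ (.base, ((κ j : ℝ) : WithTop ℝ)) ∧ x < ((κ j : ℝ) : WithTop ℝ)) id
      (by obtain ⟨j, hj⟩ := hne; exact ⟨j, by simpa using hj⟩)
    simp only [Finset.mem_filter, Finset.mem_univ, true_and, id] at hj hmin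
    obtain ⟨hj, hxj⟩ := hj
    have harc : T.FreeArc κ .base x ((κ j : ℝ) : WithTop ℝ) := by
      refine freeArc_of_lt_iff hxj.le fun p hp hpj => ?_
      obtain ⟨i, rfl⟩ := exists_eq_of_isNode_base hp
      by_contra hi
      have h1 := hmin i ⟨hp, not_le.1 hi⟩
      exact (hκ.monotone h1).not_gt (WithTop.coe_lt_coe.1 hpj)
    rcases isNode_base_iff.1 hj with ⟨r, hr⟩ | ⟨b, hbot, hr⟩
    · have hjr := hκ.injective (WithTop.coe_inj.1 hr)
      subst hjr
      refine SameOval.cornered (sameOval_of_glued hx (not_isNode_white_two _) (.inr (.source r)) harc ?_)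
        (cornered_source_upper hκ (fun b hb' => hb b (hxj.trans (WithTop.coe_lt_coe.2 (hκ hb'))))
          (fun y hy hyr => hbase _ y hxj hy hyr) (not_isNode_white_two _)
          fun _ => .inr one_lt_two_withTop)
      refine freeArc_of_lt_iff one_lt_two_withTop.le fun p hp hpt => ?_
      rcases isNode_source_iff.1 hp with rfl | ⟨-, rfl⟩
      · exact le_rfl
      · exact zero_lt_one_withTop.le
    · have hjr := hκ.injective (WithTop.coe_inj.1 hr)
      subst hjr
      refine .inr ⟨b, sameOval_of_glued hx (not_isNode_white_two _) (.inr (.sink b hbot)) harc ?_⟩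
      refine freeArc_of_lt_iff one_lt_two_withTop.le fun p hp hpt => ?_
      rcases isNode_whiteBox_iff.1 hp with rfl | rfl | ⟨-, rfl⟩
      · exact absurd hpt not_top_lt
      · exact le_rfl
      · exact zero_lt_one_withTop.le
  · refine .inl (sameOval_of_lt_iff hx not_isNode_base_top fun p hp => ?_)
    obtain ⟨i, rfl⟩ := exists_eq_of_isNode_base hp
    refine iff_of_true (lt_of_le_of_ne ?_ fun h => hx (h ▸ hp)) (WithTop.coe_lt_top _)
    by_contra h
    exact hne ⟨i, hp, not_le.1 h⟩

/-- Following the oval above and to the left of a box leads to a larger column, to a lower box of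
the same column, or to Γ₀ beyond κ_j. Hence the induction goes down from the largest column, and
inside a column up from the lowest row. -/
theorem upperCornered_aux (hκ : StrictMono κ) (j : Fin n) :
    (∀ b : T.Box, b.1.2 = j → T.UpperCornered κ b) ∧
      ∀ y, ¬ T.IsNode κ (.base, y) → ((κ j : ℝ) : WithTop ℝ) < y → T.Cornered κ (.base, y) := by
  induction j using WellFoundedGT.induction with
  | _ j ih =>
    have hbase : ∀ y, ¬ T.IsNode κ (.base, y) → ((κ j : ℝ) : WithTop ℝ) < y →
        T.Cornered κ (.base, y) := fun y hy hjy =>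
      cornered_base hκ hy
        (fun b hb => (ih _ (hκ.lt_iff_lt.1 (WithTop.coe_lt_coe.1 (hjy.trans hb)))).1 b rfl)
        fun i z hi hz hiz => (ih i (hκ.lt_iff_lt.1 (WithTop.coe_lt_coe.1 (hjy.trans hi)))).2 z hz hiz
    refine ⟨fun b hb => ?_, hbase⟩
    induction hr : b.1.1 using WellFoundedGT.induction generalizing b with
    | _ r ih2 =>
      by_cases hl : T.HasLeft (.inr b)
      · obtain ⟨c, hc⟩ := hl
        have hcol : j < c.1.2 := hb ▸ hc.2.1
        refine SameOval.cornered (sameOval_of_glued (not_isNode_whiteBox_neg b) (not_isNode_black_two c)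
          (.inl (.next b c hc)) ?_ ?_)
          (((ih _ hcol).1 c rfl).black_upper (not_isNode_black_two c) one_lt_two_withTop)
        · refine freeArc_of_lt_iff neg_lt_zero_withTop.le fun p hp hp0 => ?_
          rcases isNode_whiteBox_iff.1 hp with rfl | rfl | ⟨-, rfl⟩
          · exact absurd hp0 not_top_lt
          · exact absurd hp0 zero_lt_one_withTop.not_gt
          · exact absurd hp0 (lt_irrefl _)
        · refine freeArc_of_lt_iff one_lt_two_withTop.le fun p hp hpt => ?_
          rcases isNode_black_iff.1 hp with (rfl | rfl) | ⟨-, rfl⟩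
          · exact zero_lt_one_withTop.le
          · exact le_rfl
          · exact absurd hpt not_top_lt
      · have harc : T.FreeArc κ (.white (.inr b)) ((-1 : ℝ) : WithTop ℝ) ((1 : ℝ) : WithTop ℝ) := by
          refine freeArc_of_lt_iff (neg_lt_zero_withTop.trans zero_lt_one_withTop).le fun p hp hp0 => ?_
          rcases isNode_whiteBox_iff.1 hp with rfl | rfl | ⟨h, -⟩
          · exact absurd hp0 not_top_lt
          · exact absurd hp0 (lt_irrefl _)
          · exact absurd h hl
        rcases T.bottom_or_below b with hbot | ⟨c, hc⟩
        · obtain ⟨y, hy, hy1, hy2⟩ := T.exists_base_after hκ b.1.2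
          exact SameOval.cornered (sameOval_of_glued (not_isNode_whiteBox_neg b) hy
            (.inl (.sink b hbot)) harc hy2) (hbase y hy (hb ▸ hy1))
        · have h1 : T.UpperCornered κ c := ih2 _ (hr ▸ hc.2.1) c (hc.1.trans hb) rfl
          refine SameOval.cornered (sameOval_of_glued (not_isNode_whiteBox_neg b)
            (not_isNode_black_neg c) (.inl (.down b c hc)) harc ?_)
            (h1.black (not_isNode_black_neg c) neg_lt_zero_withTop.le)
          refine freeArc_of_wrap fun p hp => ⟨le_top, ?_⟩
          rcases isNode_black_iff.1 hp with (rfl | rfl) | ⟨-, rfl⟩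
          · exact neg_lt_zero_withTop.le
          · exact (neg_lt_zero_withTop.trans zero_lt_one_withTop).le
          · exact le_top

theorem upperCornered (hκ : StrictMono κ) (b : T.Box) : T.UpperCornered κ b :=
  (upperCornered_aux hκ b.1.2).1 b rfl

theorem cornered_of_not_isNode (hκ : StrictMono κ) {x : T.RealPoint} (hx : ¬ T.IsNode κ x) :
    T.Cornered κ x := by
  obtain ⟨c, x⟩ := x
  have hbase : ∀ j y, ¬ T.IsNode κ (.base, y) → ((κ j : ℝ) : WithTop ℝ) < y →
      T.Cornered κ (.base, y) := fun j => (upperCornered_aux hκ j).2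
  rcases c with _ | (r | b) | b
  · exact cornered_base hκ hx (fun b _ => upperCornered hκ b) fun j y _ => hbase j y
  · by_cases hr : T.RowNonempty r ∧ ((0 : ℝ) : WithTop ℝ) < x ∧ x < ((1 : ℝ) : WithTop ℝ)
    · exact cornered_source_middle hr.1 hx hr.2.1 hr.2.2
    · refine cornered_source_upper hκ (fun b _ => upperCornered hκ b) (hbase _) hx fun hr' => ?_
      rcases le_or_gt x ((0 : ℝ) : WithTop ℝ) with h0 | h0
      · exact .inl h0
      · refine .inr (lt_of_le_of_ne ?_ ?_)
        · by_contra h1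
          exact hr ⟨hr', h0, not_le.1 h1⟩
        · rintro rfl
          exact hx (isNode_source_iff.2 (.inl rfl))
  · rcases lt_trichotomy x ((1 : ℝ) : WithTop ℝ) with h1 | rfl | h1
    · by_cases hl : T.HasLeft (.inr b)
      · rcases le_or_gt x ((0 : ℝ) : WithTop ℝ) with h0 | h0
        · exact (upperCornered hκ b).white hx h0
        · exact cornered_white_middle hl hx h0 h1
      · exact (upperCornered hκ b).white_of_not_hasLeft hl hx h1.le
    · exact absurd (isNode_whiteBox_iff.2 (.inr (.inl rfl))) hx
    · exact cornered_white_lower hx h1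
  · rcases lt_trichotomy x ((1 : ℝ) : WithTop ℝ) with h1 | rfl | h1
    · rcases le_or_gt x ((0 : ℝ) : WithTop ℝ) with h0 | h0
      · exact (upperCornered hκ b).black hx h0
      · exact cornered_black_lower hx h0 h1
    · exact absurd (isNode_black_iff.2 (.inl (.inr rfl))) hx
    · exact (upperCornered hκ b).black_upper hx h1

/-! ### The corner of an oval -/

/-- `b` is the lower right corner of a set of boxes: it is the first box in the lowest row of the set. -/
def IsCorner (U : Set T.Box) (b : T.Box) : Prop :=
  b ∈ U ∧ ∀ c ∈ U, c.1.1 ≤ b.1.1 ∧ (c.1.1 = b.1.1 → b.1.2 ≤ c.1.2)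

theorem IsCorner.unique {U : Set T.Box} {b c : T.Box} (hb : IsCorner U b) (hc : IsCorner U c) :
    b = c := by
  have h1 : b.1.1 = c.1.1 := le_antisymm (hc.2 b hb.1).1 (hb.2 c hc.1).1
  exact Subtype.ext (Prod.ext h1
    (le_antisymm ((hb.2 c hc.1).2 h1.symm) ((hc.2 b hb.1).2 h1)))

theorem regionAt_cornerPoint (b : T.Box) : T.regionAt κ (cornerPoint b) =
    {c | c.1.1 ≤ b.1.1 ∧ b.1.2 ≤ c.1.2} := by
  simp only [regionAt, cornerPoint, region, not_top_lt, if_false, one_lt_two_withTop, if_true]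

theorem isCorner_regionAt_cornerPoint (b : T.Box) : IsCorner (T.regionAt κ (cornerPoint b)) b := by
  rw [regionAt_cornerPoint]
  exact ⟨⟨le_rfl, le_rfl⟩, fun c hc => ⟨hc.1, fun _ => hc.2⟩⟩

theorem regionAt_base_top : T.regionAt κ (.base, ⊤) = ∅ := by
  ext c
  simp only [regionAt, region, Set.mem_ofPred_eq, WithTop.coe_lt_top, not_true_eq_false, and_false,
    Set.mem_empty_iff_false]

/-- The region is an invariant of the oval and has at most one corner, and every oval other than
that of P₀, whose region is empty, passes through a corner point. The finite ovals thus correspond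
to the boxes. -/
theorem sameOval_cornerPoint_iff (hκ : StrictMono κ) {x : T.RealPoint} (hx : ¬ T.IsNode κ x)
    (b : T.Box) : T.SameOval κ x (cornerPoint b) ↔ IsCorner (T.regionAt κ x) b := by
  constructor
  · intro h
    rw [h.regionAt_eq hκ]
    exact isCorner_regionAt_cornerPoint b
  · intro h
    rcases cornered_of_not_isNode hκ hx with h1 | ⟨c, h1⟩
    · rw [h1.regionAt_eq hκ, regionAt_base_top] at h
      exact absurd h.1 (Set.notMem_empty _)
    · rw [h1.regionAt_eq hκ] at h
      rwa [h.unique (isCorner_regionAt_cornerPoint c)]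

theorem onFiniteOval_of_isCorner (hκ : StrictMono κ) {x : T.RealPoint} (hx : ¬ T.IsNode κ x)
    {b : T.Box} (hb : IsCorner (T.regionAt κ x) b) : T.OnFiniteOval κ x := by
  refine ⟨hx, fun h => ?_⟩
  rw [← h.regionAt_eq hκ, regionAt_base_top] at hb
  exact hb.1

theorem OnFiniteOval.exists_isCorner (hκ : StrictMono κ) {x : T.RealPoint}
    (h : T.OnFiniteOval κ x) : ∃ b, IsCorner (T.regionAt κ x) b := by
  rcases cornered_of_not_isNode hκ h.1 with h1 | ⟨b, h1⟩
  · exact absurd (.symm _ _ h1) h.2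
  · exact ⟨b, (sameOval_cornerPoint_iff hκ h.1 b).1 h1⟩

end LeTableau

namespace LeTableau

variable {k n : ℕ} {T : LeTableau k n} {κ : Fin n → ℝ}

/-! ### The regions of the four ovals at a box -/

def lowerRight (b : T.Box) : Set T.Box := {c | c.1.1 ≤ b.1.1 ∧ b.1.2 ≤ c.1.2}

def upperRight (b : T.Box) : Set T.Box := {c | c.1.1 < b.1.1 ∧ b.1.2 ≤ c.1.2}

def lowerLeft (b : T.Box) : Set T.Box := {c | c.1.1 ≤ b.1.1 ∧ b.1.2 < c.1.2}

def upperLeft (b : T.Box) : Set T.Box := {c | c.1.1 < b.1.1 ∧ b.1.2 < c.1.2}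

/-- The region of the oval that meets `Γ₀` between the `(m-1)`-st and the `m`-th point `κ`. -/
def baseRegion (T : LeTableau k n) (m : ℕ) : Set T.Box :=
  {c | (T.pivot c.1.1 : ℕ) < m ∧ m ≤ (c.1.2 : ℕ)}

theorem isCorner_lowerRight_iff {b c : T.Box} : IsCorner (lowerRight b) c ↔ b = c := by
  have h : IsCorner (lowerRight b) b := ⟨⟨le_rfl, le_rfl⟩, fun c hc => ⟨hc.1, fun _ => hc.2⟩⟩
  exact ⟨fun h' => h.unique h', fun h' => h' ▸ h⟩

theorem not_one_le_zero_withTop : ¬ ((1 : ℝ) : WithTop ℝ) ≤ ((0 : ℝ) : WithTop ℝ) :=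
  zero_lt_one_withTop.not_ge

theorem not_top_le_coe (a : ℝ) : ¬ (⊤ : WithTop ℝ) ≤ (a : WithTop ℝ) := by simp

/-- Regions at boxes do not involve the points κ, so `region_glued` may be used with the increasing
sequence κ_j = j. -/
theorem Next.lowerLeft_eq {b b' : T.Box} (hb : T.Next b b') : lowerLeft b = lowerRight b' := by
  have h := (region_glued (κ := fun j : Fin n => ((j : ℕ) : ℝ))
    (fun i j h => Nat.cast_lt.2 (Fin.lt_def.1 h)) (Glued.next b b' hb)).2
  simp only [regionAt, region, not_top_lt, lt_irrefl, if_false, zero_lt_one_withTop,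
    not_one_le_zero_withTop, le_refl, not_top_le_coe, if_true] at h
  exact h.symm

theorem Next.upperLeft_eq {b b' : T.Box} (hb : T.Next b b') : upperLeft b = upperRight b' := by
  have h := (region_glued (κ := fun j : Fin n => ((j : ℕ) : ℝ))
    (fun i j h => Nat.cast_lt.2 (Fin.lt_def.1 h)) (Glued.next b b' hb)).1
  simp only [regionAt, region, not_top_lt, lt_irrefl, if_false, zero_lt_one_withTop.not_gt,
    le_refl, not_top_le_coe, if_true] at h
  exact h

theorem lowerLeft_of_not_hasLeft {b : T.Box} (hb : ¬ T.HasLeft (.inr b)) :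
    lowerLeft b = upperLeft b := region_row_of_not_hasLeft hb

theorem Below.upperLeft_eq {b b' : T.Box} (hb : T.Below b b') : upperLeft b' = lowerLeft b := by
  have h := (region_glued (κ := fun j : Fin n => ((j : ℕ) : ℝ))
    (fun i j h => Nat.cast_lt.2 (Fin.lt_def.1 h)) (Glued.down b b' hb)).1
  simp only [regionAt, region, not_top_lt, lt_irrefl, if_false, zero_lt_one_withTop, le_refl,
    if_true] at h
  exact h.symm

theorem Below.upperRight_eq {b b' : T.Box} (hb : T.Below b b') : upperRight b' = lowerRight b := by
  have h := (region_glued (κ := fun j : Fin n => ((j : ℕ) : ℝ))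
    (fun i j h => Nat.cast_lt.2 (Fin.lt_def.1 h)) (Glued.down b b' hb)).2
  simp only [regionAt, region, not_top_lt, if_false, not_top_le_coe, WithTop.coe_lt_top, le_refl,
    if_true] at h
  exact h

theorem upperRight_of_not_above {b : T.Box} (hb : ¬ ∃ a, T.Below a b) :
    upperRight b = upperLeft b := region_column_of_not_above hb

theorem region_base_lt (j : Fin n) :
    T.regionAt (fun j : Fin n => ((j : ℕ) : ℝ)) (.base, (((j : ℕ) : ℝ) : WithTop ℝ)) =
      T.baseRegion j := by
  ext c
  simp only [regionAt, region, baseRegion, Set.mem_ofPred_eq, WithTop.coe_lt_coe, Nat.cast_lt, not_lt]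

theorem region_base_le (j : Fin n) : T.region (fun j : Fin n => ((j : ℕ) : ℝ))
      (· ≤ (((j : ℕ) : ℝ) : WithTop ℝ)) .base = T.baseRegion (j + 1) := by
  ext c
  simp only [region, baseRegion, Set.mem_ofPred_eq, WithTop.coe_le_coe, Nat.cast_le, not_le,
    Nat.lt_succ_iff, Nat.succ_le_iff]

theorem Bottom.lowerRight_eq {b : T.Box} (hb : T.Bottom b) :
    lowerRight b = T.baseRegion b.1.2 := by
  have h := (region_glued (κ := fun j : Fin n => ((j : ℕ) : ℝ))
    (fun i j h => Nat.cast_lt.2 (Fin.lt_def.1 h)) (Glued.sink b hb)).2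
  rw [region_base_lt] at h
  simp only [region, if_false, not_top_le_coe, le_refl, if_true] at h
  exact h.symm

theorem Bottom.lowerLeft_eq {b : T.Box} (hb : T.Bottom b) :
    lowerLeft b = T.baseRegion (b.1.2 + 1) := by
  have h := (region_glued (κ := fun j : Fin n => ((j : ℕ) : ℝ))
    (fun i j h => Nat.cast_lt.2 (Fin.lt_def.1 h)) (Glued.sink b hb)).1
  rw [region_base_le] at h
  simp only [regionAt, region, not_top_lt, lt_irrefl, if_false, zero_lt_one_withTop, if_true] at h
  exact h

theorem baseRegion_pivot_succ (r : Fin k) :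
    {c : T.Box | c.1.1 ≤ r ∧ T.pivot r < c.1.2} = T.baseRegion (T.pivot r + 1) := by
  ext c
  simp only [baseRegion, Set.mem_ofPred_eq, Nat.lt_succ_iff, Nat.succ_le_iff, Fin.val_fin_le,
    Fin.val_fin_lt, T.pivot_strictMono.le_iff_le]

theorem baseRegion_pivot (r : Fin k) :
    {c : T.Box | c.1.1 < r ∧ T.pivot r < c.1.2} = T.baseRegion (T.pivot r) := by
  ext c
  simp only [baseRegion, Set.mem_ofPred_eq, Fin.val_fin_le, Fin.val_fin_lt,
    T.pivot_strictMono.lt_iff_lt]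
  exact and_congr_right fun _ => ⟨le_of_lt, fun h => h.lt_of_ne (T.not_pivot c r)⟩

theorem First.lowerRight_eq {r : Fin k} {b : T.Box} (hb : T.First r b) :
    lowerRight b = T.baseRegion (T.pivot r + 1) := by
  have h := (region_glued (κ := fun j : Fin n => ((j : ℕ) : ℝ))
    (fun i j h => Nat.cast_lt.2 (Fin.lt_def.1 h)) (Glued.first r b hb)).2
  simp only [regionAt, region, not_top_lt, lt_irrefl, if_false, zero_lt_one_withTop,
    not_one_le_zero_withTop, le_refl, not_false_eq_true, and_self, if_true] at h
  rw [baseRegion_pivot_succ] at h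
  exact h

theorem First.upperRight_eq {r : Fin k} {b : T.Box} (hb : T.First r b) :
    upperRight b = T.baseRegion (T.pivot r) := by
  have h := (region_glued (κ := fun j : Fin n => ((j : ℕ) : ℝ))
    (fun i j h => Nat.cast_lt.2 (Fin.lt_def.1 h)) (Glued.first r b hb)).1
  simp only [regionAt, region, lt_irrefl, and_false, if_false, not_top_le_coe, le_refl, if_true] at h
  rw [baseRegion_pivot] at h
  exact h.symm

theorem baseRegion_of_isolated {r : Fin k} (hr : ¬ T.RowNonempty r) :
    T.baseRegion (T.pivot r + 1) = T.baseRegion (T.pivot r) := by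
  rw [← baseRegion_pivot_succ, region_row_of_isolated hr, baseRegion_pivot]

theorem baseRegion_of_empty {j : Fin n} (hj : ∀ r, T.pivot r ≠ j) (hb : ∀ b : T.Box, b.1.2 ≠ j) :
    T.baseRegion (j + 1) = T.baseRegion j := by
  ext c
  simp only [baseRegion, Set.mem_ofPred_eq, Nat.lt_succ_iff, Nat.succ_le_iff, Fin.val_fin_le,
    Fin.val_fin_lt]
  exact ⟨fun h => ⟨h.1.lt_of_ne (hj _), h.2.le⟩, fun h => ⟨h.1.le, h.2.lt_of_ne (hb c).symm⟩⟩

theorem baseRegion_zero : T.baseRegion 0 = ∅ := by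
  ext c; simp [baseRegion]

theorem baseRegion_top : T.baseRegion n = ∅ := by
  ext c
  have := c.1.2.isLt
  simp [baseRegion]

theorem exists_baseRegion_eq (hκ : StrictMono κ) (x : ℝ) :
    ∃ a ≤ n, (∀ j : Fin n, κ j < x ↔ (j : ℕ) < a) ∧
      T.regionAt κ (.base, (x : WithTop ℝ)) = T.baseRegion a := by
  have h1 : ∃ a ≤ n, ∀ j : Fin n, κ j < x ↔ (j : ℕ) < a := by
    classical
    by_cases hne : ∃ j, x ≤ κ j
    · obtain ⟨j, hj, hmin⟩ := Finset.exists_min_image (Finset.univ.filter fun j => x ≤ κ j) id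
        (by obtain ⟨j, hj⟩ := hne; exact ⟨j, by simpa using hj⟩)
      simp only [Finset.mem_filter, Finset.mem_univ, true_and, id] at hj hmin
      refine ⟨j, j.isLt.le, fun i => ⟨fun hi => hκ.lt_iff_lt.1 (hi.trans_le hj), fun hi => ?_⟩⟩
      by_contra h
      exact (hmin i (not_lt.1 h)).not_gt hi
    · push Not at hne
      exact ⟨n, le_rfl, fun j => iff_of_true (hne j) j.isLt⟩
  obtain ⟨a, ha, ha'⟩ := h1
  refine ⟨a, ha, ha', ?_⟩
  ext c
  simp only [regionAt, region, baseRegion, Set.mem_ofPred_eq, WithTop.coe_lt_coe, ha', not_lt]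

/-! ### Signs modulo two -/

open Classical in
/-- The sign of a real number, as an element of `ZMod 2`. -/
noncomputable def signBit (x : ℝ) : ZMod 2 := if x < 0 then 1 else 0

theorem signBit_of_pos {x : ℝ} (hx : 0 < x) : signBit x = 0 := if_neg hx.not_gt

theorem signBit_of_neg {x : ℝ} (hx : x < 0) : signBit x = 1 := if_pos hx

theorem signBit_one : signBit 1 = 0 := signBit_of_pos one_pos

theorem signBit_mul {x y : ℝ} (hx : x ≠ 0) (hy : y ≠ 0) :
    signBit (x * y) = signBit x + signBit y := by
  rcases lt_or_gt_of_ne hx with hx | hx <;> rcases lt_or_gt_of_ne hy with hy | hy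
  · rw [signBit_of_neg hx, signBit_of_neg hy, signBit_of_pos (mul_pos_of_neg_of_neg hx hy)]; rfl
  · rw [signBit_of_neg hx, signBit_of_pos hy, signBit_of_neg (mul_neg_of_neg_of_pos hx hy)]; rfl
  · rw [signBit_of_pos hx, signBit_of_neg hy, signBit_of_neg (mul_neg_of_pos_of_neg hx hy)]; rfl
  · rw [signBit_of_pos hx, signBit_of_pos hy, signBit_of_pos (mul_pos hx hy)]; rfl

theorem signBit_neg {x : ℝ} (hx : x ≠ 0) : signBit (-x) = 1 + signBit x := by
  rw [← neg_one_mul, signBit_mul (by norm_num) hx, signBit_of_neg (by norm_num)]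

theorem signBit_neg_one_pow (m : ℕ) : signBit ((-1) ^ m) = m := by
  induction m with
  | zero => simpa using signBit_one
  | succ m ih =>
    rw [pow_succ, signBit_mul (pow_ne_zero _ (by norm_num)) (by norm_num), ih,
      signBit_of_neg (by norm_num)]
    push_cast; rfl

theorem signBit_prod {ι : Type*} (s : Finset ι) (f : ι → ℝ) (hf : ∀ i ∈ s, f i ≠ 0) :
    signBit (∏ i ∈ s, f i) = ∑ i ∈ s, signBit (f i) := by
  classical
  induction s using Finset.induction_on with
  | empty => simpa using signBit_one
  | insert i s hi ih =>
    rw [Finset.prod_insert hi, Finset.sum_insert hi, signBit_mul (hf i (Finset.mem_insert_self _ _))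
      (Finset.prod_ne_zero_iff.2 fun j hj => hf j (Finset.mem_insert_of_mem hj)),
      ih fun j hj => hf j (Finset.mem_insert_of_mem hj)]

theorem signBit_multiset_prod (s : Multiset ℝ) (hs : (0 : ℝ) ∉ s) :
    signBit s.prod = (s.map signBit).sum := by
  induction s using Multiset.induction_on with
  | empty => simpa using signBit_one
  | cons a s ih =>
    rw [Multiset.mem_cons, not_or] at hs
    rw [Multiset.prod_cons, Multiset.map_cons, Multiset.sum_cons,
      signBit_mul (Ne.symm hs.1) (Multiset.prod_ne_zero hs.2), ih hs.2]

theorem eval_pos_of_monic_of_roots_eq_zero {q : Polynomial ℝ} (hq : q.Monic) (h : q.roots = 0)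
    (z : ℝ) : 0 < q.eval z := by
  have hne : ∀ x, q.eval x ≠ 0 := by
    intro x hx
    have : x ∈ q.roots := (Polynomial.mem_roots hq.ne_zero).2 hx
    rw [h] at this
    exact Multiset.notMem_zero _ this
  have hex : ∃ x, 0 < q.eval x := by
    rcases eq_or_ne q.natDegree 0 with h0 | h0
    · exact ⟨0, by rw [hq.natDegree_eq_zero.1 h0]; simp⟩
    · have h1 : Tendsto (fun x => q.eval x) atTop atTop :=
        q.tendsto_atTop_of_leadingCoeff_nonneg
          (Polynomial.natDegree_pos_iff_degree_pos.1 (Nat.pos_of_ne_zero h0))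
          (by rw [hq.leadingCoeff]; exact zero_le_one)
      exact (h1.eventually_gt_atTop 0).exists
  obtain ⟨x, hx⟩ := hex
  by_contra hz
  obtain ⟨y, hy⟩ := mem_range_of_exists_le_of_exists_ge q.continuous ⟨z, not_lt.1 hz⟩ ⟨x, hx.le⟩
  exact hne y hy

open Classical in
/-- The sign of a monic polynomial is the parity of the number of larger roots. -/
theorem signBit_eval_of_monic {p : Polynomial ℝ} (hp : p.Monic) {z : ℝ} (hz : p.eval z ≠ 0) :
    signBit (p.eval z) = (p.roots.map fun x => if z < x then (1 : ZMod 2) else 0).sum := by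
  -- Split off the real roots; the monic cofactor has none and is positive everywhere.
  obtain ⟨q, hq, -, hroots⟩ := Polynomial.exists_prod_multiset_X_sub_C_mul p
  have hqm : q.Monic := by
    have h1 := hp
    rw [← hq, Polynomial.Monic, Polynomial.leadingCoeff_mul,
      (Polynomial.monic_multiset_prod_of_monic _ _ fun a _ => Polynomial.monic_X_sub_C a).leadingCoeff,
      one_mul] at h1
    exact h1
  have h1 : p.eval z = (p.roots.map fun x => z - x).prod * q.eval z := by
    conv_lhs => rw [← hq]
    rw [Polynomial.eval_mul, Polynomial.eval_multiset_prod, Multiset.map_map]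
    simp
  have h2 : (0 : ℝ) ∉ p.roots.map fun x => z - x := by
    intro h
    apply hz
    rw [h1, Multiset.prod_eq_zero h, zero_mul]
  have hpos := eval_pos_of_monic_of_roots_eq_zero hqm hroots z
  rw [h1, signBit_mul (Multiset.prod_ne_zero h2) hpos.ne', signBit_of_pos hpos, add_zero,
    signBit_multiset_prod _ h2, Multiset.map_map]
  refine congrArg Multiset.sum (Multiset.map_congr rfl fun x _ => ?_)
  simp [signBit]

/-- In characteristic two f j + f (j + 1) is a difference, and the sum telescopes. -/
theorem sum_fin_lt {f : ℕ → ZMod 2} {m n : ℕ} (h : m ≤ n) :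
    ∑ j : Fin n, (if (j : ℕ) < m then f j + f (j + 1) else 0) = f 0 + f m := by
  rw [Fin.sum_univ_eq_sum_range (fun j => if j < m then f j + f (j + 1) else 0) n,
    ← Finset.sum_filter]
  have h1 : (Finset.range n).filter (· < m) = Finset.range m := by
    ext j; simp; omega
  rw [h1]
  induction m with
  | zero => simp [CharTwo.add_self_eq_zero]
  | succ m ih =>
    rw [Finset.sum_range_succ, ih (by omega) (by ext j; simp; omega)]
    linear_combination CharTwo.add_self_eq_zero (f m)

theorem sum_fin {f : ℕ → ZMod 2} (n : ℕ) :
    ∑ j : Fin n, (f j + f (j + 1)) = f 0 + f n := by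
  rw [← sum_fin_lt le_rfl]
  exact Finset.sum_congr rfl fun j _ => (if_pos j.isLt).symm

theorem sum_fin_gt {f : ℕ → ZMod 2} {m n : ℕ} (h : m < n) :
    ∑ j : Fin n, (if m < (j : ℕ) then f j + f (j + 1) else 0) = f (m + 1) + f n := by
  have h1 := sum_fin (f := f) n
  have h2 := sum_fin_lt (f := f) (Nat.succ_le_of_lt h)
  have h3 : ∑ j : Fin n, (f j + f (j + 1)) =
      ∑ j : Fin n, (if (j : ℕ) < m.succ then f j + f (j + 1) else 0) +
      ∑ j : Fin n, (if m < (j : ℕ) then f j + f (j + 1) else 0) := by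
    rw [← Finset.sum_add_distrib]
    refine Finset.sum_congr rfl fun j _ => ?_
    by_cases hj : m < (j : ℕ)
    · rw [if_neg (by omega), if_pos hj, zero_add]
    · rw [if_pos (by omega), if_neg hj, add_zero]
  rw [h1, h2] at h3
  have h4 : f m.succ = f (m + 1) := rfl
  rw [h4] at h3
  linear_combination h3.symm - CharTwo.add_self_eq_zero (f (m + 1))

end LeTableau

/-! ### Sign relations in the interior and on the boundary of the network -/

namespace LeTableau

variable {k n : ℕ} {T : LeTableau k n} {κ : Fin n → ℝ} {A : Matrix (Fin k) (Fin n) ℝ}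

open Classical in
theorem sum_below {M : Type*} [AddCommMonoid M] (f : T.Box → M) (c : T.Box) :
    (∑ d, if T.Below c d then f c else 0) = if T.Bottom c then 0 else f c := by
  rcases T.bottom_or_below c with h | ⟨d, h⟩
  · rw [if_pos h]
    exact Finset.sum_eq_zero fun d _ => if_neg fun h' => not_bottom_of_below h' h
  · rw [if_neg (not_bottom_of_below h), Finset.sum_eq_single d, if_pos h]
    · intro e _ he; exact if_neg fun h' => he (below_unique h' h)
    · simp

open Classical in
/-- Functions on the four corners and on the two edges of the boxes, with the relations satisfied by
the ovals and by the signs of the edge functions: the sum of the contributions of the white vertices is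
concentrated on the boundary. -/
theorem sum_next_corners (LR UR LL UL u2 u3 : T.Box → ZMod 2)
    (hnextL : ∀ c d, T.Next c d → LL c = LR d) (hnextU : ∀ c d, T.Next c d → UL c = UR d)
    (hleftL : ∀ c, ¬ T.HasLeft (.inr c) → LL c = UL c)
    (hleftu : ∀ c, ¬ T.HasLeft (.inr c) → u2 c = u3 c)
    (hbelowL : ∀ c d, T.Below c d → UL d = LL c) (hbelowR : ∀ c d, T.Below c d → UR d = LR c)
    (hbelowu : ∀ c d, T.Below c d → u3 d = u2 c)
    (habove : ∀ d, (¬ ∃ c, T.Below c d) → UR d = UL d) :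
    (∑ c, ∑ d, if T.Next c d then
      LR c * (u2 c + u3 c) + UL c * (u3 c + u3 d) + LR d * (1 + u2 c + u3 d) else 0) =
    (∑ c, if T.Bottom c then (LR c + LL c) * u2 c else 0) +
      (∑ r, ∑ b, if T.First r b then (LR b + UR b) * u3 b + LR b else 0) + ∑ b, LR b := by
  have htwo : ∀ x : ZMod 2, x + x = 0 := CharTwo.add_self_eq_zero
  -- G collects what belongs to the left box c of a horizontal edge and H what belongs to the box it
  -- enters. For a box without a left neighbour G is 0, so the sum over G extends to all boxes; H
  -- misses only the first boxes. What is left is paired along vertical edges, where the terms of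
  -- the two ends cancel except at the bottom.
  set G : T.Box → ZMod 2 := fun c => LR c * (u2 c + u3 c) + UL c * u3 c + LL c * u2 c with hG
  set H : T.Box → ZMod 2 := fun b => (LR b + UR b) * u3 b + LR b with hH
  have h1 : (∑ c, ∑ d, if T.Next c d then
      LR c * (u2 c + u3 c) + UL c * (u3 c + u3 d) + LR d * (1 + u2 c + u3 d) else 0) =
      ∑ c, G c + ∑ c, ∑ d, if T.Next c d then H d else 0 := by
    rw [← Finset.sum_add_distrib]
    refine Finset.sum_congr rfl fun c _ => ?_
    by_cases hc : T.HasLeft (.inr c)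
    · obtain ⟨d, hd⟩ := hc
      have e1 : (∑ d, if T.Next c d then
          LR c * (u2 c + u3 c) + UL c * (u3 c + u3 d) + LR d * (1 + u2 c + u3 d) else 0) = _ :=
        sum_next _ hd
      rw [e1, sum_next _ hd, hG, hH]
      simp only [hnextL c d hd, hnextU c d hd]
      ring
    · have e1 : (∑ d, if T.Next c d then
          LR c * (u2 c + u3 c) + UL c * (u3 c + u3 d) + LR d * (1 + u2 c + u3 d) else 0) = _ :=
        sum_next_of_not_hasLeft _ hc
      rw [e1, sum_next_of_not_hasLeft _ hc, hG, add_zero]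
      simp only [hleftu c hc, hleftL c hc, htwo, mul_zero, zero_add]
  have h2 := sum_box_eq H
  have h3 : ∑ d, (UL d + UR d) * u3 d = ∑ c, if T.Bottom c then 0 else (LR c + LL c) * u2 c := by
    rw [Finset.sum_congr rfl fun c _ => (sum_below (fun c => (LR c + LL c) * u2 c) c).symm,
      Finset.sum_comm]
    refine Finset.sum_congr rfl fun d _ => ?_
    by_cases hd : ∃ c, T.Below c d
    · obtain ⟨c, hc⟩ := hd
      rw [Finset.sum_eq_single c, if_pos hc, hbelowL c d hc, hbelowR c d hc, hbelowu c d hc, add_comm]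
      · intro e _ he; exact if_neg fun h' => he (below_unique_left h' hc)
      · simp
    · rw [Finset.sum_eq_zero fun c _ => if_neg fun h' => hd ⟨c, h'⟩, habove d hd, htwo, zero_mul]
  have h4 : ∑ c, G c + ∑ b, H b = (∑ c, (LR c + LL c) * u2 c) + ∑ d, (UL d + UR d) * u3 d + ∑ b, LR b := by
    rw [← Finset.sum_add_distrib, ← Finset.sum_add_distrib, ← Finset.sum_add_distrib]
    refine Finset.sum_congr rfl fun c _ => ?_
    rw [hG, hH]
    linear_combination htwo (LR c * u3 c)
  have h5 : ∑ c, (LR c + LL c) * u2 c = (∑ c, if T.Bottom c then (LR c + LL c) * u2 c else 0) +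
      ∑ c, if T.Bottom c then 0 else (LR c + LL c) * u2 c := by
    rw [← Finset.sum_add_distrib]
    refine Finset.sum_congr rfl fun c _ => ?_
    split_ifs <;> simp
  rw [h1]
  linear_combination h4 + h5 + h3 - h2 + htwo (∑ c, if T.Bottom c then 0 else (LR c + LL c) * u2 c)
    - htwo (∑ r, ∑ b, if T.First r b then H b else 0)

open Classical in
/-- The contributions of the boundary vertices of the network, as a sum over the columns. -/
theorem sum_boundary (d v : Fin n → ZMod 2)
    (hiso : ∀ r, ¬ T.RowNonempty r → d (T.pivot r) = 0)
    (hempty : ∀ j, (∀ r, T.pivot r ≠ j) → (∀ b : T.Box, b.1.2 ≠ j) → d j = 0) :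
    ∑ j, d j * v j = (∑ c : T.Box, if T.Bottom c then d c.1.2 * v c.1.2 else 0) +
      ∑ r, ∑ b, if T.First r b then d (T.pivot r) * v (T.pivot r) else 0 := by
  have h1 : (∑ c : T.Box, if T.Bottom c then d c.1.2 * v c.1.2 else 0) =
      ∑ j, ∑ c : T.Box, if c.1.2 = j then (if T.Bottom c then d j * v j else 0) else 0 := by
    rw [Finset.sum_comm]
    exact Finset.sum_congr rfl fun c _ => by simp
  have h2 : (∑ r, ∑ b, if T.First r b then d (T.pivot r) * v (T.pivot r) else 0) =
      ∑ j, ∑ r, if T.pivot r = j then d j * v j else 0 := by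
    rw [Finset.sum_comm (s := (Finset.univ : Finset (Fin n)))]
    refine Finset.sum_congr rfl fun r _ => ?_
    rw [Finset.sum_ite_eq]
    simp only [Finset.mem_univ, if_true]
    by_cases hr : T.RowNonempty r
    · obtain ⟨b, hb⟩ := T.exists_first hr
      exact sum_first (fun _ => d (T.pivot r) * v (T.pivot r)) hb
    · rw [sum_first_of_isolated (fun _ => d (T.pivot r) * v (T.pivot r)) hr, hiso r hr, zero_mul]
  rw [h1, h2, ← Finset.sum_add_distrib]
  refine Finset.sum_congr rfl fun j _ => ?_
  by_cases hp : ∃ r, T.pivot r = j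
  · obtain ⟨r, rfl⟩ := hp
    rw [Finset.sum_eq_zero fun c _ => if_neg fun h => T.not_pivot c r h.symm, zero_add,
      Finset.sum_eq_single r, if_pos rfl]
    · intro s _ hs; exact if_neg fun h => hs (T.pivot_strictMono.injective h)
    · simp
  · push Not at hp
    rw [Finset.sum_eq_zero (s := (Finset.univ : Finset (Fin k))) fun r _ => if_neg (hp r), add_zero]
    by_cases hb : ∃ b : T.Box, b.1.2 = j
    · obtain ⟨b, rfl⟩ := hb
      obtain ⟨c, hc, hbot⟩ := exists_bottom b
      rw [← hc, Finset.sum_eq_single c, if_pos rfl, if_pos hbot]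
      · intro e _ he
        by_cases h3 : e.1.2 = c.1.2
        · rw [if_pos h3, if_neg]
          intro h4
          exact he (Subtype.ext (Prod.ext (le_antisymm (hbot e h3) (h4 c h3.symm)) h3))
        · exact if_neg h3
      · simp
    · push Not at hb
      rw [hempty j hp hb, zero_mul, Finset.sum_eq_zero fun c _ => if_neg (hb c)]

/-! ### Signs of the edge functions on the boundary -/

open Classical in
/-- The parity of the number of the isolated pivots that are larger than `j`. -/
noncomputable def isolatedCount (T : LeTableau k n) (j : Fin n) : ZMod 2 :=
  ∑ r, if ¬ T.RowNonempty r ∧ j < T.pivot r then 1 else 0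

open Classical in
/-- The parity of the number of the roots of a polynomial that are larger than `z`. -/
noncomputable def rootBit (p : Polynomial ℝ) (z : ℝ) : ZMod 2 :=
  (p.roots.map fun x => if z < x then (1 : ZMod 2) else 0).sum

theorem signBit_isolatedFactor (hκ : StrictMono κ) {j : Fin n}
    (hj : (T.isolatedFactor κ).eval (κ j) ≠ 0) :
    signBit ((T.isolatedFactor κ).eval (κ j)) = T.isolatedCount j := by
  classical
  have h1 : (T.isolatedFactor κ).eval (κ j) =
      ∏ r, if T.RowNonempty r then 1 else κ j - κ (T.pivot r) := by
    rw [isolatedFactor, Polynomial.eval_prod]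
    refine Finset.prod_congr rfl fun r _ => ?_
    split_ifs <;> simp
  rw [h1] at hj ⊢
  rw [signBit_prod _ _ (Finset.prod_ne_zero_iff.1 hj), isolatedCount]
  refine Finset.sum_congr rfl fun r _ => ?_
  by_cases hr : T.RowNonempty r
  · simp [hr, signBit_one]
  · simp only [hr, if_false, not_false_eq_true, true_and, signBit, sub_neg, hκ.lt_iff_lt]

/-- The sign bit of the edge function on the vertical edge of the bottom box of a column, and of the
edge function at the first box of the row of a pivot. -/
noncomputable def boundaryBit (T : LeTableau k n) (κ : Fin n → ℝ) (A : Matrix (Fin k) (Fin n) ℝ)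
    (t₀ : KPTime) (j : Fin n) : ZMod 2 :=
  1 + T.pivotCount j + T.isolatedCount j + rootBit (T.reducedSatoPoly κ A t₀) (κ j)

/-- The sign of the row is included so that the bit does not change along a vertical edge
(`bit3_below`). -/
noncomputable def bit2 (κ : Fin n → ℝ) (A : Matrix (Fin k) (Fin n) ℝ) (t₀ : KPTime) (b : T.Box) :
    ZMod 2 := signBit ((-1) ^ (b.1.1 : ℕ) * T.Psi2 κ A (.inr b) t₀)

noncomputable def bit3 (κ : Fin n → ℝ) (A : Matrix (Fin k) (Fin n) ℝ) (t₀ : KPTime) (b : T.Box) :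
    ZMod 2 := signBit ((-1) ^ (b.1.1 : ℕ) * T.Psi3 κ A (.inr b) t₀)

theorem weight_pos (b : T.Box) : 0 < T.weight b.1.1 b.1.2 :=
  (T.weight_nonneg _ _).lt_of_ne b.2.symm

theorem neg_one_pow_ne_zero (m : ℕ) : ((-1 : ℝ)) ^ m ≠ 0 := pow_ne_zero _ (by norm_num)

section

variable {t₀ : KPTime} (h : T.Regular κ A) (hΨ : T.DressedNonvanishing κ A t₀)
include h hΨ

/-- The row factor of `rowSign` cancels the one in `bit2`; the column factor, the isolated factor
and S' give the three variable terms of the boundary bit. -/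
theorem bit2_bottom {b : T.Box} (hb : T.Bottom b) :
    bit2 κ A t₀ b = T.boundaryBit κ A t₀ b.1.2 := by
  have h0 := hΨ.column b
  have h1 := h.isolatedFactor_box_ne b
  have hS : signBit ((T.reducedSatoPoly κ A t₀).eval (κ b.1.2)) =
      rootBit (T.reducedSatoPoly κ A t₀) (κ b.1.2) :=
    signBit_eval_of_monic (h.numer_base_monic t₀) h0
  rw [bit2, Psi2_bottom hb, h.sato_eval, T.rowSign_eq _ _ (T.pivot_lt b),
    signBit_mul (neg_one_pow_ne_zero _), signBit_mul, signBit_neg, signBit_mul, signBit_mul, signBit_mul,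
    signBit_neg_one_pow, signBit_neg_one_pow, signBit_of_pos (Real.exp_pos _), hS,
    signBit_isolatedFactor h.strictMono h1, boundaryBit]
  · linear_combination CharTwo.add_self_eq_zero ((b.1.1 : ℕ) : ZMod 2)
  any_goals positivity
  any_goals simp only [ne_eq, neg_eq_zero, mul_eq_zero, not_or]
  any_goals simp [h0, h1, (Real.exp_pos _).ne']

/-- Since 𝔇f = 0, the weight times Ψ3 equals −Ψ2 = −e^θ q S' at the pivot. The row number is the
pivot count, so the same formula arises as at the sinks. -/
theorem bit3_first {r : Fin k} {b : T.Box} (hb : T.First r b) :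
    bit3 κ A t₀ b = T.boundaryBit κ A t₀ (T.pivot r) := by
  have h0 := hΨ.pivot r
  have h1 := h.isolatedFactor_pivot_ne hb.rowNonempty
  have hS : signBit ((T.reducedSatoPoly κ A t₀).eval (κ (T.pivot r))) =
      rootBit (T.reducedSatoPoly κ A t₀) (κ (T.pivot r)) :=
    signBit_eval_of_monic (h.numer_base_monic t₀) h0
  have h2 := h.Psi1_source r t₀
  rw [Psi1_first hb, Psi2_source, h.sato_eval] at h2
  have h3 := congrArg signBit h2
  rw [signBit_mul b.2 (hΨ.psi3 b), signBit_of_pos (weight_pos b), signBit_neg, signBit_mul,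
    signBit_mul h1 h0, signBit_of_pos (Real.exp_pos _), hS,
    signBit_isolatedFactor h.strictMono h1] at h3
  · rw [bit3, signBit_mul (neg_one_pow_ne_zero _) (hΨ.psi3 b), signBit_neg_one_pow, boundaryBit,
      T.pivotCount_pivot, hb.1]
    linear_combination h3
  · exact (Real.exp_pos _).ne'
  · exact mul_ne_zero h1 h0
  · exact mul_ne_zero (Real.exp_pos _).ne' (mul_ne_zero h1 h0)

omit h hΨ in
theorem bit3_below {c d : T.Box} (hcd : T.Below c d) : bit3 κ A t₀ d = bit2 κ A t₀ c := by
  rw [bit3, bit2, Psi2_below hcd, ← mul_assoc, ← mul_assoc, ← pow_add, Even.neg_one_pow ⟨_, rfl⟩,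
    one_mul]

omit h hΨ in
theorem bit2_of_not_hasLeft {c : T.Box} (hc : ¬ T.HasLeft (.inr c)) :
    bit2 κ A t₀ c = bit3 κ A t₀ c := by
  rw [bit3, bit2, Psi3_eq_add, Psi1_of_not_hasLeft hc, zero_add]

omit h in
/-- The contribution of the divisor point on the component of a white vertex. -/
theorem corner_white {c d : T.Box} (hcd : T.Next c d) (F : Set T.Box → ZMod 2) :
    F (T.regionAt κ (.white (.inr c),
      ((T.Psi1 κ A (.inr c) t₀ / T.Psi3 κ A (.inr c) t₀ : ℝ) : WithTop ℝ))) =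
    F (lowerRight c) * (bit2 κ A t₀ c + bit3 κ A t₀ c) +
      F (upperLeft c) * (bit3 κ A t₀ c + bit3 κ A t₀ d) +
      F (lowerRight d) * (1 + bit2 κ A t₀ c + bit3 κ A t₀ d) := by
  have h1 := hΨ.psi1 (.inr c) ⟨d, hcd⟩
  have h2 := hΨ.psi2 (.inr c) trivial
  have h3 := hΨ.psi3 c
  have hadd := T.Psi3_eq_add κ A (.inr c) t₀
  have hb : bit3 κ A t₀ d = signBit ((-1) ^ (c.1.1 : ℕ) * T.Psi1 κ A (.inr c) t₀) := by
    rw [bit3, Psi1_next hcd, signBit_mul (neg_one_pow_ne_zero _) (hΨ.psi3 d),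
      signBit_mul (neg_one_pow_ne_zero _) (mul_ne_zero d.2 (hΨ.psi3 d)),
      signBit_mul d.2 (hΨ.psi3 d), signBit_of_pos (weight_pos d), zero_add, hcd.1]
  rw [← hcd.lowerLeft_eq, hb, bit2, bit3]
  generalize T.Psi1 κ A (.inr c) t₀ = p1 at *
  generalize T.Psi2 κ A (.inr c) t₀ = p2 at *
  generalize T.Psi3 κ A (.inr c) t₀ = p3 at *
  have hsum : ∀ {x y : ℝ}, x ≠ 0 → y ≠ 0 → signBit ((-1) ^ (c.1.1 : ℕ) * x) +
      signBit ((-1) ^ (c.1.1 : ℕ) * y) = signBit (x * y) := by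
    intro x y hx hy
    rw [signBit_mul (neg_one_pow_ne_zero _) hx, signBit_mul (neg_one_pow_ne_zero _) hy,
      signBit_mul hx hy]
    linear_combination CharTwo.add_self_eq_zero (signBit ((-1) ^ (c.1.1 : ℕ)))
  rw [add_assoc (1 : ZMod 2), hsum h2 h3, hsum h3 h1, hsum h2 h1]
  -- γ = Ψ1/Ψ3 is the coordinate of the divisor point and 1 − γ = Ψ2/Ψ3. The three pairwise signs
  -- decide between γ < 0, 0 < γ < 1 and γ > 1, that is, between the three arcs, and exactly one
  -- coefficient in the formula is 1.
  obtain ⟨γ, rfl⟩ : ∃ γ, p1 = γ * p3 := ⟨p1 / p3, (div_mul_cancel₀ _ h3).symm⟩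
  obtain rfl : p2 = (1 - γ) * p3 := by linear_combination -hadd
  rw [mul_div_assoc, div_self h3, mul_one]
  have hγ0 : γ ≠ 0 := left_ne_zero_of_mul h1
  have hγ1 : γ ≠ 1 := fun h => left_ne_zero_of_mul h2 (by rw [h, sub_self])
  have hsq : 0 < p3 * p3 := mul_self_pos.2 h3
  have e1 : (1 - γ) * p3 * p3 = (1 - γ) * (p3 * p3) := by ring
  have e2 : p3 * (γ * p3) = γ * (p3 * p3) := by ring
  have e3 : (1 - γ) * p3 * (γ * p3) = (γ * (1 - γ)) * (p3 * p3) := by ring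
  rw [e1, e2, e3]
  rcases lt_or_gt_of_ne hγ0 with hg | hg
  · rw [signBit_of_pos (mul_pos (by linarith) hsq), signBit_of_neg (mul_neg_of_neg_of_pos hg hsq),
      signBit_of_neg (mul_neg_of_neg_of_pos (mul_neg_of_neg_of_pos hg (by linarith)) hsq)]
    have hr : T.regionAt κ (.white (.inr c), (γ : WithTop ℝ)) = upperLeft c := by
      simp only [regionAt, region, not_top_lt, if_false, WithTop.coe_lt_coe, hg.not_gt,
        (hg.trans one_pos).not_gt]
      rfl
    rw [hr, CharTwo.add_self_eq_zero]
    ring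
  · rcases lt_or_gt_of_ne hγ1 with hg1 | hg1
    · rw [signBit_of_pos (mul_pos (by linarith) hsq), signBit_of_pos (mul_pos hg hsq),
        signBit_of_pos (mul_pos (mul_pos hg (by linarith)) hsq)]
      have hr : T.regionAt κ (.white (.inr c), (γ : WithTop ℝ)) = lowerLeft c := by
        simp only [regionAt, region, not_top_lt, if_false, WithTop.coe_lt_coe, hg, hg1.not_gt, if_true]
        rfl
      rw [hr]
      ring
    · rw [signBit_of_neg (mul_neg_of_neg_of_pos (by linarith) hsq), signBit_of_pos (mul_pos hg hsq),
        signBit_of_neg (mul_neg_of_neg_of_pos (mul_neg_of_pos_of_neg hg (by linarith)) hsq)]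
      have hr : T.regionAt κ (.white (.inr c), (γ : WithTop ℝ)) = lowerRight c := by
        simp only [regionAt, region, not_top_lt, if_false, WithTop.coe_lt_coe, hg1, if_true]
        rfl
      rw [hr, CharTwo.add_self_eq_zero]
      ring

end

end LeTableau

/-! ### Each finite oval carries exactly one point of the divisor -/

namespace LeTableau

variable {k n : ℕ} {T : LeTableau k n} {κ : Fin n → ℝ} {A : Matrix (Fin k) (Fin n) ℝ}

theorem sum_mul_multiset_sum {ι : Type*} (s : Finset ι) (d : ι → ZMod 2) (R : Multiset ℝ)
    (g : ι → ℝ → ZMod 2) :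
    ∑ j ∈ s, d j * (R.map (g j)).sum = (R.map fun x => ∑ j ∈ s, d j * g j x).sum := by
  induction R using Multiset.induction_on with
  | empty => simp
  | cons a R ih =>
    simp only [Multiset.map_cons, Multiset.sum_cons, mul_add, Finset.sum_add_distrib, ih]

open Classical in
theorem natCast_countP {α : Type*} (p : α → Prop) (M : Multiset α) :
    (M.countP p : ZMod 2) = (M.map fun x => if p x then (1 : ZMod 2) else 0).sum := by
  induction M using Multiset.induction_on with
  | empty => simp
  | cons a M ih =>
    rw [Multiset.countP_cons, Nat.cast_add, ih, Multiset.map_cons, Multiset.sum_cons, add_comm]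
    split_ifs <;> simp

section

variable {t₀ : KPTime} (h : T.Regular κ A) (hΨ : T.DressedNonvanishing κ A t₀)
include h hΨ

open Classical in
/-- The number of the points of the divisor on the oval with a given corner is odd. -/
theorem parity_corner (L : T.Box) :
    (∑ c, ∑ d, if T.Next c d then (if IsCorner (T.regionAt κ (.white (.inr c),
      ((T.Psi1 κ A (.inr c) t₀ / T.Psi3 κ A (.inr c) t₀ : ℝ) : WithTop ℝ))) L then (1 : ZMod 2) else 0)
        else 0) +
    ((T.reducedSatoPoly κ A t₀).roots.map fun x : ℝ =>
      if IsCorner (T.regionAt κ (.base, (x : WithTop ℝ))) L then (1 : ZMod 2) else 0).sum = 1 := by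
  have htwo : ∀ x : ZMod 2, x + x = 0 := CharTwo.add_self_eq_zero
  -- F is the indicator of the corner L, and f is its restriction to the faces along Γ₀; f vanishes
  -- at both ends because the infinite oval has an empty region.
  set F : Set T.Box → ZMod 2 := fun U => if IsCorner U L then 1 else 0 with hF
  set f : ℕ → ZMod 2 := fun m => F (T.baseRegion m) with hf
  have hempty : F ∅ = 0 := if_neg fun hc => hc.1
  have hf0 : f 0 = 0 := by rw [hf]; simp only [baseRegion_zero, hempty]
  have hfn : f n = 0 := by rw [hf]; simp only [baseRegion_top, hempty]
  set d : Fin n → ZMod 2 := fun j => f j + f (j + 1) with hd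
  have h1 := sum_next_corners (fun c => F (lowerRight c)) (fun c => F (upperRight c))
    (fun c => F (lowerLeft c)) (fun c => F (upperLeft c)) (bit2 κ A t₀) (bit3 κ A t₀)
    (fun c d hcd => by simp only [hcd.lowerLeft_eq]) (fun c d hcd => by simp only [hcd.upperLeft_eq])
    (fun c hc => by simp only [lowerLeft_of_not_hasLeft hc]) (fun c hc => bit2_of_not_hasLeft hc)
    (fun c d hcd => by simp only [hcd.upperLeft_eq]) (fun c d hcd => by simp only [hcd.upperRight_eq])
    (fun c d hcd => bit3_below hcd) (fun c hc => by simp only [upperRight_of_not_above hc])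
  have h2 : (∑ c, ∑ d, if T.Next c d then F (T.regionAt κ (.white (.inr c),
      ((T.Psi1 κ A (.inr c) t₀ / T.Psi3 κ A (.inr c) t₀ : ℝ) : WithTop ℝ))) else 0) =
      ∑ c, ∑ d, if T.Next c d then F (lowerRight c) * (bit2 κ A t₀ c + bit3 κ A t₀ c) +
        F (upperLeft c) * (bit3 κ A t₀ c + bit3 κ A t₀ d) +
        F (lowerRight d) * (1 + bit2 κ A t₀ c + bit3 κ A t₀ d) else 0 := by
    refine Finset.sum_congr rfl fun c _ => Finset.sum_congr rfl fun e _ => ?_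
    by_cases hce : T.Next c e
    · rw [if_pos hce, if_pos hce, corner_white hΨ hce F]
    · rw [if_neg hce, if_neg hce]
  have h3 : (∑ c, if T.Bottom c then (F (lowerRight c) + F (lowerLeft c)) * bit2 κ A t₀ c else 0) =
      ∑ c : T.Box, if T.Bottom c then d c.1.2 * T.boundaryBit κ A t₀ c.1.2 else 0 := by
    refine Finset.sum_congr rfl fun c _ => ?_
    by_cases hc : T.Bottom c
    · rw [if_pos hc, if_pos hc, hc.lowerRight_eq, hc.lowerLeft_eq, bit2_bottom h hΨ hc]
    · rw [if_neg hc, if_neg hc]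
  have h4 : (∑ r, ∑ b, if T.First r b then
        (F (lowerRight b) + F (upperRight b)) * bit3 κ A t₀ b + F (lowerRight b) else 0) =
      (∑ r, ∑ b, if T.First r b then d (T.pivot r) * T.boundaryBit κ A t₀ (T.pivot r) else 0) +
        ∑ r, if T.RowNonempty r then f (T.pivot r + 1) else 0 := by
    rw [← Finset.sum_add_distrib]
    refine Finset.sum_congr rfl fun r _ => ?_
    by_cases hr : T.RowNonempty r
    · obtain ⟨b, hb⟩ := T.exists_first hr
      rw [if_pos hr, sum_first (fun _ => d (T.pivot r) * T.boundaryBit κ A t₀ (T.pivot r)) hb]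
      refine (sum_first _ hb).trans ?_
      rw [hb.lowerRight_eq, hb.upperRight_eq, bit3_first h hΨ hb, hd, add_comm (f _)]
    · rw [if_neg hr, sum_first_of_isolated (fun _ => d (T.pivot r) * T.boundaryBit κ A t₀ (T.pivot r)) hr,
        add_zero]
      exact sum_first_of_isolated _ hr
  -- The final 1 comes from here: exactly one box has L as the corner of its lower right face.
  have h5 : ∑ b, F (lowerRight b) = 1 := by
    simp only [hF, isCorner_lowerRight_iff]
    simp
  have hiso : ∀ r, ¬ T.RowNonempty r → f (T.pivot r + 1) = f (T.pivot r) := fun r hr => by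
    simp only [hf, baseRegion_of_isolated hr]
  have h6 := T.sum_boundary d (T.boundaryBit κ A t₀)
    (fun r hr => by simp only [hd, hiso r hr, htwo])
    (fun j hj hb => by simp only [hd, hf, baseRegion_of_empty hj hb, htwo])
  have h7 : ∑ j, d j = 0 := by rw [hd, sum_fin, hf0, hfn, add_zero]
  -- Summation by parts: each pivot contributes f just after it. The isolated count contributes the
  -- same terms for the isolated rows, and the first boxes contribute those for the other rows, so
  -- that all of them cancel.
  have h8 : ∑ j, d j * (T.pivotCount j : ZMod 2) = ∑ r, f (T.pivot r + 1) := by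
    have e1 : ∀ j : Fin n, d j * (T.pivotCount j : ZMod 2) =
        ∑ r, if (T.pivot r : ℕ) < j then f j + f (j + 1) else 0 := by
      intro j
      rw [pivotCount, Finset.card_filter, Nat.cast_sum, Finset.mul_sum]
      exact Finset.sum_congr rfl fun r _ => by split_ifs <;> simp [hd]
    rw [Finset.sum_congr rfl fun j _ => e1 j, Finset.sum_comm]
    refine Finset.sum_congr rfl fun r _ => ?_
    rw [sum_fin_gt (T.pivot r).isLt, hfn, add_zero]
  have h9 : ∑ j, d j * T.isolatedCount j = ∑ r, if T.RowNonempty r then 0 else f (T.pivot r + 1) := by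
    have e1 : ∀ j : Fin n, d j * T.isolatedCount j = ∑ r, if T.RowNonempty r then 0 else
        (if (j : ℕ) < T.pivot r then f j + f (j + 1) else 0) := by
      intro j
      rw [isolatedCount, Finset.mul_sum]
      refine Finset.sum_congr rfl fun r _ => ?_
      by_cases hr : T.RowNonempty r <;> simp [hr, hd]
    rw [Finset.sum_congr rfl fun j _ => e1 j, Finset.sum_comm]
    refine Finset.sum_congr rfl fun r _ => ?_
    by_cases hr : T.RowNonempty r
    · simp [hr]
    · simp only [hr, if_false]
      rw [sum_fin_lt (T.pivot r).isLt.le, hf0, zero_add, hiso r hr]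
  -- A root x counts for the columns with κ_j < x; the sum of their d_j telescopes to F on the face
  -- that contains x. This cancels the contribution of the divisor points on Γ₀.
  have h10 : ∑ j, d j * rootBit (T.reducedSatoPoly κ A t₀) (κ j) =
      ((T.reducedSatoPoly κ A t₀).roots.map fun x : ℝ => F (T.regionAt κ (.base, (x : WithTop ℝ)))).sum := by
    simp only [rootBit]
    rw [sum_mul_multiset_sum]
    refine congrArg Multiset.sum (Multiset.map_congr rfl fun x _ => ?_)
    obtain ⟨a, ha, ha', hreg⟩ := exists_baseRegion_eq (T := T) h.strictMono x
    have e2 := sum_fin_lt (f := f) ha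
    rw [hf0, zero_add] at e2
    rw [hreg]
    refine Eq.trans (Finset.sum_congr rfl fun j _ => ?_) e2
    simp only [ha', mul_ite, mul_one, mul_zero, hd]
  have h11 : ∑ j, d j * T.boundaryBit κ A t₀ j = ∑ j, d j + ∑ j, d j * (T.pivotCount j : ZMod 2) +
      ∑ j, d j * T.isolatedCount j + ∑ j, d j * rootBit (T.reducedSatoPoly κ A t₀) (κ j) := by
    simp only [← Finset.sum_add_distrib, boundaryBit]
    exact Finset.sum_congr rfl fun j _ => by ring
  have h12 : ∑ r, f (T.pivot r + 1) = (∑ r, if T.RowNonempty r then f (T.pivot r + 1) else 0) +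
      ∑ r, if T.RowNonempty r then 0 else f (T.pivot r + 1) := by
    rw [← Finset.sum_add_distrib]
    exact Finset.sum_congr rfl fun r _ => by split_ifs <;> simp
  change (∑ c, ∑ d, if T.Next c d then F (T.regionAt κ (.white (.inr c),
      ((T.Psi1 κ A (.inr c) t₀ / T.Psi3 κ A (.inr c) t₀ : ℝ) : WithTop ℝ))) else 0) +
    ((T.reducedSatoPoly κ A t₀).roots.map fun x : ℝ => F (T.regionAt κ (.base, (x : WithTop ℝ)))).sum = 1
  rw [h2, h1, h3, h4, h5]
  linear_combination -h6 + h11 + h7 + h8 + h9 + h10 + h12 +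
    htwo (∑ r, if T.RowNonempty r then f (T.pivot r + 1) else 0) +
    htwo (∑ r, if T.RowNonempty r then 0 else f (T.pivot r + 1)) +
    htwo (((T.reducedSatoPoly κ A t₀).roots.map fun x : ℝ =>
      F (T.regionAt κ (.base, (x : WithTop ℝ)))).sum)

end

/-! ### The real points of the divisor -/

/-- The real zeros of the wave function. -/
noncomputable def realPoints (T : LeTableau k n) (κ : Fin n → ℝ) (A : Matrix (Fin k) (Fin n) ℝ)
    (t₀ : KPTime) : Multiset T.RealPoint :=
  ∑ c, (T.numer κ A t₀ c).roots.map fun x : ℝ => (c, (x : WithTop ℝ))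

open Classical in
theorem card_eq_countP_add {β : Type*} [Fintype β] {α : Type*} (p : α → β → Prop)
    (hp : ∀ a b b', p a b → p a b' → b = b') (M : Multiset α) :
    M.card = M.countP (fun a => ∀ b, ¬ p a b) + ∑ b, M.countP fun a => p a b := by
  induction M using Multiset.induction_on with
  | empty => simp
  | cons a M ih =>
    simp only [Multiset.card_cons, Multiset.countP_cons, Finset.sum_add_distrib]
    have h1 : (if ∀ b, ¬ p a b then 1 else 0) + ∑ b, (if p a b then 1 else 0) = 1 := by
      by_cases hex : ∃ b, p a b
      · obtain ⟨b, hb⟩ := hex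
        rw [if_neg fun h => h b hb, zero_add, Finset.sum_eq_single b, if_pos hb]
        · intro c _ hc; exact if_neg fun h => hc (hp a _ _ h hb)
        · simp
      · push Not at hex
        rw [if_pos hex, Finset.sum_eq_zero fun b _ => if_neg (hex b), add_zero]
    omega

section

variable {t₀ : KPTime} (h : T.Regular κ A) (hΨ : T.DressedNonvanishing κ A t₀)
include h hΨ

open Classical in
theorem natCast_countP_realPoints (L : T.Box) :
    ((T.realPoints κ A t₀).countP fun x => IsCorner (T.regionAt κ x) L : ZMod 2) = 1 := by
  rw [natCast_countP, realPoints, ← Multiset.coe_mapAddMonoidHom, map_sum,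
    ← Multiset.coe_sumAddMonoidHom, map_sum]
  simp only [Multiset.coe_mapAddMonoidHom, Multiset.coe_sumAddMonoidHom, Multiset.map_map]
  rw [sum_component]
  have h1 : ∀ r, (T.numer κ A t₀ (.white (.inl r))).roots = 0 := by
    intro r
    by_cases hr : T.RowNonempty r
    · rw [h.numer_source hr, Polynomial.roots_C]
    · rw [numer_isolated hr, Polynomial.roots_C]
  have h2 : ∀ b, (T.numer κ A t₀ (.black b)).roots = 0 := by
    intro b; rw [numer, Polynomial.roots_C]
  simp only [h1, h2, Multiset.map_zero, Multiset.sum_zero, Finset.sum_const_zero, zero_add, add_zero]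
  rw [add_comm]
  refine Eq.trans ?_ (parity_corner h hΨ L)
  refine congrArg₂ (· + ·) (Finset.sum_congr rfl fun c _ => ?_) rfl
  by_cases hc : T.HasLeft (.inr c)
  · rw [numer_of_hasLeft hc, Polynomial.roots_linear_sub (hΨ.psi3 c)]
    obtain ⟨d, hd⟩ := hc
    rw [sum_next (fun _ => if IsCorner (T.regionAt κ (.white (.inr c),
      ((T.Psi1 κ A (.inr c) t₀ / T.Psi3 κ A (.inr c) t₀ : ℝ) : WithTop ℝ))) L then (1 : ZMod 2) else 0) hd]
    simp
  · rw [numer_box_of_not_hasLeft hc, Polynomial.roots_C]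
    simp only [Multiset.map_zero, Multiset.sum_zero]
    exact (sum_next_of_not_hasLeft _ hc).symm

theorem card_realPoints_le : (T.realPoints κ A t₀).card ≤ T.dim := by
  rw [← sum_natDegree_numer h hΨ, realPoints, Multiset.card_sum]
  refine Finset.sum_le_sum fun c _ => ?_
  rw [Multiset.card_map]
  exact Polynomial.card_roots' (T.numer κ A t₀ c)

open Classical in
-- A pigeonhole argument: there are at most g real points, and by parity at least one for each of
-- the g boxes. Equality holds throughout, so none is left for the infinite oval or for non-real
-- zeros.
theorem countP_realPoints : (T.realPoints κ A t₀).card = T.dim ∧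
    ((T.realPoints κ A t₀).countP fun x => ∀ L, ¬ IsCorner (T.regionAt κ x) L) = 0 ∧
    ∀ L, ((T.realPoints κ A t₀).countP fun x => IsCorner (T.regionAt κ x) L) = 1 := by
  have h1 := card_eq_countP_add (fun x L => IsCorner (T.regionAt κ x) L)
    (fun x L L' hL hL' => hL.unique hL') (T.realPoints κ A t₀)
  have h2 := card_realPoints_le h hΨ
  have h3 : ∀ L, 1 ≤ ((T.realPoints κ A t₀).countP fun x => IsCorner (T.regionAt κ x) L) := by
    intro L
    rw [Nat.one_le_iff_ne_zero]
    intro h0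
    have := natCast_countP_realPoints h hΨ L
    rw [h0] at this
    exact absurd this (by decide)
  have h4 : T.dim = ∑ _L : T.Box, 1 := by simp [dim]
  have h5 := Finset.sum_le_sum fun L (_ : L ∈ Finset.univ) => h3 L
  have h6 : ∑ _L : T.Box, 1 = ∑ L, ((T.realPoints κ A t₀).countP fun x => IsCorner (T.regionAt κ x) L) := by
    omega
  refine ⟨by omega, by omega, fun L => ?_⟩
  exact ((Finset.sum_eq_sum_iff_of_le fun L _ => h3 L).1 h6 L (Finset.mem_univ _)).symm

theorem card_roots_numer (c : T.Component) :
    (T.numer κ A t₀ c).roots.card = (T.numer κ A t₀ c).natDegree := by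
  have h1 := (countP_realPoints h hΨ).1
  rw [← sum_natDegree_numer h hΨ, realPoints, Multiset.card_sum] at h1
  simp only [Multiset.card_map] at h1
  exact (Finset.sum_eq_sum_iff_of_le fun c _ => Polynomial.card_roots' (T.numer κ A t₀ c)).1 h1 c (Finset.mem_univ _)

theorem exists_real_of_eval_numer_eq_zero (c : T.Component) (z : ℂ)
    (hz : ((T.numer κ A t₀ c).map (algebraMap ℝ ℂ)).eval z = 0) : ∃ x : ℝ, (x : ℂ) = z := by
  have h1 := Polynomial.roots_map_of_injective_of_card_eq_natDegree (algebraMap ℝ ℂ).injective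
    (card_roots_numer h hΨ c)
  have h2 : z ∈ ((T.numer κ A t₀ c).map (algebraMap ℝ ℂ)).roots :=
    (Polynomial.mem_roots (map_ne_zero_of_ne_zero (numer_ne_zero h hΨ c))).2 hz
  rw [← h1, Multiset.mem_map] at h2
  obtain ⟨x, -, hx⟩ := h2
  exact ⟨x, hx⟩

variable (hΦ : T.VacuumNonvanishing κ t₀)
include hΦ

open Classical in
theorem kpDivisor_eq_count_realPoints (x : T.RealPoint) :
    T.kpDivisor κ A t₀ x.toPoint = ((T.realPoints κ A t₀).count x : ℤ) := by
  obtain ⟨c, x⟩ := x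
  induction x using WithTop.recTopCoe with
  | top =>
    rw [toPoint_top, kpDivisor_infty h hΦ hΨ, Multiset.count_eq_zero_of_notMem]
    · rfl
    · rw [realPoints, Multiset.mem_sum]
      rintro ⟨d, -, hd⟩
      obtain ⟨y, -, hy⟩ := Multiset.mem_map.1 hd
      exact WithTop.coe_ne_top (Prod.ext_iff.1 hy).2
  | coe x =>
    have hinj : ∀ d : T.Component, Function.Injective fun y : ℝ => ((d, (y : WithTop ℝ)) : T.RealPoint) :=
      fun d y z hyz => WithTop.coe_inj.1 (Prod.ext_iff.1 hyz).2
    rw [toPoint_coe, kpDivisor_coe h hΦ hΨ, realPoints, Multiset.count_sum',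
      Finset.sum_eq_single c]
    · rw [Multiset.count_map_eq_count' _ _ (hinj c), Polynomial.count_roots]
      congr 1
      exact (Polynomial.eq_rootMultiplicity_map (algebraMap ℝ ℂ).injective x).symm
    · intro d _ hd
      rw [Multiset.count_eq_zero]
      intro hx
      obtain ⟨y, -, hy⟩ := Multiset.mem_map.1 hx
      exact hd (Prod.ext_iff.1 hy).1
    · simp

theorem isRealRegular_kpDivisor : T.IsRealRegular κ (T.kpDivisor κ A t₀) := by
  classical
  obtain ⟨-, h0, h1⟩ := countP_realPoints h hΨ
  have hnode : ∀ x : T.RealPoint, T.kpDivisor κ A t₀ x.toPoint ≠ 0 → ¬ T.IsNode κ x :=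
    fun x hx hn => hx (kpDivisor_node h hΦ hΨ hn)
  refine ⟨fun P hP => ?_, fun x hx => ?_⟩
  · obtain ⟨c, p⟩ := P
    induction p using OnePoint.rec with
    | infty => exact absurd (kpDivisor_infty h hΦ hΨ c) hP
    | coe z =>
      have hz : ((T.numer κ A t₀ c).map (algebraMap ℝ ℂ)).eval z = 0 := by
        by_contra h'
        rw [kpDivisor_coe h hΦ hΨ, Polynomial.rootMultiplicity_eq_zero h'] at hP
        exact hP rfl
      obtain ⟨y, rfl⟩ := exists_real_of_eval_numer_eq_zero h hΨ c z hz
      refine ⟨(c, (y : WithTop ℝ)), ?_, toPoint_coe c y⟩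
      rw [← toPoint_coe] at hP
      have hn := hnode _ hP
      rw [kpDivisor_eq_count_realPoints h hΨ hΦ] at hP
      have hmem : ((c, (y : WithTop ℝ)) : T.RealPoint) ∈ T.realPoints κ A t₀ :=
        Multiset.count_ne_zero.1 (by exact_mod_cast hP)
      have h3 := Multiset.countP_eq_zero.1 h0 _ hmem
      push Not at h3
      obtain ⟨L, hL⟩ := h3
      exact onFiniteOval_of_isCorner h.strictMono hn hL
  · obtain ⟨L, hL⟩ := hx.exists_isCorner h.strictMono
    have h2 := h1 L
    rw [Multiset.countP_eq_card_filter, Multiset.card_eq_one] at h2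
    obtain ⟨y, hy⟩ := h2
    have hmem : ∀ z, z ∈ T.realPoints κ A t₀ ∧ IsCorner (T.regionAt κ z) L ↔ z = y := by
      intro z
      rw [← Multiset.mem_filter (p := fun x => IsCorner (T.regionAt κ x) L), hy, Multiset.mem_singleton]
    have hyL : IsCorner (T.regionAt κ y) L := ((hmem y).2 rfl).2
    have hD : T.kpDivisor κ A t₀ y.toPoint = 1 := by
      rw [kpDivisor_eq_count_realPoints h hΨ hΦ,
        ← Multiset.count_filter_of_pos (p := fun x => IsCorner (T.regionAt κ x) L) hyL, hy]
      simp
    refine ⟨y, ?_, hD, fun z hz hDz => (hmem z).1 ⟨?_, ?_⟩⟩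
    · exact .trans _ _ _ ((sameOval_cornerPoint_iff h.strictMono hx.1 L).2 hL)
        (.symm _ _ ((sameOval_cornerPoint_iff h.strictMono (hnode y (by rw [hD]; exact one_ne_zero)) L).2 hyL))
    · rw [kpDivisor_eq_count_realPoints h hΨ hΦ] at hDz
      exact Multiset.count_ne_zero.1 (by exact_mod_cast hDz)
    · rw [← hz.regionAt_eq h.strictMono]; exact hL

end

end LeTableau

/-! ### Existence of admissible times -/

namespace LeTableau

variable {k n : ℕ} {T : LeTableau k n} {κ : Fin n → ℝ} {A : Matrix (Fin k) (Fin n) ℝ}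

theorem boxVec_ne_zero (b : T.Box) : T.boxVec b ≠ 0 :=
  fun h => T.boxVec_self_ne b (congrFun h _)

theorem vec1_ne_zero {v : T.White} (hv : T.HasLeft v) : T.vec1 v ≠ 0 := by
  rcases v with r | b
  · obtain ⟨b, hb⟩ := T.exists_first hv
    rw [vec1_first hb]
    exact smul_ne_zero b.2 (boxVec_ne_zero b)
  · obtain ⟨b', hb'⟩ := hv
    rw [vec1_next hb']
    exact smul_ne_zero b'.2 (boxVec_ne_zero b')

theorem vec2_ne_zero (v : T.White) : T.vec2 v ≠ 0 := by
  rcases v with r | b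
  · rw [vec2]; simp
  · rcases T.bottom_or_below b with hb | ⟨c, hc⟩
    · rw [vec2_bottom hb]
      exact smul_ne_zero (T.rowSign_ne_zero _ _) (by simp)
    · rw [vec2_below_eq_smul hc]
      exact smul_ne_zero (mul_ne_zero (neg_one_pow_ne_zero _) (neg_one_pow_ne_zero _))
        (boxVec_ne_zero c)

theorem vec2_box_pivot (b : T.Box) (r : Fin k) : T.vec2 (.inr b) (T.pivot r) = 0 := by
  rcases T.bottom_or_below b with hb | ⟨c, hc⟩
  · rw [vec2_bottom hb, Pi.smul_apply, Pi.single_eq_of_ne (T.not_pivot b r), smul_zero]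
  · rw [vec2_below_eq_smul hc, Pi.smul_apply, boxVec_eq_zero _ _ (.inr ⟨r, rfl⟩), smul_zero]

theorem vec3_ne_zero (v : T.White) : T.vec3 v ≠ 0 := by
  rcases v with r | b
  · rw [← matrix_row]
    refine fun h => one_ne_zero (α := ℝ) ?_
    have := congrFun h (T.pivot r)
    rwa [matrix_pivot, if_pos rfl] at this
  · rw [vec3_box]; exact boxVec_ne_zero b

theorem eventually_vacuumNonvanishing (T : LeTableau k n) (hκ : StrictMono κ) (t : KPTime) :
    ∀ᶠ x in cofinite, T.VacuumNonvanishing κ (shiftX t x) := by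
  have h1 : ∀ {v : Fin n → ℝ}, v ≠ 0 → ∀ᶠ x in cofinite, expSum κ v (shiftX t x) ≠ 0 := by
    intro v hv
    rw [eventually_cofinite]
    simpa using finite_zeros_expSum hκ.injective hv t
  refine eventually_all.2 fun v => ?_
  have h2 : ∀ᶠ x in cofinite, T.HasLeft v → T.Phi1 κ v (shiftX t x) ≠ 0 := by
    by_cases hv : T.HasLeft v
    · filter_upwards [h1 (vec1_ne_zero hv)] with x hx _ using hx
    · exact Eventually.of_forall fun x hv' => absurd hv' hv
  exact h2.and ((h1 (vec2_ne_zero v)).and (h1 (vec3_ne_zero v)))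

/-- Each condition excludes finitely many x by the behaviour at −∞. That argument fails for values
at the pivots of non-isolated rows, where the limit polynomial vanishes, so these are obtained from
the edge to the left. -/
theorem Regular.eventually_dressedNonvanishing (h : T.Regular κ A) (t : KPTime) :
    ∀ᶠ x in cofinite, T.DressedNonvanishing κ A (shiftX t x) := by
  have h1 : ∀ {v : Fin n → ℝ}, v ≠ 0 → (∀ r, v (T.pivot r) = 0) →
      ∀ᶠ x in cofinite, dressedSum κ (satoPoly κ A) v (shiftX t x) ≠ 0 := by
    intro v hv hp
    rw [eventually_cofinite, h.sato]
    simpa using T.finite_zeros_dressedSum_of_ne_zero h.strictMono h.wronskian_ne hv hp t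
  have h2 : ∀ {z : ℝ}, (∀ r, T.RowNonempty r → z ≠ κ (T.pivot r)) →
      ∀ᶠ x in cofinite, (T.reducedSatoPoly κ A (shiftX t x)).eval z ≠ 0 := by
    intro z hz
    rw [eventually_cofinite, h.reduced]
    simpa using T.finite_zeros_reducedSatoPoly h.strictMono h.wronskian_ne t hz
  have hpsi1 : ∀ᶠ x in cofinite, ∀ v, T.HasLeft v → T.Psi1 κ A v (shiftX t x) ≠ 0 := by
    refine eventually_all.2 fun v => ?_
    by_cases hv : T.HasLeft v
    · filter_upwards [h1 (vec1_ne_zero hv) fun r => vec1_eq_zero_of_pivot _ _ ⟨r, rfl⟩] with x hx _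
        using hx
    · exact Eventually.of_forall fun x hv' => absurd hv' hv
  have hpsi2 : ∀ᶠ x in cofinite, ∀ b : T.Box, T.Psi2 κ A (.inr b) (shiftX t x) ≠ 0 :=
    eventually_all.2 fun b => h1 (vec2_ne_zero _) (vec2_box_pivot b)
  have hpsi3 : ∀ᶠ x in cofinite, ∀ b : T.Box, T.Psi3 κ A (.inr b) (shiftX t x) ≠ 0 :=
    eventually_all.2 fun b => h1 (vec3_ne_zero _) fun r => by
      rw [vec3_box, boxVec_eq_zero _ _ (.inr ⟨r, rfl⟩)]
  have hiso : ∀ᶠ x in cofinite, ∀ r, ¬ T.RowNonempty r →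
      (T.reducedSatoPoly κ A (shiftX t x)).eval (κ (T.pivot r)) ≠ 0 := by
    refine eventually_all.2 fun r => ?_
    by_cases hr : T.RowNonempty r
    · exact Eventually.of_forall fun x hr' => absurd hr hr'
    · have hz : ∀ s, T.RowNonempty s → κ (T.pivot r) ≠ κ (T.pivot s) := fun s hs hrs =>
        hr ((T.pivot_strictMono.injective (h.strictMono.injective hrs)).symm ▸ hs)
      filter_upwards [h2 hz] with x hx _ using hx
  have hcol : ∀ᶠ x in cofinite, ∀ b : T.Box,
      (T.reducedSatoPoly κ A (shiftX t x)).eval (κ b.1.2) ≠ 0 :=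
    eventually_all.2 fun b => h2 fun s _ hs => T.not_pivot b s (h.strictMono.injective hs).symm
  filter_upwards [hpsi1, hpsi2, hpsi3, hiso, hcol] with x h1 h2 h3 h4 h5
  -- At a source Ψ2 = −Ψ1, and the vector of Ψ1 has no pivot entries. Since Ψ2 = e^θ q S' at the
  -- pivot, this also gives S' ≠ 0 there.
  have hsource : ∀ r, T.RowNonempty r → T.Psi2 κ A (.inl r) (shiftX t x) ≠ 0 := by
    intro r hr h0
    refine h1 (.inl r) hr ?_
    rw [h.Psi1_source, h0, neg_zero]
  refine ⟨h1, fun v hv => ?_, h3, fun r => ?_, h5⟩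
  · rcases v with r | b
    · exact hsource r hv
    · exact h2 b
  · by_cases hr : T.RowNonempty r
    · have h6 := hsource r hr
      rw [Psi2_source, h.sato_eval] at h6
      exact right_ne_zero_of_mul (right_ne_zero_of_mul h6)
    · exact h4 r hr

theorem Regular.exists_admissible (h : T.Regular κ A) :
    ∃ x₀ : ℝ, ∀ x > x₀, T.Admissible κ A (Finsupp.single 0 x) := by
  have h1 : ∀ᶠ x in atTop, T.Admissible κ A (shiftX 0 x) := by
    -- Only finitely many x are excluded, so all large ones are admissible.
    refine Filter.Eventually.filter_mono atTop_le_cofinite ?_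
    filter_upwards [T.eventually_vacuumNonvanishing h.strictMono 0,
      h.eventually_dressedNonvanishing 0] with x h1 h2
    exact admissible_of_nonvanishing h1 h2
  obtain ⟨x₀, hx₀⟩ := eventually_atTop.1 h1
  refine ⟨x₀, fun x hx => ?_⟩
  have := hx₀ x hx.le
  rwa [shiftX, zero_add] at this

end LeTableau

theorem theorem3p2 {k n : ℕ} (κ : Fin n → ℝ) (hκ : StrictMono κ)
    (A : Matrix (Fin k) (Fin n) ℝ) (hA : IsTotallyNonneg A)
    (T : LeTableau k n) (hT : T.Represents A) :
    (∃ x₀ : ℝ, ∀ x > x₀, T.Admissible κ A (Finsupp.single 0 x)) ∧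
    ∀ t₀ : KPTime, T.Admissible κ A t₀ →
      (∀ P : T.Point, MeromorphicAtPoint (fun ζ => T.dressedWave κ A t₀ P.1 ζ t₀) P.2 ∧
        orderAtPoint (fun ζ => T.dressedWave κ A t₀ P.1 ζ t₀) P.2 ≠ ⊤) ∧
      T.IsEffectiveOfDegree κ (T.kpDivisor κ A t₀) T.dim ∧
      T.IsNonspecial κ (T.kpDivisor κ A t₀) ∧
      T.RestrictsToSato κ A t₀ (T.kpDivisor κ A t₀) ∧
      T.IsRealRegular κ (T.kpDivisor κ A t₀) ∧
      T.IsKPWaveFunction κ A t₀ (T.kpDivisor κ A t₀) (T.kpWave κ A t₀) := by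
  have h := hT.regular hκ hA
  refine ⟨h.exists_admissible, fun t₀ ht => ?_⟩
  have hΦ := ht.vacuumNonvanishing
  have hΨ := ht.dressedNonvanishing
  refine ⟨fun P => ⟨LeTableau.meromorphicAtPoint_dressedWave hΦ P, ?_⟩,
    LeTableau.isEffectiveOfDegree_kpDivisor h hΦ hΨ, LeTableau.isNonspecial_kpDivisor h hΦ hΨ,
    LeTableau.restrictsToSato_kpDivisor h hΦ hΨ, LeTableau.isRealRegular_kpDivisor h hΨ hΦ,
    LeTableau.isKPWaveFunction_kpWave h hΦ hΨ
      (LeTableau.exists_real_of_eval_numer_eq_zero h hΨ)⟩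
  rw [LeTableau.orderAtPoint_dressedWave h hΦ hΨ]
  exact WithTop.coe_ne_top
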